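/- **Setting.** Let $a<b$ and let $\mu$ be a self-similar probability measure on $\mathbb R$, i.e. $\mu=\sum_{i=1}^q p_i\,\mu\circ S_i^{-1}$ with $p_i>0$, $\sum_i p_i=1$, where $S_i(x)=c_ix+s_i$, $0<|c_i|<1$. Assume $\operatorname{supp}\mu=[a,b]$. Let $T_j(x)=r^{n_j}x+d_j$ ($1\le j\le N$, $0<r<1$, integers $n_j\ge1$, $d_j\in\mathbb R$) be an auxiliary IFS satisfying the open set condition, and put $\rho:=\max_j r^{n_j}$. Assume that $\mu$ satisfies a family of second-order self-similar identities with respect to $\{T_j\}$: $\operatorname{supp}\mu\subseteq\bigcup_jT_j(\operatorname{supp}\mu)$, and there are real $N\times N$ matrices $M_1,\dots,M_N$ such that $\mu(T_iT_jB)=\sum_k (M_j)_{ik}\,\mu(T_kB)$ for all $i,j$ and all Borel $B\subseteq\operatorname{supp}\mu$. Let $(u,v)_\mu=\int uv\,d\mu$, with norm $\|\cdot\|_\mu$ on $L^2_\mu[a,b]$. Let $\operatorname{Dom}\mathcal E$ be the orthogonal complement in $H^1_0(a,b)$ of $\{u:\|u\|_\mu=0\}$ (elements of $H_0^1(a,b)$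 being identified with their continuous representatives), $\mathcal E(u,v)=\int_a^bu'v'\,dx$ and $\|u\|_{\operatorname{Dom}\mathcal E}=\mathcal E(u,u)^{1/2}$. Identify $w\in L^2_\mu[a,b]$ with $(w,\cdot)_\mu\in(\operatorname{Dom}\mathcal E)'$. For $T>0$ and $g,h\in\operatorname{Dom}\mathcal E$, a *weak solution* of $u_{tt}-\Delta_\mu u=0$ on $[a,b]\times[0,T]$ with $u=0$ on $\{a,b\}\times[0,T]$, $u(\cdot,0)=g$, $u_t(\cdot,0)=h$, is a function $u\in L^2(0,T;\operatorname{Dom}\mathcal E)$ with weak derivatives $u_t\in L^2(0,T;L^2_\mu[a,b])$ and $u_{tt}\in L^2(0,T;(\operatorname{Dom}\mathcal E)')$ such that for each $v\in\operatorname{Dom}\mathcal E$, $\langle u_{tt},v\rangle+\mathcal E(u,v)=0$ for a.e. $t\in[0,T]$, and $u(0)=g$, $u_t(0)=h$. Here $u$ and $u_t$ denote the representatives that are continuous on $[0,T]$ with values in $L^2_\mu[a,b]$ and $(\operatorname{Dom}\mathcal E)'$ respectively, and $u(t)\in\operatorname{Dom}\mathcal E$ for every $t$. For $m\ge1$ let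 $a=x_0<x_1<\dots<x_{N^m}=b$ be the end-points of the intervals $T_{j_1}\cdots T_{j_m}[a,b]$, and let $\phi_1,\dots,\phi_{N^m-1}$ be the continuous piecewise linear tent functions with $\phi_i(x_k)=\delta_{ik}$. The *finite element approximation* is $u^m(x,t)=\sum_{j=1}^{N^m-1}\beta_j(t)\phi_j(x)$, where the $C^2$ functions $\beta_j$ satisfy, for $1\le i\le N^m-1$ and $t\in[0,T]$, $$\sum_j\beta_j''(t)\int_a^b\phi_i\phi_j\,d\mu=-\sum_j\beta_j(t)\int_a^b\phi_i'\phi_j'\,dx,\qquad \beta_i(0)=g(x_i),\quad \beta_i'(0)=h(x_i).$$ **Theorem.** In this setting: 1. For all $T>0$, all $g,h\in\operatorname{Dom}\mathcal E$ and every $t\in[0,T]$, $u^m(\cdot,t)$ converges to the weak solution $u(\cdot,t)$ in $L^2_\mu[a,b]$ as $m\to\infty$. 2. For every $T>0$ there is a constant $C>0$, depending only on $\mu$, on the auxiliary IFS and on $T$, such that for all $g,h\in\operatorname{Dom}\mathcal E$ whose weak solution satisfies $u_{tt}\in L^2(0,T;\operatorname{Dom}\mathcal E)$, all $m\ge1$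 and all $t\in[0,T]$, $$\|u^m(\cdot,t)-u(\cdot,t)\|_\mu\le\Big(C\sqrt T\,\|u_{tt}\|_{L^2(0,T;\operatorname{Dom}\mathcal E)}+2\,\|u(\cdot,t)\|_{\operatorname{Dom}\mathcal E}\Big)\rho^{m/2}.$$ 3. There is a constant $C>0$, depending only on $\mu$ and the auxiliary IFS (and not on $T$), such that for all $T>0$, $g,h$, $m$, $t$ as in 2, $$\|u^m(\cdot,t)-u(\cdot,t)\|_\mu\le\Big(C\sqrt T\,\|u_{tt}\|_{L^2(0,T;\operatorname{Dom}\mathcal E)}+2\sqrt{b-a}\,\|u(\cdot,t)\|_{\operatorname{Dom}\mathcal E}\Big)\rho^{m/2}.$$ -/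

import Mathlib

open MeasureTheory Set
open scoped ContDiff ENNReal

namespace FractalWave

noncomputable section

/-! ### Self-similar measures and auxiliary iterated function systems on the line -/

/-- `μ` is the self-similar measure of an IFS of contractive similitudes
`S i x = c i * x + s i` of the line (contraction ratio `|c i|`, orthogonal part `sign (c i)`)
with probability weights `p i`: the probability measure `μ` satisfies
`μ = ∑ i, p i • (μ ∘ (S i)⁻¹)`. -/
structure IsSelfSimilar (μ : Measure ℝ) [IsProbabilityMeasure μ] {q : ℕ}
    (c s p : Fin q → ℝ) : Prop where
  ratio_pos : ∀ i, 0 < |c i|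
  ratio_lt_one : ∀ i, |c i| < 1
  weight_pos : ∀ i, 0 < p i
  weight_sum : ∑ i, p i = 1
  invariant : μ = ∑ i, ENNReal.ofReal (p i) • μ.map (fun x => c i * x + s i)

/-- An IFS of the form `T j x = r ^ (n j) * x + d j`, with `0 < r < 1` and `n j ≥ 1`. -/
structure AuxIFS (N : ℕ) where
  r : ℝ
  r_pos : 0 < r
  r_lt_one : r < 1
  n : Fin N → ℕ
  n_pos : ∀ j, 1 ≤ n j
  d : Fin N → ℝ

namespace AuxIFS

variable {N : ℕ} (A : AuxIFS N)

/-- The map `T j`. -/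
def T (j : Fin N) (x : ℝ) : ℝ := A.r ^ A.n j * x + A.d j

/-- The largest contraction ratio `ρ = max_j r ^ (n j)`. -/
def rho : ℝ := ⨆ j, A.r ^ A.n j

/-- The open set condition. -/
def OpenSetCondition : Prop :=
  ∃ U : Set ℝ, IsOpen U ∧ U.Nonempty ∧ Bornology.IsBounded U ∧
    (∀ j, A.T j '' U ⊆ U) ∧ ∀ i j, i ≠ j → Disjoint (A.T i '' U) (A.T j '' U)

/-- `μ` satisfies a family of second-order self-similar identities with respect to the IFS. -/
def SecondOrderIdentities (μ : Measure ℝ) : Prop :=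
  μ.support ⊆ ⋃ j, A.T j '' μ.support ∧
  ∃ M : Fin N → Matrix (Fin N) (Fin N) ℝ, ∀ B : Set ℝ, MeasurableSet B → B ⊆ μ.support →
    ∀ i j, μ.real (A.T i '' (A.T j '' B)) = ∑ k, M j i k * μ.real (A.T k '' B)

/-- `T_J = T_{j₁} ∘ ⋯ ∘ T_{j_m}` for a multi-index `J = (j₁, …, j_m)`. -/
def comp {m : ℕ} (J : Fin m → Fin N) (x : ℝ) : ℝ :=
  (List.ofFn J).foldr (fun j y => A.T j y) x

/-- The set `V_m` of end-points of all the level-`m` intervals `T_J [a, b]`, `|J| = m`. -/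
def vertices (a b : ℝ) (m : ℕ) : Finset ℝ :=
  Finset.univ.biUnion fun J : Fin m → Fin N => {A.comp J a, A.comp J b}

/-- The nodes `x_0 < x_1 < ⋯`: the elements of `V_m` in increasing order. (The default value
`b` is only used beyond the last node.) -/
def node (a b : ℝ) (m i : ℕ) : ℝ := ((A.vertices a b m).sort (· ≤ ·)).getD i b

/-- The tent function `φ_j` with nodes `V_m`, for an interior node (`1 ≤ j ≤ N ^ m - 1`). -/
def tent (a b : ℝ) (m j : ℕ) (x : ℝ) : ℝ :=
  let l := A.node a b m (j - 1)
  let c := A.node a b m j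
  let r := A.node a b m (j + 1)
  if l ≤ x ∧ x ≤ c then (x - l) / (c - l)
  else if c ≤ x ∧ x ≤ r then (x - r) / (c - r)
  else 0

/-- The indices `1, …, N ^ m - 1` of the interior nodes. -/
def interior (N m : ℕ) : Finset ℕ := Finset.Ioo 0 (N ^ m)

/-- Mass matrix `M_{ij} = ∫ φ_i φ_j dμ`. -/
def mass (μ : Measure ℝ) (a b : ℝ) (m i j : ℕ) : ℝ :=
  ∫ x in Icc a b, A.tent a b m i x * A.tent a b m j x ∂μ

/-- Stiffness matrix `K_{ij} = -∫ φ_i' φ_j' dx`. -/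
def stiffness (a b : ℝ) (m i j : ℕ) : ℝ :=
  -∫ x in a..b, deriv (A.tent a b m i) x * deriv (A.tent a b m j) x

/-- The finite element approximation `u^m(x, t) = ∑_j β_j(t) φ_j(x)`. -/
def femSum (a b : ℝ) (m : ℕ) (β : ℕ → ℝ → ℝ) (t x : ℝ) : ℝ :=
  ∑ j ∈ interior N m, β j t * A.tent a b m j x

/-- The coefficient functions `β_1, …, β_{N^m - 1}` solve the finite element system of level `m`
for the homogeneous wave equation with initial data `g`, `h`:
`∑_j β_j'' ∫ φ_i φ_j dμ = -∑_j β_j ∫ φ_i' φ_j' dx` on `[0, τ]`,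
`β_i(0) = g(x_i)` and `β_i'(0) = h(x_i)`. -/
structure IsFEMSolution (μ : Measure ℝ) (a b τ : ℝ) (g h : ℝ → ℝ) (m : ℕ)
    (β : ℕ → ℝ → ℝ) : Prop where
  contDiff : ∀ i ∈ interior N m, ContDiff ℝ 2 (β i)
  ode : ∀ t ∈ Icc 0 τ, ∀ i ∈ interior N m,
    ∑ j ∈ interior N m, A.mass μ a b m i j * iteratedDeriv 2 (β j) t =
      ∑ j ∈ interior N m, A.stiffness a b m i j * β j t
  init_pos : ∀ i ∈ interior N m, β i 0 = g (A.node a b m i)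
  init_vel : ∀ i ∈ interior N m, deriv (β i) 0 = h (A.node a b m i)

end AuxIFS

/-! ### The Sobolev space, the Dirichlet form and its domain -/

/-- `L²(a, b)` with respect to Lebesgue measure. -/
abbrev L2 (a b : ℝ) := Lp ℝ 2 (volume.restrict (Ioo a b))

/-- The pairs `(φ, φ')`, with `φ ∈ C_c^∞(a, b)`, in `L²(a, b) × L²(a, b)`. The inner product of
the ambient space restricts to the `H¹` inner product `∫ u v + ∫ u' v'`. -/
def testPairs (a b : ℝ) : Set (WithLp 2 (L2 a b × L2 a b)) :=
  {w | ∃ φ : ℝ → ℝ, ContDiff ℝ ∞ φ ∧ HasCompactSupport φ ∧ tsupport φ ⊆ Ioo a b ∧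
    w.fst =ᵐ[volume.restrict (Ioo a b)] φ ∧ w.snd =ᵐ[volume.restrict (Ioo a b)] deriv φ}

/-- `H₀¹(a, b)`, the completion of `C_c^∞(a, b)` in `H¹(a, b)`. An element is the pair of a
function `u` and its weak derivative `u'`. -/
def H01 (a b : ℝ) : Submodule ℝ (WithLp 2 (L2 a b × L2 a b)) :=
  (Submodule.span ℝ (testPairs a b)).topologicalClosure

/-- The weak derivative `u'` of `u ∈ H₀¹(a, b)`. -/
def wderiv {a b : ℝ} (u : H01 a b) : L2 a b := (u : WithLp 2 (L2 a b × L2 a b)).snd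

/-- The continuous representative `x ↦ ∫_a^x u'` of `u ∈ H₀¹(a, b)`. -/
def contRep {a b : ℝ} (u : H01 a b) (x : ℝ) : ℝ :=
  ∫ y in a..x, wderiv u y ∂(volume.restrict (Ioo a b))

theorem integrable_wderiv {a b : ℝ} (u : H01 a b) :
    Integrable (wderiv u) (volume.restrict (Ioo a b)) :=
  (Lp.memLp (wderiv u)).integrable (by norm_num)

theorem continuous_contRep {a b : ℝ} (u : H01 a b) : Continuous (contRep u) :=
  intervalIntegral.continuous_primitive
    (fun _ _ => (integrable_wderiv u).intervalIntegrable) a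

theorem wderiv_add {a b : ℝ} (u v : H01 a b) : wderiv (u + v) = wderiv u + wderiv v := rfl

theorem wderiv_smul {a b : ℝ} (c : ℝ) (u : H01 a b) : wderiv (c • u) = c • wderiv u := rfl

theorem contRep_add {a b : ℝ} (u v : H01 a b) : contRep (u + v) = contRep u + contRep v := by
  funext x
  simp only [contRep, wderiv_add, Pi.add_apply]
  rw [← intervalIntegral.integral_add (integrable_wderiv u).intervalIntegrable
    (integrable_wderiv v).intervalIntegrable]
  apply intervalIntegral.integral_congr_ae
  filter_upwards [Lp.coeFn_add (wderiv u) (wderiv v)] with y hy _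
  simpa using hy

theorem contRep_smul {a b : ℝ} (c : ℝ) (u : H01 a b) : contRep (c • u) = c • contRep u := by
  funext x
  simp only [contRep, wderiv_smul, Pi.smul_apply]
  rw [← intervalIntegral.integral_smul (𝕜 := ℝ) c]
  apply intervalIntegral.integral_congr_ae
  filter_upwards [Lp.coeFn_smul c (wderiv u)] with y hy _
  simpa using hy

theorem abs_contRep_le {a b : ℝ} (u : H01 a b) (x : ℝ) :
    |contRep u x| ≤ √(b - a) * ‖u‖ := by
  have h1 : |contRep u x| ≤ ∫ y, ‖wderiv u y‖ ∂(volume.restrict (Ioo a b)) := by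
    have h0 := intervalIntegral.norm_integral_le_integral_norm_uIoc (a := a) (b := x)
      (f := fun y => wderiv u y) (μ := volume.restrict (Ioo a b))
    rw [← Real.norm_eq_abs]
    refine h0.trans ?_
    exact setIntegral_le_integral (integrable_wderiv u).norm
      (Filter.Eventually.of_forall fun _ => norm_nonneg _)
  have h2 : ∫ y, ‖wderiv u y‖ ∂(volume.restrict (Ioo a b)) ≤ √(b - a) * ‖wderiv u‖ := by
    have e := eLpNorm_le_eLpNorm_mul_rpow_measure_univ (p := 1) (q := 2)
      (μ := volume.restrict (Ioo a b)) (by norm_num) (Lp.aestronglyMeasurable (wderiv u))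
    rw [integral_norm_eq_lintegral_enorm (Lp.aestronglyMeasurable _), ← eLpNorm_one_eq_lintegral_enorm,
      mul_comm, Lp.norm_def]
    have hs : √(b - a) = (volume.restrict (Ioo a b) univ ^
        (1 / (1 : ℝ≥0∞).toReal - 1 / (2 : ℝ≥0∞).toReal)).toReal := by
      rw [← ENNReal.toReal_rpow, Real.sqrt_eq_rpow]
      simp only [Measure.restrict_apply_univ, Real.volume_Ioo]
      rcases le_total 0 (b - a) with h | h
      · rw [ENNReal.toReal_ofReal h]
        norm_num
      · rw [ENNReal.ofReal_of_nonpos h, ← Real.sqrt_eq_rpow, Real.sqrt_eq_zero_of_nonpos h]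
        norm_num
    rw [hs, ← ENNReal.toReal_mul]
    refine ENNReal.toReal_mono (ENNReal.mul_ne_top (Lp.eLpNorm_ne_top _) ?_) e
    exact ENNReal.rpow_ne_top_of_nonneg (by norm_num) (measure_ne_top _ _)
  have h3 : ‖wderiv u‖ ≤ ‖u‖ := by
    have h := WithLp.prod_norm_sq_eq_of_L2 (u : WithLp 2 (L2 a b × L2 a b))
    change ‖(u : WithLp 2 (L2 a b × L2 a b)).snd‖ ≤ ‖(u : WithLp 2 (L2 a b × L2 a b))‖
    refine le_of_sq_le_sq ?_ (norm_nonneg _)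
    nlinarith [sq_nonneg ‖(u : WithLp 2 (L2 a b × L2 a b)).fst‖]
  exact h1.trans (h2.trans (mul_le_mul_of_nonneg_left h3 (Real.sqrt_nonneg _)))

section measure

variable (μ : Measure ℝ) [IsFiniteMeasure μ] (a b : ℝ)

theorem memLp_contRep (u : H01 a b) : MemLp (contRep u) 2 μ :=
  MemLp.of_bound (continuous_contRep u).aestronglyMeasurable (√(b - a) * ‖u‖)
    (Filter.Eventually.of_forall fun x => abs_contRep_le u x)

/-- The map `ι : H₀¹(a, b) → L²_μ` sending `u` to its `L²_μ`-representative. -/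
def iota : H01 a b →L[ℝ] Lp ℝ 2 μ :=
  LinearMap.mkContinuous
    { toFun := fun u => (memLp_contRep μ a b u).toLp (contRep u)
      map_add' := fun u v => by
        rw [← MemLp.toLp_add]
        exact MemLp.toLp_congr _ _ (by rw [contRep_add])
      map_smul' := fun c u => by
        rw [RingHom.id_apply, ← MemLp.toLp_const_smul]
        exact MemLp.toLp_congr _ _ (by rw [contRep_smul]) }
    ((μ.real univ) ^ (1 / 2 : ℝ) * √(b - a))
    fun u => by
      have h := Lp.norm_le_of_ae_bound (p := 2) (f := (memLp_contRep μ a b u).toLp (contRep u))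
        (C := √(b - a) * ‖u‖) (by positivity) (by
          filter_upwards [MemLp.coeFn_toLp (memLp_contRep μ a b u)] with x hx
          rw [hx]
          exact abs_contRep_le u x)
      rw [mul_assoc]
      refine h.trans (le_of_eq ?_)
      norm_num [measureReal_def, ← coe_measureUnivNNReal]

/-- `Dom ℰ`, the orthogonal complement in `H₀¹(a, b)` of `𝒩 = {u : ‖ι u‖_μ = 0}`. -/
def DomE : Submodule ℝ (H01 a b) := (LinearMap.ker (iota μ a b).toLinearMap)ᗮ

variable {a b}

/-- The embedding `Dom ℰ → L²_μ`. -/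
def toL2mu : DomE μ a b →L[ℝ] Lp ℝ 2 μ := (iota μ a b).comp (DomE μ a b).subtypeL

/-- The embedding `L²_μ → (Dom ℰ)'`, `w ↦ (w, ·)_μ`. -/
def toDual (w : Lp ℝ 2 μ) : StrongDual ℝ (DomE μ a b) := (innerSL ℝ w).comp (toL2mu μ)

variable {μ}

/-- The Dirichlet form `ℰ(u, v) = ∫ u' v' dx`. -/
def energy (u v : DomE μ a b) : ℝ :=
  ∫ x in Ioo a b, wderiv (u : H01 a b) x * wderiv (v : H01 a b) x

/-- `‖u‖_{Dom ℰ} = ℰ(u, u)^{1/2} = ‖u'‖_{L²(a, b)}`. -/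
def domNorm (u : DomE μ a b) : ℝ := √(energy u u)

/-- The continuous representative of an element of `Dom ℰ`. -/
def toFun (u : DomE μ a b) : ℝ → ℝ := contRep (u : H01 a b)

end measure

/-! ### Weak solutions of the wave equation -/

/-- `v` is the weak derivative of `u` on `(0, τ)`, for Banach-space valued functions. -/
def HasWeakTimeDeriv {X : Type*} [NormedAddCommGroup X] [NormedSpace ℝ X] (τ : ℝ)
    (u v : ℝ → X) : Prop :=
  ∀ φ : ℝ → ℝ, ContDiff ℝ ∞ φ → HasCompactSupport φ → tsupport φ ⊆ Ioo 0 τ →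
    ∫ t in Ioo 0 τ, deriv φ t • u t = -∫ t in Ioo 0 τ, φ t • v t

/-- `u`, with `u_t = u₁` and `u_tt = u₂`, is a weak solution on `[0, τ]` of
`u_tt - Δ_μ u = f`, `u = 0` on `{a, b}`, `u(0) = g`, `u_t(0) = h`.

As usual, `u` and `u_t` stand for their representatives that are continuous in time
(with values in `L²_μ` and in `(Dom ℰ)'`), so that the values at a given time make sense. -/
structure IsWeakSolution (μ : Measure ℝ) [IsFiniteMeasure μ] (a b τ : ℝ)
    (f : ℝ → DomE μ a b) (g : DomE μ a b) (h : Lp ℝ 2 μ)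
    (u : ℝ → DomE μ a b) (u₁ : ℝ → Lp ℝ 2 μ) (u₂ : ℝ → StrongDual ℝ (DomE μ a b)) : Prop where
  memLp_u : MemLp u 2 (volume.restrict (Ioo 0 τ))
  memLp_ut : MemLp u₁ 2 (volume.restrict (Ioo 0 τ))
  memLp_utt : MemLp u₂ 2 (volume.restrict (Ioo 0 τ))
  deriv_u : HasWeakTimeDeriv τ (fun t => toL2mu μ (u t)) u₁
  deriv_ut : HasWeakTimeDeriv τ (fun t => toDual (a := a) (b := b) μ (u₁ t)) u₂
  continuous_u : ContinuousOn (fun t => toL2mu μ (u t)) (Icc 0 τ)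
  continuous_ut : ContinuousOn (fun t => toDual (a := a) (b := b) μ (u₁ t)) (Icc 0 τ)
  equation : ∀ v : DomE μ a b, ∀ᵐ t ∂(volume.restrict (Ioo 0 τ)),
    u₂ t v + energy (u t) v = inner ℝ (toL2mu μ (f t)) (toL2mu μ v)
  init_pos : u 0 = g
  init_vel : u₁ 0 = h

/-- `w ∈ L²(0, τ; Dom ℰ)` is (the class of) `u_tt`, given `u_tt = u₂` as a function with values
in `(Dom ℰ)'`. -/
structure IsDomEValued {μ : Measure ℝ} [IsFiniteMeasure μ] {a b : ℝ} (τ : ℝ)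
    (u₂ : ℝ → StrongDual ℝ (DomE μ a b)) (w : ℝ → DomE μ a b) : Prop where
  memLp : MemLp w 2 (volume.restrict (Ioo 0 τ))
  ae_eq : ∀ᵐ t ∂(volume.restrict (Ioo 0 τ)), u₂ t = toDual μ (toL2mu μ (w t))

/-- `‖w‖_{2, Dom ℰ} = (∫_0^τ ‖w(t)‖²_{Dom ℰ} dt)^{1/2}`. -/
def bochnerNorm {μ : Measure ℝ} [IsFiniteMeasure μ] {a b : ℝ} (τ : ℝ)
    (w : ℝ → DomE μ a b) : ℝ :=
  √(∫ t in Ioo 0 τ, domNorm (w t) ^ 2)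

/-- `‖v - u‖_μ` for a function `v` on `[a, b]` and `u ∈ Dom ℰ`. -/
def errorNorm {μ : Measure ℝ} [IsFiniteMeasure μ] {a b : ℝ} (v : ℝ → ℝ) (u : DomE μ a b) : ℝ :=
  √(∫ x in Icc a b, (v x - toFun u x) ^ 2 ∂μ)

end

end FractalWave

/-! The theorem rests on one fact about dimension one: piecewise linear interpolation `P` at the
nodes is the Ritz projection. The derivative of a tent function is a step function, so its energy
pairing with `w` involves only three nodal values of `w`, and `w - P w` vanishes at all nodes
(`interp_ritz`). Since `|w(y) - w(x)| ≤ √(y - x) ‖w'‖` and `μ` has mass one, `‖w - P w‖_μ` is at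
most the square root of the mesh size times `‖w'‖` (`norm_embL_sub_interp_le`). The mesh size is at
most `ρ^m (b - a)`: the level-`m` intervals cover `[a, b]`, and the open set condition bounds their
total length by `b - a`, so they tile it (`tiling_nodes`, `AuxIFS.node_spec`). Because the support
of `μ` is `[a, b]`, the energy space is all of `H₀¹(a, b)` and contains the tents. The finite
element system is thus a Galerkin method with initial data `P g`, `P h`
(`AuxIFS.IsFEMSolution.isGalerkin`).

Rate: if `u_tt` has values in the energy space, `e = P u - u^m` has zero initial data and satisfies
`(e'', v)_μ + ℰ(e, v) = (P u_tt - u_tt, v)_μ` for discrete `v`. Testing with `v = e'` bounds the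
energy norm of `e` by the projection error of `u_tt` (`energy_estimate`,
`IsGalerkin.norm_D_error_le`); the error of `P u(t)` itself gives the other term. This yields the
coefficients `2 (b - a)` and `√(b - a)`, hence the bound with a constant independent of `T`. When
`√(b - a) > 2`, the bound with coefficient `2` on `‖u(t)‖` needs more: the excess is absorbed using
`IsRegularSolution.norm_D_le`, which controls `‖u(t)‖` by `u_tt` with a constant depending on `T`.

Convergence: without regularity of `u_tt`, the equation is first integrated twice in time. The same
energy argument then shows that the time integral of the error tends to zero
(`IsGalerkin.norm_prim_error_le`). By conservation of discrete energy the approximations are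
Lipschitz in time with a common constant, and `u` is continuous in `L²_μ`; averaging over a short
time window gives convergence at each time (`IsIntegratedSolution.exists_error_le`).

Weak derivatives, in space and in time, are turned into primitives by the du Bois-Reymond lemma, so
all identities are between Bochner integrals. -/

namespace FractalWave

noncomputable section

/-! ### Primitives of Bochner integrable functions -/

section primitives

variable {X Y Z : Type*} [NormedAddCommGroup X] [NormedSpace ℝ X]
  [NormedAddCommGroup Y] [NormedSpace ℝ Y] [NormedAddCommGroup Z] [NormedSpace ℝ Z]

theorem integrable_bilin_prod {ν : Measure ℝ} [SFinite ν] (B : X →L[ℝ] Y →L[ℝ] Z) {f : ℝ → X}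
    {g : ℝ → Y} (hf : Integrable f ν) (hg : Integrable g ν) :
    Integrable (fun z : ℝ × ℝ => B (f z.1) (g z.2)) (ν.prod ν) := by
  have h1 : Integrable (fun z : ℝ × ℝ => ‖B‖ * (‖f z.1‖ * ‖g z.2‖)) (ν.prod ν) :=
    (hf.norm.mul_prod hg.norm).const_mul _
  refine h1.mono' (B.aestronglyMeasurable_comp₂ hf.1.comp_fst hg.1.comp_snd)
    (Filter.Eventually.of_forall fun z => ?_)
  simpa [mul_assoc] using B.le_opNorm₂ (f z.1) (g z.2)

/-- The product rule for a continuous bilinear map applied to two primitives. -/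
theorem bilin_primitive [CompleteSpace X] [CompleteSpace Y] [CompleteSpace Z]
    (B : X →L[ℝ] Y →L[ℝ] Z) {f : ℝ → X} {g : ℝ → Y} {a t : ℝ} (hat : a ≤ t)
    (hf : IntervalIntegrable f volume a t) (hg : IntervalIntegrable g volume a t) :
    B (∫ s in a..t, f s) (∫ s in a..t, g s) =
      ∫ s in a..t, (B (f s) (∫ r in a..s, g r) + B (∫ r in a..s, f r) (g s)) := by
  rw [intervalIntegrable_iff_integrableOn_Ioc_of_le hat] at hf hg
  set ν := volume.restrict (Ioc a t) with hν
  have hB := integrable_bilin_prod B hf hg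
  -- The double integral of `B (f s) (g r)` over the square is split along the diagonal; Fubini
  -- integrates first in `r` on the part `r ≤ s` and first in `s` on the part `s < r`.
  have hmeas : MeasurableSet {z : ℝ × ℝ | z.2 ≤ z.1} := measurableSet_le measurable_snd measurable_fst
  have hsplit : ∀ s r, B (f s) (g r) =
      {z : ℝ × ℝ | z.2 ≤ z.1}.indicator (fun z => B (f z.1) (g z.2)) (s, r) +
      {z : ℝ × ℝ | z.2 ≤ z.1}ᶜ.indicator (fun z => B (f z.1) (g z.2)) (s, r) := fun s r =>
    (congrFun (indicator_self_add_compl _ (fun z : ℝ × ℝ => B (f z.1) (g z.2))) (s, r)).symm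
  have h1 := hB.indicator hmeas
  have h2 := hB.indicator hmeas.compl
  have e1 : ∀ᵐ s ∂ν, ∫ r, {z : ℝ × ℝ | z.2 ≤ z.1}.indicator (fun z => B (f z.1) (g z.2)) (s, r) ∂ν
      = B (f s) (∫ r in a..s, g r) := by
    filter_upwards [ae_restrict_mem measurableSet_Ioc] with s hs
    have : (fun r => {z : ℝ × ℝ | z.2 ≤ z.1}.indicator (fun z => B (f z.1) (g z.2)) (s, r)) =
        (Iic s).indicator fun r => B (f s) (g r) := by
      ext r; simp only [indicator, mem_ofPred_eq, mem_Iic]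
    rw [this, integral_indicator measurableSet_Iic, hν, Measure.restrict_restrict measurableSet_Iic,
      intervalIntegral.integral_of_le hs.1.le]
    have hst : Iic s ∩ Ioc a t = Ioc a s := by
      ext r; simp only [mem_inter_iff, mem_Iic, mem_Ioc]; constructor
      · rintro ⟨h, h', -⟩; exact ⟨h', h⟩
      · rintro ⟨h, h'⟩; exact ⟨h', h, h'.trans hs.2⟩
    rw [hst]
    exact (B (f s)).integral_comp_comm (IntegrableOn.mono_set hg (Ioc_subset_Ioc_right hs.2))
  have e2 : ∀ᵐ r ∂ν, ∫ s, {z : ℝ × ℝ | z.2 ≤ z.1}ᶜ.indicator (fun z => B (f z.1) (g z.2)) (s, r) ∂ν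
      = B (∫ s in a..r, f s) (g r) := by
    filter_upwards [ae_restrict_mem measurableSet_Ioc] with r hr
    have : (fun s => {z : ℝ × ℝ | z.2 ≤ z.1}ᶜ.indicator (fun z => B (f z.1) (g z.2)) (s, r)) =
        (Iio r).indicator fun s => B.flip (g r) (f s) := by
      ext s; simp only [indicator, mem_compl_iff, mem_ofPred_eq, mem_Iio, not_le,
        ContinuousLinearMap.flip_apply]
    rw [this, integral_indicator measurableSet_Iio, hν, Measure.restrict_restrict measurableSet_Iio,
      intervalIntegral.integral_of_le hr.1.le, integral_Ioc_eq_integral_Ioo]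
    have hst : Iio r ∩ Ioc a t = Ioo a r := by
      ext s; simp only [mem_inter_iff, mem_Iio, mem_Ioc, mem_Ioo]; constructor
      · rintro ⟨h, h', -⟩; exact ⟨h', h⟩
      · rintro ⟨h, h'⟩; exact ⟨h', h, h'.le.trans hr.2⟩
    rw [hst, ← ContinuousLinearMap.flip_apply B]
    exact (B.flip (g r)).integral_comp_comm
      (IntegrableOn.mono_set hf (Ioo_subset_Ioc_self.trans (Ioc_subset_Ioc_right hr.2)))
  rw [intervalIntegral.integral_of_le hat, intervalIntegral.integral_of_le hat,
    intervalIntegral.integral_of_le hat]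
  have i1 := h1.integral_prod_left
  have i2 := h2.integral_prod_right
  rw [integral_add (i1.congr e1) (i2.congr e2), ← integral_congr_ae e1, ← integral_congr_ae e2,
    ← integral_prod _ h1, ← integral_prod_symm _ h2, ← integral_add h1 h2]
  have : (fun z : ℝ × ℝ => {z : ℝ × ℝ | z.2 ≤ z.1}.indicator (fun z => B (f z.1) (g z.2)) z +
      {z : ℝ × ℝ | z.2 ≤ z.1}ᶜ.indicator (fun z => B (f z.1) (g z.2)) z) =
      fun z => B (f z.1) (g z.2) := by
    ext z; exact (hsplit z.1 z.2).symm
  rw [this, integral_prod _ hB]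
  have e3 : ∀ s, ∫ r, B (f s) (g r) ∂ν = B.flip (∫ r, g r ∂ν) (f s) := fun s =>
    (B (f s)).integral_comp_comm hg
  rw [integral_congr_ae (Filter.Eventually.of_forall e3),
    ContinuousLinearMap.integral_comp_comm _ hf, ContinuousLinearMap.flip_apply]

end primitives

/-! ### The du Bois-Reymond lemma -/

section duBoisReymond

variable {X : Type*} [NormedAddCommGroup X] [NormedSpace ℝ X]

theorem smooth_primitive {φ : ℝ → ℝ} (hφ : ContDiff ℝ ∞ φ) (a : ℝ) :
    ContDiff ℝ ∞ (fun x => ∫ y in a..x, φ y) ∧ deriv (fun x => ∫ y in a..x, φ y) = φ := by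
  have hd : ∀ x, HasDerivAt (fun x => ∫ y in a..x, φ y) (φ x) x := fun x =>
    intervalIntegral.integral_hasDerivAt_right (hφ.continuous.intervalIntegrable _ _)
      (hφ.continuous.stronglyMeasurableAtFilter _ _) hφ.continuous.continuousAt
  have hde : deriv (fun x => ∫ y in a..x, φ y) = φ := funext fun x => (hd x).deriv
  refine ⟨?_, hde⟩
  rw [contDiff_infty_iff_deriv, hde]
  exact ⟨fun x => (hd x).differentiableAt, hφ⟩

/-- Trades the topological support for a compact interval, on whose two sides integrals of `φ`
visibly vanish. -/
theorem tsupport_subset_Ioo_iff {φ : ℝ → ℝ} {a b : ℝ} (hab : a < b) (hs : tsupport φ ⊆ Ioo a b)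
    (hc : HasCompactSupport φ) :
    ∃ c d, a < c ∧ c ≤ d ∧ d < b ∧ ∀ x, x ∉ Icc c d → φ x = 0 := by
  rcases (tsupport φ).eq_empty_or_nonempty with h | h
  · refine ⟨(a + b) / 2, (a + b) / 2, by linarith, le_rfl, by linarith, fun x _ => ?_⟩
    exact image_eq_zero_of_notMem_tsupport (by simp [h])
  · obtain ⟨c, hc1, hc2⟩ := hc.isCompact.exists_isLeast h
    obtain ⟨d, hd1, hd2⟩ := hc.isCompact.exists_isGreatest h
    refine ⟨c, d, (hs hc1).1, hc2 hd1, (hs hd1).2, fun x hx => ?_⟩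
    exact image_eq_zero_of_notMem_tsupport fun h' => hx ⟨hc2 h', hd2 h'⟩

theorem test_of_vanishing {φ : ℝ → ℝ} {a b c d : ℝ} (hc : a < c) (hd : d < b)
    (h : ∀ x, x ∉ Icc c d → φ x = 0) : HasCompactSupport φ ∧ tsupport φ ⊆ Ioo a b := by
  have h1 : tsupport φ ⊆ Icc c d :=
    closure_minimal (fun x hx => by_contra fun h' => hx (h x h')) isClosed_Icc
  exact ⟨HasCompactSupport.of_support_subset_isCompact isCompact_Icc
    ((subset_tsupport _).trans h1), h1.trans (Icc_subset_Ioo hc hd)⟩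

/-- A test function with zero mean is the derivative of a test function. -/
theorem exists_primitive_test {φ : ℝ → ℝ} {a b : ℝ} (hab : a < b) (hφ : ContDiff ℝ ∞ φ)
    (hc : HasCompactSupport φ) (hs : tsupport φ ⊆ Ioo a b) (h0 : ∫ x in Ioo a b, φ x = 0) :
    ∃ ψ : ℝ → ℝ, ContDiff ℝ ∞ ψ ∧ HasCompactSupport ψ ∧ tsupport ψ ⊆ Ioo a b ∧ deriv ψ = φ := by
  obtain ⟨c, d, hac, hcd, hdb, hz⟩ := tsupport_subset_Ioo_iff hab hs hc
  obtain ⟨h1, h2⟩ := smooth_primitive hφ a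
  have hi : ∀ x y, IntervalIntegrable φ volume x y := fun x y => hφ.continuous.intervalIntegrable _ _
  have h0' : ∫ y in a..b, φ y = 0 := by
    rw [intervalIntegral.integral_of_le hab.le, integral_Ioc_eq_integral_Ioo, h0]
  have hl : ∀ x < c, ∀ y < c, ∫ t in x..y, φ t = 0 := fun x hx y hy => by
    rw [intervalIntegral.integral_congr (g := fun _ => 0), intervalIntegral.integral_zero]
    intro t ht
    refine hz t fun h => ?_
    rcases le_total x y with hxy | hxy
    · rw [uIcc_of_le hxy] at ht; linarith [ht.2, h.1]
    · rw [uIcc_of_ge hxy] at ht; linarith [ht.2, h.1]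
  have hr : ∀ x > d, ∀ y > d, ∫ t in x..y, φ t = 0 := fun x hx y hy => by
    rw [intervalIntegral.integral_congr (g := fun _ => 0), intervalIntegral.integral_zero]
    intro t ht
    refine hz t fun h => ?_
    rcases le_total x y with hxy | hxy
    · rw [uIcc_of_le hxy] at ht; linarith [ht.1, h.2]
    · rw [uIcc_of_ge hxy] at ht; linarith [ht.1, h.2]
  -- To the left of `c` nothing has been integrated yet; to the right of `d` the primitive equals
  -- the whole integral, which is zero.
  have hv : ∀ x, x ∉ Icc c d → ∫ y in a..x, φ y = 0 := fun x hx => by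
    rcases lt_or_ge x c with h | h
    · exact hl a hac x h
    · have hdx : d < x := not_le.mp fun h' => hx ⟨h, h'⟩
      rw [← intervalIntegral.integral_add_adjacent_intervals (hi a b) (hi b x), h0', zero_add]
      exact hr b hdb x hdx
  obtain ⟨h3, h4⟩ := test_of_vanishing hac hdb hv
  exact ⟨_, h1, h3, h4, h2⟩

theorem exists_test_integral_one {a b : ℝ} (hab : a < b) : ∃ φ : ℝ → ℝ, ContDiff ℝ ∞ φ ∧
    HasCompactSupport φ ∧ tsupport φ ⊆ Ioo a b ∧ ∫ x in Ioo a b, φ x = 1 := by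
  let w : ContDiffBump ((a + b) / 2) := ⟨(b - a) / 8, (b - a) / 4, by linarith, by linarith⟩
  have hts : tsupport (w.normed volume) ⊆ Ioo a b := by
    rw [w.tsupport_normed_eq, Real.closedBall_eq_Icc]
    exact Icc_subset_Ioo (by simp only [w]; linarith) (by simp only [w]; linarith)
  refine ⟨w.normed volume, w.contDiff_normed, w.hasCompactSupport_normed, hts, ?_⟩
  rw [setIntegral_eq_integral_of_forall_compl_eq_zero fun x hx =>
    image_eq_zero_of_notMem_tsupport fun h => hx (hts h)]
  exact w.integral_normed

theorem integrable_test_smul {f : ℝ → X} {a b : ℝ} (hf : IntegrableOn f (Ioo a b))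
    {φ : ℝ → ℝ} (hφ : Continuous φ) (hc : HasCompactSupport φ) :
    IntegrableOn (fun x => φ x • f x) (Ioo a b) := by
  obtain ⟨C, hC⟩ := hφ.bounded_above_of_compact_support hc
  exact hf.bdd_smul C hφ.aestronglyMeasurable (Filter.Eventually.of_forall hC)

/-- A function whose weak derivative vanishes is almost everywhere constant. -/
theorem ae_const_of_weak_deriv_zero [CompleteSpace X] {a b : ℝ} (hab : a < b) {f : ℝ → X}
    (hf : IntegrableOn f (Ioo a b))
    (h : ∀ φ : ℝ → ℝ, ContDiff ℝ ∞ φ → HasCompactSupport φ → tsupport φ ⊆ Ioo a b →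
      ∫ x in Ioo a b, deriv φ x • f x = 0) :
    ∃ c : X, ∀ᵐ x ∂(volume.restrict (Ioo a b)), f x = c := by
  obtain ⟨φ₀, h1, h2, h3, h4⟩ := exists_test_integral_one hab
  set c := ∫ x in Ioo a b, φ₀ x • f x
  refine ⟨c, ?_⟩
  have key := isOpen_Ioo.ae_eq_zero_of_integral_contDiff_smul_eq_zero (μ := volume)
    (U := Ioo a b) (f := fun x => f x - c)
    ((hf.sub (integrableOn_const (by simp))).locallyIntegrableOn) ?_
  · rw [ae_restrict_iff' measurableSet_Ioo]
    filter_upwards [key] with x hx hm using sub_eq_zero.mp (hx hm)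
  intro g g1 g2 g3
  rw [← setIntegral_eq_integral_of_forall_compl_eq_zero (s := Ioo a b) fun x hx => by
    rw [image_eq_zero_of_notMem_tsupport fun h => hx (g3 h), zero_smul]]
  set I := ∫ x in Ioo a b, g x with hI
  have gi : IntegrableOn g (Ioo a b) := (g1.continuous.integrable_of_hasCompactSupport g2).integrableOn
  have pi : IntegrableOn φ₀ (Ioo a b) :=
    (h1.continuous.integrable_of_hasCompactSupport h2).integrableOn
  -- Subtracting `I φ₀` removes the mean of `g`, so the difference is the derivative of a test
  -- function and is annihilated by `f`. This leaves `∫ g f = I c`, with `c` the average of `f`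
  -- against `φ₀`.
  have d1 : ContDiff ℝ ∞ (fun x => g x - I * φ₀ x) := g1.sub (contDiff_const.mul h1)
  have hIs : HasCompactSupport (fun x => I * φ₀ x) := h2.mul_left
  have d2 : HasCompactSupport (fun x => g x - I * φ₀ x) := g2.sub hIs
  have d3 : tsupport (fun x => g x - I * φ₀ x) ⊆ Ioo a b :=
    (tsupport_sub _ _).trans (union_subset g3 ((tsupport_mul_subset_right).trans h3))
  have d4 : ∫ x in Ioo a b, (g x - I * φ₀ x) = 0 := by
    rw [integral_sub gi (pi.const_mul I), integral_const_mul, h4]; simp [hI]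
  obtain ⟨ψ, p1, p2, p3, p4⟩ := exists_primitive_test hab d1 d2 d3 d4
  have := h ψ p1 p2 p3
  rw [p4] at this
  have e : ∀ x, (g x - I * φ₀ x) • f x = g x • f x - I • (φ₀ x • f x) := fun x => by
    rw [sub_smul, mul_smul]
  have s1 := integrable_test_smul hf g1.continuous g2
  have s2 := integrable_test_smul hf h1.continuous h2
  simp_rw [e] at this
  have s2' : IntegrableOn (fun x => I • (φ₀ x • f x)) (Ioo a b) := s2.smul I
  rw [integral_sub s1 s2', integral_smul] at this
  simp_rw [smul_sub]
  rw [integral_sub s1 (gi.smul_const c), integral_smul_const]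
  exact this

/-- Integration by parts of a primitive against a test function. -/
theorem integral_test_primitive [CompleteSpace X] {a b : ℝ} (hab : a < b) {v : ℝ → X}
    (hv : IntegrableOn v (Ioo a b)) {φ : ℝ → ℝ} (h1 : ContDiff ℝ ∞ φ) (h2 : HasCompactSupport φ)
    (h3 : tsupport φ ⊆ Ioo a b) :
    ∫ x in Ioo a b, deriv φ x • ∫ y in a..x, v y = -∫ x in Ioo a b, φ x • v x := by
  have hvi : IntervalIntegrable v volume a b := by
    rwa [intervalIntegrable_iff_integrableOn_Ioo_of_le hab.le]
  have hc : Continuous (deriv φ) := h1.continuous_deriv (by simp)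
  have hp : ∀ x, ∫ y in a..x, deriv φ y = φ x := fun x => by
    rw [intervalIntegral.integral_deriv_eq_sub (fun y _ => (h1.differentiable (by simp)) y)
      (hc.intervalIntegrable _ _), image_eq_zero_of_notMem_tsupport (f := φ) (x := a)
      (fun h => (h3 h).1.false), sub_zero]
  have hb : φ b = 0 := image_eq_zero_of_notMem_tsupport (fun h => (h3 h).2.false)
  -- The product rule for scalar multiplication; the boundary term vanishes because `φ b = 0`.
  have key := bilin_primitive (ContinuousLinearMap.lsmul ℝ ℝ : ℝ →L[ℝ] X →L[ℝ] X) hab.le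
    (hc.intervalIntegrable a b) hvi
  simp only [hp, hb, map_zero, zero_apply, ContinuousLinearMap.lsmul_apply]
    at key
  have i1 : IntervalIntegrable (fun x => deriv φ x • ∫ y in a..x, v y) volume a b := by
    have : ContinuousOn (fun x => deriv φ x • ∫ y in a..x, v y) (uIcc a b) :=
      hc.continuousOn.smul (intervalIntegral.continuousOn_primitive_interval
        (by rw [uIcc_of_le hab.le, integrableOn_Icc_iff_integrableOn_Ioo]; exact hv))
    exact this.intervalIntegrable
  have i2 : IntervalIntegrable (fun x => φ x • v x) volume a b := by
    rw [intervalIntegrable_iff_integrableOn_Ioo_of_le hab.le]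
    exact integrable_test_smul hv h1.continuous h2
  rw [intervalIntegral.integral_add i1 i2, intervalIntegral.integral_of_le hab.le,
    intervalIntegral.integral_of_le hab.le, integral_Ioc_eq_integral_Ioo,
    integral_Ioc_eq_integral_Ioo] at key
  exact eq_neg_of_add_eq_zero_left key.symm

/-- A continuous function with weak derivative `v` is a primitive of `v`. -/
theorem HasWeakTimeDeriv.eq_primitive [CompleteSpace X] {τ : ℝ} (hτ : 0 < τ) {u v : ℝ → X}
    (huv : HasWeakTimeDeriv τ u v) (hu : ContinuousOn u (Icc 0 τ))
    (hv : IntegrableOn v (Ioo 0 τ)) {t : ℝ} (ht : t ∈ Icc 0 τ) :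
    u t = u 0 + ∫ s in (0 : ℝ)..t, v s := by
  have hvi : IntegrableOn v (uIcc 0 τ) := by
    rw [uIcc_of_le hτ.le, integrableOn_Icc_iff_integrableOn_Ioo]; exact hv
  have hP : ContinuousOn (fun t => ∫ s in (0 : ℝ)..t, v s) (Icc 0 τ) := by
    rw [← uIcc_of_le hτ.le]; exact intervalIntegral.continuousOn_primitive_interval hvi
  have hd : ContinuousOn (fun t => u t - ∫ s in (0 : ℝ)..t, v s) (Icc 0 τ) := hu.sub hP
  have hiI : ∀ {w : ℝ → X}, ContinuousOn w (Icc 0 τ) → IntegrableOn w (Ioo 0 τ) := fun hw =>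
    hw.integrableOn_Icc.mono_set Ioo_subset_Icc_self
  obtain ⟨c, hc⟩ := ae_const_of_weak_deriv_zero hτ (hiI hd) fun φ h1 h2 h3 => by
    have hc : Continuous (deriv φ) := h1.continuous_deriv (by simp)
    simp_rw [smul_sub]
    rw [integral_sub (integrable_test_smul (hiI hu) hc h2.deriv)
      (integrable_test_smul (hiI hP) hc h2.deriv), huv φ h1 h2 h3,
      integral_test_primitive hτ hv h1 h2 h3, sub_self]
  -- Both sides are continuous, so equality almost everywhere on the open interval extends to its
  -- closure.
  have hE : EqOn (fun t => u t - ∫ s in (0 : ℝ)..t, v s) (fun _ => c) (Icc 0 τ) := by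
    have h1 := Measure.eqOn_open_of_ae_eq (μ := volume) hc isOpen_Ioo
      (hd.mono Ioo_subset_Icc_self) continuousOn_const
    exact h1.of_subset_closure hd continuousOn_const Ioo_subset_Icc_self
      (by rw [closure_Ioo hτ.ne])
  have e0 := hE (left_mem_Icc.mpr hτ.le)
  have et := hE ht
  simp only [intervalIntegral.integral_same, sub_zero] at e0 et
  rw [e0, ← et]; abel

end duBoisReymond

/-! ### The space `H₀¹(a, b)` -/

section Sobolev

variable {a b : ℝ}

instance : CompleteSpace (H01 a b) :=
  (Submodule.isClosed_topologicalClosure _).completeSpace_coe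

theorem L2_inner_eq {α : Type*} [MeasurableSpace α] {ν : Measure α} (f g : Lp ℝ 2 ν) :
    inner ℝ f g = ∫ x, f x * g x ∂ν := by
  rw [L2.inner_def]
  exact integral_congr_ae (Filter.Eventually.of_forall fun x => by simp [mul_comm])

theorem L2_integrableOn (f : L2 a b) : IntegrableOn f (Ioo a b) :=
  (Lp.memLp f).integrable (by norm_num)

theorem L2_intervalIntegrable (hab : a ≤ b) (f : L2 a b) : IntervalIntegrable f volume a b := by
  rw [intervalIntegrable_iff_integrableOn_Ioo_of_le hab]
  exact L2_integrableOn f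

/-- The primitive of an element of `L²(a, b)`, plus a constant, as an element of `L²(a, b)`. -/
theorem exists_L2_primitive (hab : a < b) (f : L2 a b) (c : ℝ) : ∃ F : L2 a b,
    ∀ᵐ x ∂(volume.restrict (Ioo a b)), F x = (∫ y in a..x, f y) + c := by
  have hc : ContinuousOn (fun x => (∫ y in a..x, f y) + c) (Icc a b) := by
    have hi : IntegrableOn f (uIcc a b) := by
      rw [uIcc_of_le hab.le, integrableOn_Icc_iff_integrableOn_Ioo]; exact L2_integrableOn f
    rw [← uIcc_of_le hab.le]
    exact (intervalIntegral.continuousOn_primitive_interval hi).add continuousOn_const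
  obtain ⟨C, hC⟩ := isCompact_Icc.exists_bound_of_continuousOn hc
  have hm : MemLp (fun x => (∫ y in a..x, f y) + c) 2 (volume.restrict (Ioo a b)) :=
    MemLp.of_bound ((hc.mono Ioo_subset_Icc_self).aestronglyMeasurable measurableSet_Ioo) C
      ((ae_restrict_iff' measurableSet_Ioo).mpr
        (Filter.Eventually.of_forall fun x hx => hC x (Ioo_subset_Icc_self hx)))
  exact ⟨hm.toLp _, hm.coeFn_toLp⟩

theorem inner_testPair {ζ w : WithLp 2 (L2 a b × L2 a b)} {φ : ℝ → ℝ}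
    (h1 : w.fst =ᵐ[volume.restrict (Ioo a b)] φ)
    (h2 : w.snd =ᵐ[volume.restrict (Ioo a b)] deriv φ) :
    inner ℝ ζ w = (∫ x in Ioo a b, φ x • ζ.fst x) + ∫ x in Ioo a b, deriv φ x • ζ.snd x := by
  rw [WithLp.prod_inner_apply, L2_inner_eq, L2_inner_eq]
  congr 1
  · refine integral_congr_ae ?_
    filter_upwards [h1] with x hx
    simp only [WithLp.fst] at hx ⊢
    rw [hx, smul_eq_mul, mul_comm]
  · refine integral_congr_ae ?_
    filter_upwards [h2] with x hx
    simp only [WithLp.snd] at hx ⊢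
    rw [hx, smul_eq_mul, mul_comm]

theorem exists_testPair {φ : ℝ → ℝ} (h1 : ContDiff ℝ ∞ φ) (h2 : HasCompactSupport φ)
    (h3 : tsupport φ ⊆ Ioo a b) : ∃ w ∈ testPairs a b,
    w.fst =ᵐ[volume.restrict (Ioo a b)] φ ∧ w.snd =ᵐ[volume.restrict (Ioo a b)] deriv φ := by
  have m1 : MemLp φ 2 (volume.restrict (Ioo a b)) :=
    (h1.continuous.memLp_of_hasCompactSupport h2)
  have m2 : MemLp (deriv φ) 2 (volume.restrict (Ioo a b)) :=
    ((h1.continuous_deriv (by simp)).memLp_of_hasCompactSupport h2.deriv)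
  exact ⟨WithLp.toLp 2 (m1.toLp φ, m2.toLp (deriv φ)),
    ⟨φ, h1, h2, h3, m1.coeFn_toLp, m2.coeFn_toLp⟩, m1.coeFn_toLp, m2.coeFn_toLp⟩

/-- A vector orthogonal to all test pairs is orthogonal to `H₀¹(a, b)`. -/
theorem inner_H01_eq_zero {ζ : WithLp 2 (L2 a b × L2 a b)}
    (h : ∀ w ∈ testPairs a b, inner ℝ ζ w = 0) (u : H01 a b) :
    inner ℝ ζ (u : WithLp 2 (L2 a b × L2 a b)) = 0 := by
  have hc : IsClosed (LinearMap.ker (innerSL ℝ ζ).toLinearMap : Set (WithLp 2 (L2 a b × L2 a b))) :=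
    (innerSL ℝ ζ).isClosed_ker
  have : H01 a b ≤ LinearMap.ker (innerSL ℝ ζ).toLinearMap :=
    Submodule.topologicalClosure_minimal _ (Submodule.span_le.mpr fun w hw => h w hw) hc
  exact this u.2

/-- The pairs `(p, ∫ p + c)` are orthogonal to the test pairs. -/
theorem inner_primitivePair_testPair (hab : a < b) {ζ : WithLp 2 (L2 a b × L2 a b)} {c : ℝ}
    (hζ : ∀ᵐ x ∂(volume.restrict (Ioo a b)), ζ.snd x = (∫ y in a..x, ζ.fst y) + c)
    {w : WithLp 2 (L2 a b × L2 a b)} (hw : w ∈ testPairs a b) : inner ℝ ζ w = 0 := by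
  obtain ⟨φ, h1, h2, h3, h4, h5⟩ := hw
  have hφc : Continuous (deriv φ) := h1.continuous_deriv (by simp)
  have hd0 : ∫ x in Ioo a b, deriv φ x = 0 := by
    rw [← integral_Ioc_eq_integral_Ioo, ← intervalIntegral.integral_of_le hab.le,
      intervalIntegral.integral_deriv_eq_sub (fun y _ => (h1.differentiable (by simp)) y)
      (hφc.intervalIntegrable _ _), image_eq_zero_of_notMem_tsupport (f := φ) (x := a)
      (fun h => (h3 h).1.false), image_eq_zero_of_notMem_tsupport (f := φ) (x := b)
      (fun h => (h3 h).2.false), sub_zero]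
  rw [inner_testPair h4 h5]
  have hdi : IntegrableOn (deriv φ) (Ioo a b) :=
    (hφc.integrable_of_hasCompactSupport h2.deriv).integrableOn
  have e : ∫ x in Ioo a b, deriv φ x • ζ.snd x = ∫ x in Ioo a b, deriv φ x • ∫ y in a..x, ζ.fst y := by
    have i1 : IntegrableOn (fun x => deriv φ x • ζ.snd x) (Ioo a b) :=
      integrable_test_smul (L2_integrableOn _) hφc h2.deriv
    have i2 : IntegrableOn (fun x => deriv φ x * c) (Ioo a b) := hdi.mul_const c
    have : ∀ᵐ x ∂(volume.restrict (Ioo a b)),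
        deriv φ x • ∫ y in a..x, ζ.fst y = deriv φ x • ζ.snd x - deriv φ x * c := by
      filter_upwards [hζ] with x hx
      rw [hx]; simp only [smul_eq_mul]; ring
    rw [integral_congr_ae this, integral_sub i1 i2, integral_mul_const, hd0, zero_mul, sub_zero]
  rw [e, integral_test_primitive hab (L2_integrableOn _) h1 h2 h3, add_neg_cancel]

/-- Conversely, a vector orthogonal to the test pairs has this form. -/
theorem snd_eq_of_orthogonal (hab : a < b) {ζ : WithLp 2 (L2 a b × L2 a b)}
    (h : ∀ w ∈ testPairs a b, inner ℝ ζ w = 0) : ∃ c : ℝ,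
    ∀ᵐ x ∂(volume.restrict (Ioo a b)), ζ.snd x = (∫ y in a..x, ζ.fst y) + c := by
  obtain ⟨P, hP⟩ := exists_L2_primitive hab ζ.fst 0
  have hPi := L2_integrableOn P
  have hd := (L2_integrableOn ζ.snd).sub hPi
  obtain ⟨c, hc⟩ := ae_const_of_weak_deriv_zero hab hd fun φ h1 h2 h3 => by
    have hφc : Continuous (deriv φ) := h1.continuous_deriv (by simp)
    obtain ⟨w, hw, w1, w2⟩ := exists_testPair h1 h2 h3
    have := h w hw
    rw [inner_testPair w1 w2] at this
    have ip := integral_test_primitive hab (L2_integrableOn ζ.fst) h1 h2 h3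
    have e : ∫ x in Ioo a b, deriv φ x • P x = ∫ x in Ioo a b, deriv φ x • ∫ y in a..x, ζ.fst y := by
      refine integral_congr_ae ?_
      filter_upwards [hP] with x hx
      rw [hx, add_zero]
    simp_rw [Pi.sub_apply, smul_sub]
    rw [integral_sub (integrable_test_smul (L2_integrableOn _) hφc h2.deriv)
      (integrable_test_smul hPi hφc h2.deriv), e, ip]
    linarith
  refine ⟨c, ?_⟩
  filter_upwards [hc, hP] with x h1 h2
  rw [Pi.sub_apply, h2] at h1
  linarith

/-- Every mean-free element of `L²(a, b)` is the weak derivative of an element of `H₀¹(a, b)`. -/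
theorem exists_H01_of_wderiv (hab : a < b) (f : L2 a b) (hf : ∫ x in Ioo a b, f x = 0) :
    ∃ u : H01 a b, wderiv u = f := by
  obtain ⟨F, hF⟩ := exists_L2_primitive hab f 0
  let w : WithLp 2 (L2 a b × L2 a b) := WithLp.toLp 2 (F, f)
  suffices hw : w ∈ H01 a b from ⟨⟨w, hw⟩, rfl⟩
  -- Membership in the closure is tested against the orthogonal complement. A vector `ζ` there has
  -- second component `∫ ζ.fst + c`, so its inner product with `(F, f)` is the boundary term of the
  -- product `(∫ ζ.fst)(∫ f)`, which is zero because `f` has mean zero.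
  rw [H01, ← Submodule.orthogonal_orthogonal_eq_closure, Submodule.mem_orthogonal]
  intro ζ hζ
  rw [Submodule.mem_orthogonal] at hζ
  obtain ⟨c, hc⟩ := snd_eq_of_orthogonal hab (ζ := ζ) fun w hw => by
    rw [real_inner_comm]; exact hζ w (Submodule.subset_span hw)
  rw [WithLp.prod_inner_apply, L2_inner_eq, L2_inner_eq]
  change (∫ x in Ioo a b, ζ.fst x * F x) + ∫ x in Ioo a b, ζ.snd x * f x = 0
  have e1 : ∫ x in Ioo a b, ζ.fst x * F x = ∫ x in Ioo a b, ζ.fst x * ∫ y in a..x, f y := by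
    refine integral_congr_ae ?_
    filter_upwards [hF] with x hx
    rw [hx, add_zero]
  have key := bilin_primitive (ContinuousLinearMap.mul ℝ ℝ) hab.le
    (L2_intervalIntegrable hab.le ζ.fst) (L2_intervalIntegrable hab.le f)
  have f0 : ∫ x in a..b, f x = 0 := by
    rw [intervalIntegral.integral_of_le hab.le, integral_Ioc_eq_integral_Ioo, hf]
  rw [f0, map_zero, intervalIntegral.integral_of_le hab.le, integral_Ioc_eq_integral_Ioo] at key
  simp only [ContinuousLinearMap.mul_apply'] at key
  have e2 : ∫ x in Ioo a b, ζ.snd x * f x =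
      ∫ x in Ioo a b, ((∫ y in a..x, ζ.fst y) * f x + c * f x) := by
    refine integral_congr_ae ?_
    filter_upwards [hc] with x hx
    rw [hx]; ring
  have i0 : IntegrableOn (fun x => ζ.fst x * F x) (Ioo a b) := by
    simpa [mul_comm, IntegrableOn] using L2.integrable_inner (𝕜 := ℝ) ζ.fst F
  have i1 : IntegrableOn (fun x => ζ.fst x * ∫ y in a..x, f y) (Ioo a b) := by
    refine i0.congr ?_
    filter_upwards [hF] with x hx
    rw [hx, add_zero]
  have i2' : IntegrableOn (fun x => ζ.snd x * f x) (Ioo a b) := by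
    simpa [mul_comm, IntegrableOn] using L2.integrable_inner (𝕜 := ℝ) ζ.snd f
  have i3 : IntegrableOn (fun x => c * f x) (Ioo a b) := (L2_integrableOn f).const_mul c
  have i2 : IntegrableOn (fun x => (∫ y in a..x, ζ.fst y) * f x) (Ioo a b) := by
    refine (i2'.sub i3).congr ?_
    filter_upwards [hc] with x hx
    simp only [Pi.sub_apply]
    rw [hx]; ring
  rw [e1, e2, integral_add i2 i3, integral_const_mul, hf, mul_zero, add_zero, ← integral_add i1 i2]
  exact key.symm

/-- The pair `(0, 1)` is orthogonal to every test pair, hence to all of `H₀¹(a, b)`. -/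
theorem integral_wderiv (hab : a < b) (u : H01 a b) : ∫ x in Ioo a b, wderiv u x = 0 := by
  obtain ⟨F, hF⟩ := exists_L2_primitive hab (0 : L2 a b) 1
  have hF' : ∀ᵐ x ∂(volume.restrict (Ioo a b)), F x = 1 := by
    filter_upwards [hF, ae_restrict_mem measurableSet_Ioo] with x hx hm
    rw [hx, add_eq_right, intervalIntegral.integral_of_le hm.1.le]
    have h0 := Lp.coeFn_zero ℝ 2 (volume.restrict (Ioo a b))
    have h1 : ∀ᵐ y ∂(volume.restrict (Ioc a x)), (0 : L2 a b) y = 0 := by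
      rw [← restrict_Ioo_eq_restrict_Ioc]
      exact ae_restrict_of_ae_restrict_of_subset (Ioo_subset_Ioo_right hm.2.le) h0
    rw [integral_congr_ae h1]; simp
  have := inner_H01_eq_zero (ζ := WithLp.toLp 2 ((0 : L2 a b), F))
    (fun w hw => inner_primitivePair_testPair hab (ζ := WithLp.toLp 2 ((0 : L2 a b), F)) hF hw) u
  rw [WithLp.prod_inner_apply, L2_inner_eq, L2_inner_eq] at this
  have e1 : ∫ x in Ioo a b, (0 : L2 a b) x * (u : WithLp 2 (L2 a b × L2 a b)).fst x = 0 := by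
    rw [integral_congr_ae (g := fun _ => 0), integral_zero]
    filter_upwards [Lp.coeFn_zero ℝ 2 (volume.restrict (Ioo a b))] with x hx
    rw [hx]; simp
  have e2 : ∫ x in Ioo a b, F x * (u : WithLp 2 (L2 a b × L2 a b)).snd x =
      ∫ x in Ioo a b, wderiv u x := by
    refine integral_congr_ae ?_
    filter_upwards [hF'] with x hx
    rw [hx, one_mul]; rfl
  rw [← e2]
  change (∫ x in Ioo a b, (0 : L2 a b) x * (u : WithLp 2 (L2 a b × L2 a b)).fst x) +
    (∫ x in Ioo a b, F x * (u : WithLp 2 (L2 a b × L2 a b)).snd x) = 0 at this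
  rwa [e1, zero_add] at this

/-- An element of `H₀¹(a, b)` is determined by its weak derivative. -/
theorem eq_zero_of_wderiv (hab : a < b) (u : H01 a b) (hu : wderiv u = 0) : u = 0 := by
  have hs : (u : WithLp 2 (L2 a b × L2 a b)).snd = 0 := hu
  have hf : (u : WithLp 2 (L2 a b × L2 a b)).fst = 0 := by
    -- The pair `(u, ∫ u)` is orthogonal to `H₀¹(a, b)`; paired with `(u, 0)` it gives `‖u‖² = 0`.
    obtain ⟨P, hP⟩ := exists_L2_primitive hab (u : WithLp 2 (L2 a b × L2 a b)).fst 0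
    have := inner_H01_eq_zero
      (ζ := WithLp.toLp 2 ((u : WithLp 2 (L2 a b × L2 a b)).fst, P))
      (fun w hw => inner_primitivePair_testPair hab
        (ζ := WithLp.toLp 2 ((u : WithLp 2 (L2 a b × L2 a b)).fst, P)) hP hw) u
    rw [WithLp.prod_inner_apply] at this
    change inner ℝ (u : WithLp 2 (L2 a b × L2 a b)).fst (u : WithLp 2 (L2 a b × L2 a b)).fst +
      inner ℝ P (u : WithLp 2 (L2 a b × L2 a b)).snd = 0 at this
    rw [hs, inner_zero_right, add_zero] at this
    exact inner_self_eq_zero.mp this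
  apply Subtype.ext
  have : (u : WithLp 2 (L2 a b × L2 a b)).ofLp = 0 := Prod.ext hf hs
  exact (WithLp.ofLp_injective 2) this

theorem contRep_left (u : H01 a b) : contRep u a = 0 := by simp [contRep]

theorem contRep_right (hab : a < b) (u : H01 a b) : contRep u b = 0 := by
  rw [contRep, intervalIntegral.integral_of_le hab.le, Measure.restrict_restrict measurableSet_Ioc,
    inter_eq_self_of_subset_right Ioo_subset_Ioc_self, integral_wderiv hab]

/-- The weak derivative tested against the indicator of an interval. -/
theorem inner_indicator_wderiv (u : H01 a b) {x y : ℝ} (hxy : x ≤ y) (k : ℝ) :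
    inner ℝ (indicatorConstLp 2 measurableSet_Ioc (measure_ne_top _ (Ioc x y)) k) (wderiv u) =
      k * (contRep u y - contRep u x) := by
  have hi : ∀ x y, IntervalIntegrable (wderiv u) (volume.restrict (Ioo a b)) x y := fun x y =>
    (integrable_wderiv u).intervalIntegrable
  rw [L2.inner_indicatorConstLp_eq_inner_setIntegral ℝ, contRep, contRep,
    intervalIntegral.integral_interval_sub_left (hi _ _) (hi _ _),
    intervalIntegral.integral_of_le hxy]
  simp [mul_comm]

/-- Cauchy–Schwarz against the indicator of `(x, y]`. This Hölder exponent `1/2` is where the rate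
`ρ^(m/2)` comes from. -/
theorem abs_contRep_sub_le (u : H01 a b) {x y : ℝ} (hxy : x ≤ y) :
    |contRep u y - contRep u x| ≤ √(y - x) * ‖wderiv u‖ := by
  have h := inner_indicator_wderiv u hxy 1
  rw [one_mul] at h
  rw [← h]
  refine (abs_real_inner_le_norm _ _).trans ?_
  gcongr
  refine norm_indicatorConstLp_le.trans ?_
  rw [norm_one, one_mul, Real.sqrt_eq_rpow]
  have : (volume.restrict (Ioo a b)).real (Ioc x y) ≤ y - x := by
    have h1 : (volume.restrict (Ioo a b)) (Ioc x y) ≤ volume (Ioc x y) :=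
      Measure.restrict_apply_le _ _
    rw [Real.volume_Ioc] at h1
    refine (ENNReal.toReal_mono (by simp) h1).trans ?_
    rw [ENNReal.toReal_ofReal (by linarith)]
  rw [ENNReal.toReal_ofNat]
  exact Real.rpow_le_rpow (by positivity) this (by norm_num)

theorem abs_contRep_le_wderiv (u : H01 a b) (x : ℝ) (hx : x ∈ Icc a b) :
    |contRep u x| ≤ √(b - a) * ‖wderiv u‖ := by
  have := abs_contRep_sub_le u hx.1
  rw [contRep_left, sub_zero] at this
  refine this.trans ?_
  gcongr
  linarith [hx.2]

/-- By Lebesgue differentiation, the continuous representative has derivative `u'` almost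
everywhere. -/
theorem wderiv_eq_zero_of_contRep (u : H01 a b)
    (h : ∀ x ∈ Icc a b, contRep u x = 0) : wderiv u = 0 := by
  have hi : LocallyIntegrable ((Ioo a b).indicator (wderiv u)) volume :=
    ((integrable_indicator_iff measurableSet_Ioo).mpr (integrable_wderiv u)).locallyIntegrable
  have hd := LocallyIntegrable.ae_hasDerivAt_integral hi
  refine Lp.ext ?_
  have h0 := Lp.coeFn_zero ℝ 2 (volume.restrict (Ioo a b))
  filter_upwards [ae_restrict_of_ae hd, h0, ae_restrict_mem measurableSet_Ioo] with x h1 h2 h3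
  rw [h2, Pi.zero_apply]
  have h4 := h1 a
  rw [indicator_of_mem h3] at h4
  refine h4.unique ((hasDerivAt_const x (0 : ℝ)).congr_of_eventuallyEq ?_)
  filter_upwards [isOpen_Ioo.mem_nhds h3] with y hy
  rw [← h y (Ioo_subset_Icc_self hy), contRep, intervalIntegral.integral_of_le hy.1.le,
    intervalIntegral.integral_of_le hy.1.le, integral_indicator measurableSet_Ioo,
    Measure.restrict_restrict measurableSet_Ioo, Measure.restrict_restrict measurableSet_Ioc,
    inter_comm]

end Sobolev

/-! ### The domain of the Dirichlet form -/

section Dom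

variable (μ : Measure ℝ) [IsFiniteMeasure μ] (a b : ℝ)

instance : CompleteSpace (DomE μ a b) :=
  (Submodule.isClosed_orthogonal _).completeSpace_coe

/-- The weak derivative as a continuous linear map `Dom ℰ → L²(a, b)`. -/
def gradL : DomE μ a b →L[ℝ] L2 a b :=
  ((WithLp.sndL 2 ℝ (L2 a b) (L2 a b)).comp (H01 a b).subtypeL).comp (DomE μ a b).subtypeL

variable {μ a b}

theorem gradL_apply (u : DomE μ a b) : gradL μ a b u = wderiv (u : H01 a b) := rfl

theorem energy_eq (u v : DomE μ a b) :
    energy u v = inner ℝ (gradL μ a b u) (gradL μ a b v) := by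
  rw [gradL_apply, gradL_apply, L2_inner_eq]; rfl

theorem domNorm_eq (u : DomE μ a b) : domNorm u = ‖gradL μ a b u‖ := by
  rw [domNorm, energy_eq, real_inner_self_eq_norm_sq, Real.sqrt_sq (norm_nonneg _)]

theorem toL2mu_coeFn (u : DomE μ a b) : toL2mu μ u =ᵐ[μ] toFun u :=
  MemLp.coeFn_toLp (memLp_contRep μ a b u)

/-- `Dom ℰ` is the orthogonal complement of the kernel of `iota`, and the two meet only in zero. -/
theorem toL2mu_injective : Function.Injective (toL2mu (a := a) (b := b) μ) := by
  rw [injective_iff_map_eq_zero]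
  intro u hu
  have h1 : (u : H01 a b) ∈ LinearMap.ker (iota μ a b).toLinearMap := hu
  have h2 := (Submodule.mem_orthogonal _ _).mp u.2 _ h1
  exact Subtype.ext (inner_self_eq_zero.mp h2)

/-- If the measure charges every open subset of `[a, b]` then `Dom ℰ` is all of `H₀¹(a, b)`. -/
theorem DomE_eq_top (hab : a < b) (hsupp : μ.support = Icc a b) : DomE μ a b = ⊤ := by
  have : LinearMap.ker (iota μ a b).toLinearMap = ⊥ := by
    rw [eq_bot_iff]
    intro u hu
    have h0 : (memLp_contRep μ a b u).toLp (contRep u) = 0 := hu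
    have h1 : contRep u =ᵐ[μ] 0 := by
      have := MemLp.coeFn_toLp (memLp_contRep μ a b u)
      rw [h0] at this
      exact this.symm.trans (Lp.coeFn_zero ℝ 2 μ)
    refine (Submodule.mem_bot ℝ).mpr (eq_zero_of_wderiv hab u (wderiv_eq_zero_of_contRep u ?_))
    intro x hx
    by_contra hne
    rw [← hsupp, Measure.mem_support_iff_forall] at hx
    have ho : IsOpen {y | contRep u y ≠ 0} := isOpen_ne_fun (continuous_contRep u) continuous_const
    exact (hx _ (ho.mem_nhds hne)).ne' h1
  rw [DomE, this, Submodule.bot_orthogonal_eq_top]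

omit [IsFiniteMeasure μ] in
theorem ae_mem_Icc (hsupp : μ.support = Icc a b) : ∀ᵐ x ∂μ, x ∈ Icc a b := by
  rw [← hsupp]; exact Measure.support_mem_ae

omit [IsFiniteMeasure μ] in
theorem integral_eq_setIntegral_Icc (hsupp : μ.support = Icc a b) (f : ℝ → ℝ) :
    ∫ x in Icc a b, f x ∂μ = ∫ x, f x ∂μ := by
  rw [Measure.restrict_eq_self_of_ae_mem (ae_mem_Icc hsupp)]

theorem inner_toL2mu (u v : DomE μ a b) :
    inner ℝ (toL2mu μ u) (toL2mu μ v) = ∫ x, toFun u x * toFun v x ∂μ := by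
  rw [L2_inner_eq]
  refine integral_congr_ae ?_
  filter_upwards [toL2mu_coeFn u, toL2mu_coeFn v] with x h1 h2
  rw [h1, h2]

end Dom

theorem norm_toL2mu_le_of_bound {μ : Measure ℝ} [IsProbabilityMeasure μ] {a b : ℝ}
    (hsupp : μ.support = Icc a b)
    (u : DomE μ a b) {C : ℝ} (hC : 0 ≤ C) (h : ∀ x ∈ Icc a b, |toFun u x| ≤ C) :
    ‖toL2mu μ u‖ ≤ C := by
  have := Lp.norm_le_of_ae_bound (p := 2) (f := toL2mu μ u) hC (by
    filter_upwards [toL2mu_coeFn u, ae_mem_Icc hsupp] with x h1 h2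
    rw [h1]; exact h x h2)
  simpa [measureUnivNNReal] using this

theorem norm_toL2mu_le {μ : Measure ℝ} [IsProbabilityMeasure μ] {a b : ℝ}
    (hsupp : μ.support = Icc a b) (u : DomE μ a b) :
    ‖toL2mu μ u‖ ≤ √(b - a) * ‖gradL μ a b u‖ :=
  norm_toL2mu_le_of_bound hsupp u (by positivity) fun x hx => by
    rw [gradL_apply]; exact abs_contRep_le_wderiv u.1 x hx

/-! ### Second-order evolution equations in an abstract setting

`V` is the energy space, `J : V → H` the embedding into the pivot space, and the energy form is
`⟪D u, D v⟫` for a continuous linear map `D : V → K`. -/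

section Evolution

variable {V H K : Type*} [NormedAddCommGroup V] [NormedSpace ℝ V]
  [NormedAddCommGroup H] [InnerProductSpace ℝ H] [NormedAddCommGroup K] [InnerProductSpace ℝ K]

/-- The primitive of `f` that vanishes at `0`. -/
def prim (f : ℝ → V) (t : ℝ) : V := ∫ s in (0 : ℝ)..t, f s

omit [NormedSpace ℝ V] in
theorem intervalIntegrable_mono_Icc {f : ℝ → V} {τ t : ℝ} (hf : IntervalIntegrable f volume 0 τ)
    (ht : t ∈ Icc 0 τ) : IntervalIntegrable f volume 0 t := by
  refine hf.mono_set ?_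
  rw [uIcc_of_le ht.1, uIcc_of_le (ht.1.trans ht.2)]
  exact Icc_subset_Icc_right ht.2

theorem continuousOn_prim {f : ℝ → V} {τ : ℝ} (hτ : 0 ≤ τ) (hf : IntervalIntegrable f volume 0 τ) :
    ContinuousOn (prim f) (Icc 0 τ) := by
  have h := intervalIntegral.continuousOn_primitive_interval' hf left_mem_uIcc
  rwa [uIcc_of_le hτ] at h

omit [NormedSpace ℝ V] in
theorem intervalIntegrable_of_continuousOn_Icc {f : ℝ → V} {τ : ℝ} (hτ : 0 ≤ τ)
    (hf : ContinuousOn f (Icc 0 τ)) : IntervalIntegrable f volume 0 τ := by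
  rw [← uIcc_of_le hτ] at hf; exact hf.intervalIntegrable

theorem intervalIntegrable_prim {f : ℝ → V} {τ : ℝ} (hτ : 0 ≤ τ)
    (hf : IntervalIntegrable f volume 0 τ) : IntervalIntegrable (prim f) volume 0 τ :=
  intervalIntegrable_of_continuousOn_Icc hτ (continuousOn_prim hτ hf)

theorem map_prim {W : Type*} [NormedAddCommGroup W] [NormedSpace ℝ W] [CompleteSpace V]
    [CompleteSpace W] (L : V →L[ℝ] W) {f : ℝ → V} {τ t : ℝ}
    (hf : IntervalIntegrable f volume 0 τ) (ht : t ∈ Icc 0 τ) :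
    L (prim f t) = prim (fun s => L (f s)) t :=
  (L.intervalIntegral_comp_comm (intervalIntegrable_mono_Icc hf ht)).symm

theorem prim_congr_Icc {f g : ℝ → V} {τ t : ℝ} (h : ∀ s ∈ Icc 0 τ, f s = g s) (ht : t ∈ Icc 0 τ) :
    prim f t = prim g t := by
  refine intervalIntegral.integral_congr fun s hs => h s ?_
  rw [uIcc_of_le ht.1] at hs
  exact ⟨hs.1, hs.2.trans ht.2⟩

theorem norm_map_prim_le {W : Type*} [NormedAddCommGroup W] [NormedSpace ℝ W] [CompleteSpace V]
    [CompleteSpace W] (L : V →L[ℝ] W) {f : ℝ → V} {τ t : ℝ}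
    (hf : IntervalIntegrable f volume 0 τ) (ht : t ∈ Icc 0 τ) :
    ‖L (prim f t)‖ ≤ ∫ s in (0 : ℝ)..τ, ‖L (f s)‖ := by
  rw [map_prim L hf ht]
  refine (intervalIntegral.norm_integral_le_integral_norm ht.1).trans ?_
  have hi : IntervalIntegrable (fun s => ‖L (f s)‖) volume 0 τ := by
    rw [intervalIntegrable_iff] at hf ⊢
    exact (L.integrable_comp hf).norm
  exact intervalIntegral.integral_mono_interval le_rfl ht.1 ht.2
    (Filter.Eventually.of_forall fun _ => norm_nonneg _) hi

theorem norm_map_prim_le_of_bound {W : Type*} [NormedAddCommGroup W] [NormedSpace ℝ W]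
    [CompleteSpace V] [CompleteSpace W] (L : V →L[ℝ] W) {f : ℝ → V} {τ t C : ℝ}
    (hf : IntervalIntegrable f volume 0 τ) (ht : t ∈ Icc 0 τ) (hC : ∀ s ∈ Icc 0 τ, ‖L (f s)‖ ≤ C) :
    ‖L (prim f t)‖ ≤ C * τ := by
  have hC0 : 0 ≤ C := (norm_nonneg _).trans (hC t ht)
  rw [map_prim L hf ht]
  refine (intervalIntegral.norm_integral_le_of_norm_le_const (C := C) fun s hs => ?_).trans ?_
  · rw [uIoc_of_le ht.1] at hs
    exact hC s ⟨hs.1.le, hs.2.trans ht.2⟩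
  · rw [sub_zero, abs_of_nonneg ht.1]
    exact mul_le_mul_of_nonneg_left ht.2 hC0

variable [CompleteSpace V]

/-- The integrated form of `d/dt ‖L y‖² = 2 ⟪L y', L y⟫` for `y = prim f`, available for merely
integrable `f`. -/
theorem norm_sq_map_prim (L : V →L[ℝ] H) {f : ℝ → V} {τ t : ℝ}
    (hf : IntervalIntegrable f volume 0 τ) (ht : t ∈ Icc 0 τ) :
    ‖L (prim f t)‖ ^ 2 = ∫ s in (0 : ℝ)..t, 2 * inner ℝ (L (f s)) (L (prim f s)) := by
  have hft := intervalIntegrable_mono_Icc hf ht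
  have h := bilin_primitive ((innerSL ℝ).bilinearComp L L) ht.1 hft hft
  simp only [ContinuousLinearMap.bilinearComp_apply, innerSL_apply_apply] at h
  rw [← real_inner_self_eq_norm_sq, prim, h]
  refine intervalIntegral.integral_congr fun s _ => ?_
  simp only [prim]
  rw [real_inner_comm (L (f s)) (L (∫ r in (0 : ℝ)..s, f r)), two_mul]

omit [CompleteSpace V] in
theorem intervalIntegrable_inner_prim (L : V →L[ℝ] H) {f g : ℝ → V} {τ : ℝ} (hτ : 0 ≤ τ)
    (hf : IntervalIntegrable f volume 0 τ) (hg : ContinuousOn g (Icc 0 τ)) :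
    IntervalIntegrable (fun s => inner ℝ (L (f s)) (L (g s))) volume 0 τ := by
  obtain ⟨C, hC⟩ := isCompact_Icc.exists_bound_of_continuousOn (L.continuous.comp_continuousOn hg)
  rw [intervalIntegrable_iff, uIoc_of_le hτ] at hf ⊢
  have hgm : AEStronglyMeasurable g (volume.restrict (Ioc 0 τ)) :=
    (hg.mono Ioc_subset_Icc_self).aestronglyMeasurable measurableSet_Ioc
  have hm : AEStronglyMeasurable (fun s => inner ℝ (L (f s)) (L (g s)))
      (volume.restrict (Ioc 0 τ)) :=
    ((innerSL ℝ).bilinearComp L L).aestronglyMeasurable_comp₂ hf.1 hgm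
  refine ((L.integrable_comp hf).norm.mul_const C).mono' hm ?_
  filter_upwards [ae_restrict_mem measurableSet_Ioc] with s hs
  refine (norm_inner_le_norm _ _).trans ?_
  exact mul_le_mul_of_nonneg_left (hC s (Ioc_subset_Icc_self hs)) (norm_nonneg _)

/-- The energy estimate for `y'' + A y = F`, `y(0) = y'(0) = 0`, where `y'' = f`. -/
theorem energy_estimate (J : V →L[ℝ] H) (D : V →L[ℝ] K) {τ : ℝ} {f : ℝ → V} {F : ℝ → H}
    (hf : IntervalIntegrable f volume 0 τ) (hF : IntervalIntegrable F volume 0 τ)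
    (h : ∀ᵐ t ∂(volume.restrict (Ioc 0 τ)), inner ℝ (J (f t)) (J (prim f t)) +
      inner ℝ (D (prim (prim f) t)) (D (prim f t)) = inner ℝ (F t) (J (prim f t)))
    {t : ℝ} (ht : t ∈ Icc 0 τ) :
    ‖J (prim f t)‖ ≤ 2 * ∫ s in (0 : ℝ)..τ, ‖F s‖ ∧
    ‖D (prim (prim f) t)‖ ≤ 2 * ∫ s in (0 : ℝ)..τ, ‖F s‖ := by
  have hτ : 0 ≤ τ := ht.1.trans ht.2
  have hc1 := continuousOn_prim hτ hf
  have hf1 := intervalIntegrable_prim hτ hf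
  have hc2 := continuousOn_prim hτ hf1
  set A := ∫ s in (0 : ℝ)..τ, ‖F s‖ with hA
  have hA0 : 0 ≤ A := intervalIntegral.integral_nonneg hτ fun _ _ => norm_nonneg _
  let z : ℝ → ℝ := fun t => ‖J (prim f t)‖ ^ 2 + ‖D (prim (prim f) t)‖ ^ 2
  have hz : ContinuousOn z (Icc 0 τ) :=
    ((J.continuous.comp_continuousOn hc1).norm.pow 2).add
      ((D.continuous.comp_continuousOn hc2).norm.pow 2)
  obtain ⟨t₀, ht₀, hmax⟩ := isCompact_Icc.exists_isMaxOn (nonempty_Icc.mpr hτ) hz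
  have hz0 : ∀ s, 0 ≤ z s := fun s => by positivity
  -- At the maximum point `t₀` of the energy, the estimate `z t₀ ≤ 2 A M` is quadratic in `M`, and
  -- division by `M` bounds `M` by `2 A` without Grönwall's inequality.
  set M := √(z t₀)
  have hM : ∀ s ∈ Icc 0 τ, ‖J (prim f s)‖ ≤ M := fun s hs =>
    Real.le_sqrt_of_sq_le ((le_add_of_nonneg_right (sq_nonneg _)).trans (hmax hs))
  have hi1 := (intervalIntegrable_inner_prim J hτ hf hc1).const_mul 2
  have hi2 : IntervalIntegrable (fun s => 2 * inner ℝ (D (prim f s)) (D (prim (prim f) s)))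
      volume 0 τ := (intervalIntegrable_inner_prim D hτ hf1 hc2).const_mul 2
  have hbound : z t₀ ≤ 2 * A * M := by
    have e : z t₀ = ∫ s in (0 : ℝ)..t₀, (2 * inner ℝ (J (f s)) (J (prim f s)) +
        2 * inner ℝ (D (prim f s)) (D (prim (prim f) s))) := by
      rw [intervalIntegral.integral_add (intervalIntegrable_mono_Icc hi1 ht₀)
        (intervalIntegrable_mono_Icc hi2 ht₀), ← norm_sq_map_prim J hf ht₀,
        ← norm_sq_map_prim D hf1 ht₀]
    have hi3 : IntervalIntegrable (fun s => ‖F s‖ * (2 * M)) volume 0 τ := hF.norm.mul_const _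
    have h1 : z t₀ ≤ ∫ s in (0 : ℝ)..t₀, ‖F s‖ * (2 * M) := by
      rw [e]
      refine intervalIntegral.integral_mono_ae_restrict ht₀.1
        ((intervalIntegrable_mono_Icc hi1 ht₀).add (intervalIntegrable_mono_Icc hi2 ht₀))
        (intervalIntegrable_mono_Icc hi3 ht₀) ?_
      rw [Filter.EventuallyLE, ← restrict_Ioc_eq_restrict_Icc]
      filter_upwards [ae_restrict_of_ae_restrict_of_subset (Ioc_subset_Ioc_right ht₀.2) h,
        ae_restrict_mem measurableSet_Ioc] with s hs hs'
      have h2 := hM s ⟨hs'.1.le, hs'.2.trans ht₀.2⟩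
      have h3 := real_inner_le_norm (F s) (J (prim f s))
      have h4 := mul_le_mul_of_nonneg_left h2 (norm_nonneg (F s))
      have h5 := real_inner_comm (D (prim f s)) (D (prim (prim f) s))
      linarith
    refine h1.trans ?_
    have h5 := intervalIntegral.integral_mono_interval (μ := volume) (f := fun s => ‖F s‖ * (2 * M))
      le_rfl ht₀.1 ht₀.2 (Filter.Eventually.of_forall fun s => by simp only [Pi.zero_apply]; positivity) hi3
    refine h5.trans (le_of_eq ?_)
    rw [intervalIntegral.integral_mul_const]; ring
  have hMA : M ≤ 2 * A := by
    have hsq : M * M = z t₀ := Real.mul_self_sqrt (hz0 _)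
    rcases (Real.sqrt_nonneg (z t₀)).eq_or_lt with h0 | h0
    · change 0 = M at h0; rw [← h0]; positivity
    · exact le_of_mul_le_mul_right (hsq.le.trans hbound) h0
  refine ⟨(hM t ht).trans hMA, le_trans ?_ hMA⟩
  exact Real.le_sqrt_of_sq_le ((le_add_of_nonneg_left (sq_nonneg _)).trans (hmax ht))

/-- `um` is a semidiscrete Galerkin approximation (with derivatives `um1`, `um2`) in the range of the
Ritz projection `P`, whose error in `H` is at most `ε` times the energy norm. -/
structure IsGalerkin (J : V →L[ℝ] H) (D : V →L[ℝ] K) (P : V →L[ℝ] V) (τ ε : ℝ) (g h : V)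
    (um um1 um2 : ℝ → V) : Prop where
  idem : ∀ w, P (P w) = P w
  ritz : ∀ w v, P v = v → inner ℝ (D (w - P w)) (D v) = 0
  approx : ∀ w, ‖J (w - P w)‖ ≤ ε * ‖D w‖
  mem : ∀ t, P (um t) = um t
  mem1 : ∀ t, P (um1 t) = um1 t
  mem2 : ∀ t, P (um2 t) = um2 t
  hasDeriv : ∀ t, HasDerivAt um (um1 t) t
  hasDeriv1 : ∀ t, HasDerivAt um1 (um2 t) t
  cont2 : Continuous um2
  eqn : ∀ t ∈ Icc 0 τ, ∀ v, P v = v → inner ℝ (J (um2 t)) (J v) + inner ℝ (D (um t)) (D v) = 0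
  init : um 0 = P g
  init1 : um1 0 = P h

omit [CompleteSpace V] in
/-- The product rule for the square of the norm of the image of a differentiable curve. -/
theorem hasDerivAt_norm_sq_map (L : V →L[ℝ] H) {f : ℝ → V} {f' : V} {t : ℝ}
    (hf : HasDerivAt f f' t) :
    HasDerivAt (fun s => ‖L (f s)‖ ^ 2) (2 * inner ℝ (L (f t)) (L f')) t :=
  (L.hasFDerivAt.comp_hasDerivAt t hf).norm_sq

namespace IsGalerkin

variable {J : V →L[ℝ] H} {D : V →L[ℝ] K} {P : V →L[ℝ] V} {τ ε : ℝ} {g h : V}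
  {um um1 um2 : ℝ → V} (G : IsGalerkin J D P τ ε g h um um1 um2)
include G

omit [CompleteSpace V] in
theorem norm_D_proj_le (w : V) : ‖D (P w)‖ ≤ ‖D w‖ := by
  have h1 := G.ritz w (P w) (G.idem w)
  rw [map_sub, inner_sub_left, real_inner_self_eq_norm_sq, sub_eq_zero] at h1
  have h2 := real_inner_le_norm (D w) (D (P w))
  rcases (norm_nonneg (D (P w))).eq_or_lt with h0 | h0
  · rw [← h0]; exact norm_nonneg _
  · refine le_of_mul_le_mul_right ?_ h0
    nlinarith

omit [CompleteSpace V] in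
theorem continuous_um : Continuous um :=
  continuous_iff_continuousAt.mpr fun t => (G.hasDeriv t).continuousAt

omit [CompleteSpace V] in
theorem continuous_um1 : Continuous um1 :=
  continuous_iff_continuousAt.mpr fun t => (G.hasDeriv1 t).continuousAt

theorem um1_eq (t : ℝ) : um1 t = P h + prim um2 t := by
  rw [prim, intervalIntegral.integral_eq_sub_of_hasDerivAt (fun s _ => G.hasDeriv1 s)
    (G.cont2.intervalIntegrable _ _), G.init1]
  abel

/-- Taylor's formula with integral remainder, the form in which `um` can be compared with the weak
solution. -/
theorem um_eq (t : ℝ) : um t = P g + t • P h + prim (prim um2) t := by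
  have h1 : um t - P g = ∫ s in (0 : ℝ)..t, um1 s := by
    rw [intervalIntegral.integral_eq_sub_of_hasDerivAt (fun s _ => G.hasDeriv s)
      (G.continuous_um1.intervalIntegrable _ _), G.init]
  have h2 : (∫ s in (0 : ℝ)..t, um1 s) = t • P h + prim (prim um2) t := by
    have hc : Continuous (prim um2) :=
      intervalIntegral.continuous_primitive (fun _ _ => G.cont2.intervalIntegrable _ _) 0
    rw [prim, intervalIntegral.integral_congr (g := fun s => P h + prim um2 s)
      (fun s _ => G.um1_eq s), intervalIntegral.integral_add (by simp)
      (hc.intervalIntegrable _ _)]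
    simp
  rw [add_assoc, ← h2, ← h1]; abel

omit [CompleteSpace V] in
/-- Conservation of the discrete energy. -/
theorem energy_conservation {t : ℝ} (ht : t ∈ Icc 0 τ) :
    ‖J (um1 t)‖ ^ 2 + ‖D (um t)‖ ^ 2 = ‖J (P h)‖ ^ 2 + ‖D (P g)‖ ^ 2 := by
  have hd : ∀ s ∈ Icc 0 τ, HasDerivAt (fun s => ‖J (um1 s)‖ ^ 2 + ‖D (um s)‖ ^ 2) 0 s := by
    intro s hs
    have h1 := (hasDerivAt_norm_sq_map J (G.hasDeriv1 s)).add (hasDerivAt_norm_sq_map D (G.hasDeriv s))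
    -- The velocity is an admissible test vector because it stays in the range of `P`.
    have h2 := G.eqn s hs (um1 s) (G.mem1 s)
    rw [real_inner_comm] at h2
    have h3 : 2 * inner ℝ (J (um1 s)) (J (um2 s)) + 2 * inner ℝ (D (um s)) (D (um1 s)) = 0 := by
      linarith
    rwa [h3] at h1
  have hc : ContinuousOn (fun s => ‖J (um1 s)‖ ^ 2 + ‖D (um s)‖ ^ 2) (Icc 0 τ) := fun s hs =>
    (hd s hs).continuousAt.continuousWithinAt
  have := constant_of_has_deriv_right_zero hc
    (fun s hs => (hd s (Ico_subset_Icc_self hs)).hasDerivWithinAt) t ht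
  rw [this, G.init, G.init1]

-- The bound does not involve `P`: all Galerkin approximations are Lipschitz in `H` with the same
-- constant.
omit [CompleteSpace V] in
theorem norm_um1_le {κ : ℝ} (hκ : 0 ≤ κ) (hJ : ∀ v, ‖J v‖ ≤ κ * ‖D v‖) {t : ℝ} (ht : t ∈ Icc 0 τ) :
    ‖J (um1 t)‖ ≤ κ * ‖D h‖ + ‖D g‖ := by
  have h1 := G.energy_conservation ht
  have h2 : ‖J (P h)‖ ≤ κ * ‖D h‖ :=
    (hJ _).trans (mul_le_mul_of_nonneg_left (G.norm_D_proj_le h) hκ)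
  have h3 := G.norm_D_proj_le g
  refine le_of_sq_le_sq ?_ (by positivity)
  have h4 : ‖J (P h)‖ ^ 2 ≤ (κ * ‖D h‖) ^ 2 := by gcongr
  have h5 : ‖D (P g)‖ ^ 2 ≤ ‖D g‖ ^ 2 := by gcongr
  nlinarith [sq_nonneg ‖D (um t)‖, mul_nonneg (mul_nonneg hκ (norm_nonneg (D h))) (norm_nonneg (D g))]

end IsGalerkin

end Evolution

/-! ### Error estimates for abstract Galerkin approximations, and an a priori bound for regular
solutions. -/

section EvolutionEstimates

variable {V H K : Type*} [NormedAddCommGroup V] [NormedSpace ℝ V]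
  [NormedAddCommGroup H] [InnerProductSpace ℝ H] [NormedAddCommGroup K] [InnerProductSpace ℝ K]
  [CompleteSpace V]

theorem map_prim_prim {W : Type*} [NormedAddCommGroup W] [NormedSpace ℝ W]
    [CompleteSpace W] (L : V →L[ℝ] W) {f : ℝ → V} {τ t : ℝ}
    (hf : IntervalIntegrable f volume 0 τ) (ht : t ∈ Icc 0 τ) :
    L (prim (prim f) t) = prim (prim fun s => L (f s)) t := by
  rw [map_prim L (intervalIntegrable_prim (ht.1.trans ht.2) hf) ht]
  exact prim_congr_Icc (fun s hs => map_prim L hf hs) ht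

omit [CompleteSpace V] in
theorem prim_sub {f g : ℝ → V} {τ t : ℝ} (hf : IntervalIntegrable f volume 0 τ)
    (hg : IntervalIntegrable g volume 0 τ) (ht : t ∈ Icc 0 τ) :
    prim (fun s => f s - g s) t = prim f t - prim g t :=
  intervalIntegral.integral_sub (intervalIntegrable_mono_Icc hf ht)
    (intervalIntegrable_mono_Icc hg ht)

omit [CompleteSpace V] in
theorem prim_prim_sub {f g : ℝ → V} {τ t : ℝ} (hf : IntervalIntegrable f volume 0 τ)
    (hg : IntervalIntegrable g volume 0 τ) (ht : t ∈ Icc 0 τ) :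
    prim (prim fun s => f s - g s) t = prim (prim f) t - prim (prim g) t := by
  have hτ := ht.1.trans ht.2
  rw [← prim_sub (intervalIntegrable_prim hτ hf) (intervalIntegrable_prim hτ hg) ht]
  exact prim_congr_Icc (fun s hs => prim_sub hf hg hs) ht

/-- The functional `⟪L ·, L v⟫`. -/
def pairing (L : V →L[ℝ] H) (v : V) : V →L[ℝ] ℝ := (innerSL ℝ (L v)).comp L

omit [CompleteSpace V] in
theorem pairing_apply (L : V →L[ℝ] H) (v w : V) : pairing L v w = inner ℝ (L w) (L v) := by
  rw [real_inner_comm]; rfl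

omit [CompleteSpace V] in
theorem intervalIntegrable_map {W : Type*} [NormedAddCommGroup W] [NormedSpace ℝ W]
    (L : V →L[ℝ] W) {f : ℝ → V} {τ : ℝ} (hf : IntervalIntegrable f volume 0 τ) :
    IntervalIntegrable (fun s => L (f s)) volume 0 τ := by
  rw [intervalIntegrable_iff] at hf ⊢
  exact L.integrable_comp hf

/-- The wave equation `u'' + A u = 0`, `u(0) = g`, `u'(0) = h`, integrated twice in time. -/
structure IsIntegratedSolution (J : V →L[ℝ] H) (D : V →L[ℝ] K) (τ : ℝ) (g h : V) (u : ℝ → V) :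
    Prop where
  integrable : IntervalIntegrable u volume 0 τ
  cont : ContinuousOn (fun t => J (u t)) (Icc 0 τ)
  eqn : ∀ t ∈ Icc 0 τ, ∀ v, inner ℝ (J (u t)) (J v) + inner ℝ (D (prim (prim u) t)) (D v) =
    inner ℝ (J (g + t • h)) (J v)

/-- A solution of the wave equation `u'' + A u = 0`, `u(0) = g`, `u'(0) = h` whose second
derivative `utt` takes values in the energy space. -/
structure IsRegularSolution (J : V →L[ℝ] H) (D : V →L[ℝ] K) (τ : ℝ) (g h : V) (u utt : ℝ → V) :
    Prop where
  integrable : IntervalIntegrable u volume 0 τ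
  integrable_utt : IntervalIntegrable utt volume 0 τ
  eq_prim : ∀ t ∈ Icc 0 τ, u t = g + t • h + prim (prim utt) t
  eqn : ∀ t ∈ Icc 0 τ, ∀ v, inner ℝ (J (prim utt t)) (J v) + inner ℝ (D (prim u t)) (D v) = 0

variable {J : V →L[ℝ] H} {D : V →L[ℝ] K} {P : V →L[ℝ] V} {τ ε : ℝ} {g h : V}
  {um um1 um2 u utt : ℝ → V}

namespace IsGalerkin

theorem integrated_eqn (G : IsGalerkin J D P τ ε g h um um1 um2) {t : ℝ} (ht : t ∈ Icc 0 τ) {v : V}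
    (hv : P v = v) : inner ℝ (J (um t)) (J v) + inner ℝ (D (prim (prim um) t)) (D v) =
      inner ℝ (J (P g + t • P h)) (J v) := by
  have i2 : IntervalIntegrable um2 volume 0 τ := G.cont2.intervalIntegrable _ _
  have i0 : IntervalIntegrable um volume 0 τ := G.continuous_um.intervalIntegrable _ _
  -- The Galerkin equation for a fixed `v`, integrated twice; the initial data enter only through
  -- `um_eq`.
  have e : pairing J v (prim (prim um2) t) = - pairing D v (prim (prim um) t) := by
    change _ = (-pairing D v) _
    rw [map_prim_prim _ i2 ht, map_prim_prim _ i0 ht]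
    refine prim_congr_Icc (fun s hs => prim_congr_Icc (fun r hr => ?_) hs) ht
    have := G.eqn r hr v hv
    rw [neg_apply, pairing_apply, pairing_apply]
    linarith
  rw [pairing_apply, pairing_apply] at e
  rw [G.um_eq t, map_add J (P g + t • P h), inner_add_left, e]
  ring

/-- The time-integrated error of the Galerkin approximation. -/
theorem norm_prim_error_le (G : IsGalerkin J D P τ ε g h um um1 um2)
    (S : IsIntegratedSolution J D τ g h u) (hε : 0 ≤ ε) [CompleteSpace H] {t : ℝ}
    (ht : t ∈ Icc 0 τ) :
    ‖J (prim (fun s => u s - um s) t)‖ ≤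
      3 * (ε * ∫ s in (0 : ℝ)..τ, (‖D (u s)‖ + ‖D g‖ + τ * ‖D h‖)) := by
  have hτ := ht.1.trans ht.2
  have iu := S.integrable
  have im : IntervalIntegrable um volume 0 τ := G.continuous_um.intervalIntegrable _ _
  have iPu := intervalIntegrable_map P iu
  have iDu : IntervalIntegrable (fun s => ‖D (u s)‖) volume 0 τ := (intervalIntegrable_map D iu).norm
  set Q := ∫ s in (0 : ℝ)..τ, (‖D (u s)‖ + ‖D g‖ + τ * ‖D h‖) with hQ
  have iQ : IntervalIntegrable (fun s => ‖D (u s)‖ + ‖D g‖ + τ * ‖D h‖) volume 0 τ :=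
    (iDu.add (by simp)).add (by simp)
  -- Here `f` plays the role of `y''` in `energy_estimate`, so the bound on `y'` is a bound on the
  -- time integral of `f`. Ritz orthogonality removes the energy part of the projection error,
  -- leaving in `F` only the `H`-errors of `P` on `u`, `g` and `h`.
  let f : ℝ → V := fun s => P (u s) - um s
  let F : ℝ → H := fun s => J (P (u s) - u s) + (J (g - P g) + s • J (h - P h))
  have hf : IntervalIntegrable f volume 0 τ := iPu.sub im
  have hF : IntervalIntegrable F volume 0 τ := by
    refine (intervalIntegrable_map J (iPu.sub iu)).add ?_
    exact Continuous.intervalIntegrable (by fun_prop) _ _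
  have hPf : ∀ s, P (f s) = f s := fun s => by simp only [f, map_sub, G.idem, G.mem]
  have hP1 : ∀ s ∈ Icc 0 τ, P (prim f s) = prim f s := fun s hs => by
    rw [map_prim P hf hs]; exact prim_congr_Icc (fun r _ => hPf r) hs
  have hP2 : ∀ s ∈ Icc 0 τ, prim (prim f) s = P (prim (prim u) s) - prim (prim um) s :=
    fun s hs => by rw [prim_prim_sub iPu im hs, map_prim_prim P iu hs]
  have key := (energy_estimate J D hf hF (by
    filter_upwards [ae_restrict_mem measurableSet_Ioc] with s hs
    have hs' := Ioc_subset_Icc_self hs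
    rw [hP2 s hs']
    have hv := hP1 s hs'
    set v := prim f s
    have e1 := G.integrated_eqn hs' hv
    have e2 := S.eqn s hs' v
    have e3 := G.ritz (prim (prim u) s) v hv
    simp only [f, F, map_sub, map_add, map_smul, inner_sub_left, inner_add_left,
      inner_smul_left, smul_sub] at e1 e2 e3 ⊢
    linarith) ht).1
  have hFn : ∫ s in (0 : ℝ)..τ, ‖F s‖ ≤ ε * Q := by
    rw [hQ, ← intervalIntegral.integral_const_mul]
    refine intervalIntegral.integral_mono_on hτ hF.norm (iQ.const_mul ε) fun s hs => ?_
    have a1 := G.approx (u s)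
    have a2 := G.approx g
    have a3 := G.approx h
    rw [← norm_neg, ← map_neg, neg_sub] at a1
    calc ‖F s‖ ≤ ‖J (P (u s) - u s)‖ + (‖J (g - P g)‖ + ‖s • J (h - P h)‖) :=
          (norm_add_le _ _).trans (add_le_add_right (norm_add_le _ _) _)
      _ ≤ ε * ‖D (u s)‖ + (ε * ‖D g‖ + τ * (ε * ‖D h‖)) := by
          rw [norm_smul, Real.norm_of_nonneg hs.1]
          gcongr
          exact hs.2
      _ = _ := by ring
  have hrest : ‖J (prim (fun s => u s - P (u s)) t)‖ ≤ ε * Q := by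
    refine (norm_map_prim_le J (iu.sub iPu) ht).trans ?_
    rw [hQ, ← intervalIntegral.integral_const_mul]
    refine intervalIntegral.integral_mono_on hτ (intervalIntegrable_map J (iu.sub iPu)).norm
      (iQ.const_mul ε) fun s hs => (G.approx (u s)).trans ?_
    gcongr
    have := mul_nonneg hτ (norm_nonneg (D h))
    linarith [norm_nonneg (D g)]
  -- The factor `3` is `2` from the energy estimate for `P u - um` plus `1` from `u - P u`.
  have hsum : prim (fun s => u s - um s) t = prim (fun s => u s - P (u s)) t + prim f t := by
    rw [prim_sub iu im ht, prim_sub iu iPu ht, prim_sub iPu im ht]; abel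
  rw [hsum, map_add]
  refine (norm_add_le _ _).trans ?_
  linarith

/-- The error estimate in the energy norm for regular solutions. -/
theorem norm_D_error_le (G : IsGalerkin J D P τ ε g h um um1 um2)
    (S : IsRegularSolution J D τ g h u utt) [CompleteSpace H] {t : ℝ} (ht : t ∈ Icc 0 τ) :
    ‖D (P (u t) - um t)‖ ≤ 2 * (ε * ∫ s in (0 : ℝ)..τ, ‖D (utt s)‖) := by
  have hτ := ht.1.trans ht.2
  have iu := S.integrable_utt
  have im : IntervalIntegrable um2 volume 0 τ := G.cont2.intervalIntegrable _ _
  have iPu := intervalIntegrable_map P iu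
  -- The double primitive of `f` is exactly `P u - um`, since both curves start at `P g` with
  -- velocity `P h`.
  let f : ℝ → V := fun s => P (utt s) - um2 s
  let F : ℝ → H := fun s => J (P (utt s) - utt s)
  have hf : IntervalIntegrable f volume 0 τ := iPu.sub im
  have hF : IntervalIntegrable F volume 0 τ := intervalIntegrable_map J (iPu.sub iu)
  have hPf : ∀ s, P (f s) = f s := fun s => by simp only [f, map_sub, G.idem, G.mem2]
  have hP1 : ∀ s ∈ Icc 0 τ, P (prim f s) = prim f s := fun s hs => by
    rw [map_prim P hf hs]; exact prim_congr_Icc (fun r _ => hPf r) hs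
  have hP2 : ∀ s ∈ Icc 0 τ, prim (prim f) s = P (u s) - um s := fun s hs => by
    rw [prim_prim_sub iPu im hs, ← map_prim_prim P iu hs, G.um_eq s, S.eq_prim s hs]
    simp only [map_add, map_smul]; abel
  -- The exceptional null set must not depend on `v`, since the test vector used below varies with
  -- time. Differentiating the vector-valued primitives first, and pairing with `v` afterwards,
  -- achieves this.
  have hae : ∀ᵐ s ∂(volume.restrict (Ioc 0 τ)), ∀ v, inner ℝ (J (utt s)) (J v) +
      inner ℝ (D (u s)) (D v) = 0 := by
    rw [← restrict_Ioo_eq_restrict_Ioc, ae_restrict_iff' measurableSet_Ioo]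
    filter_upwards [IntervalIntegrable.ae_hasDerivAt_integral iu,
      IntervalIntegrable.ae_hasDerivAt_integral S.integrable] with s h1 h2 hs v
    have hs' : s ∈ uIcc 0 τ := by rw [uIcc_of_le hτ]; exact Ioo_subset_Icc_self hs
    have d1 := (pairing J v).hasFDerivAt.comp_hasDerivAt s (h1 hs' 0 left_mem_uIcc)
    have d2 := (pairing D v).hasFDerivAt.comp_hasDerivAt s (h2 hs' 0 left_mem_uIcc)
    have d3 := d1.add d2
    rw [pairing_apply, pairing_apply] at d3
    refine d3.unique ((hasDerivAt_const s (0 : ℝ)).congr_of_eventuallyEq ?_)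
    filter_upwards [isOpen_Ioo.mem_nhds hs] with r hr
    have := S.eqn r (Ioo_subset_Icc_self hr) v
    simp only [Pi.add_apply, Function.comp_apply, pairing_apply]
    exact this
  have key := (energy_estimate J D hf hF (by
    filter_upwards [ae_restrict_mem measurableSet_Ioc, hae] with s hs he
    have hs' := Ioc_subset_Icc_self hs
    rw [hP2 s hs']
    have hv := hP1 s hs'
    set v := prim f s
    have e1 := G.eqn s hs' v hv
    have e2 := he v
    have e3 := G.ritz (u s) v hv
    simp only [f, F, map_sub, inner_sub_left] at e1 e2 e3 ⊢
    linarith) ht).2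
  rw [hP2 t ht] at key
  refine key.trans ?_
  gcongr
  rw [← intervalIntegral.integral_const_mul]
  refine intervalIntegral.integral_mono_on hτ hF.norm
    ((intervalIntegrable_map D iu).norm.const_mul ε) fun s _ => ?_
  have a1 := G.approx (utt s)
  rwa [← norm_neg, ← map_neg, neg_sub] at a1

end IsGalerkin

/-- Convergence of the Galerkin approximations at a fixed time. -/
theorem IsIntegratedSolution.exists_error_le [CompleteSpace H] (S : IsIntegratedSolution J D τ g h u)
    (hτ : 0 < τ) {κ : ℝ} (hκ : 0 ≤ κ) (hJ : ∀ v, ‖J v‖ ≤ κ * ‖D v‖) {t : ℝ} (ht : t ∈ Icc 0 τ)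
    {η : ℝ} (hη : 0 < η) :
    ∃ ε₀ : ℝ, 0 < ε₀ ∧ ∀ (P : V →L[ℝ] V) (ε : ℝ) (um um1 um2 : ℝ → V), 0 ≤ ε → ε ≤ ε₀ →
      IsGalerkin J D P τ ε g h um um1 um2 → ‖J (um t - u t)‖ ≤ η := by
  set R := κ * ‖D h‖ + ‖D g‖
  have hR : 0 ≤ R := by positivity
  set Q := ∫ s in (0 : ℝ)..τ, (‖D (u s)‖ + ‖D g‖ + τ * ‖D h‖)
  have hQ : 0 ≤ Q := intervalIntegral.integral_nonneg hτ.le fun _ _ => by positivity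
  obtain ⟨δ, hδ, hcont⟩ := Metric.continuousOn_iff.mp S.cont t ht (η / 3) (by positivity)
  -- The length of the averaging window: below `δ`, so that `J u` moves by less than `η / 3`; small
  -- against `R`, so that `J um` moves by at most `η / 3`; at most `τ / 2`, so that a window on one
  -- side of `t` fits into `[0, τ]`.
  set δ' := min (min (δ / 2) (η / (3 * (R + 1)))) (τ / 2) with hδ'
  have hδ'0 : 0 < δ' := by positivity
  have hd1 : δ' < δ := ((min_le_left _ _).trans (min_le_left _ _)).trans_lt (by linarith)
  have hd2 : R * δ' ≤ η / 3 := by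
    have h1 : δ' ≤ η / (3 * (R + 1)) := (min_le_left _ _).trans (min_le_right _ _)
    rw [le_div_iff₀ (by positivity)] at h1
    nlinarith
  have hd3 : δ' ≤ τ / 2 := min_le_right _ _
  obtain ⟨l, r, hl0, hlr, hrτ, htl, htr⟩ : ∃ l r, 0 ≤ l ∧ r = l + δ' ∧ r ≤ τ ∧ l ≤ t ∧ t ≤ r := by
    rcases le_total t (τ / 2) with h1 | h1
    · exact ⟨t, t + δ', ht.1, rfl, by linarith, le_rfl, by linarith⟩
    · exact ⟨t - δ', t, by linarith, by ring, ht.2, by linarith, le_rfl⟩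
  -- Chosen so that the integrated error `3 ε Q` is at most `η δ' / 6` at each end of the window;
  -- the `+ 1` guards against `Q = 0`.
  refine ⟨η * δ' / (18 * (Q + 1)), by positivity, fun P ε um um1 um2 hε hεle G => ?_⟩
  have hl : l ∈ Icc 0 τ := ⟨hl0, by linarith⟩
  have hr : r ∈ Icc 0 τ := ⟨by linarith, hrτ⟩
  have im : IntervalIntegrable um volume 0 τ := G.continuous_um.intervalIntegrable _ _
  have ie : IntervalIntegrable (fun s => u s - um s) volume 0 τ := S.integrable.sub im
  have b1 := G.norm_prim_error_le S hε hl
  have b2 := G.norm_prim_error_le S hε hr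
  have hεQ : 3 * (ε * Q) ≤ η * δ' / 6 := by
    rw [le_div_iff₀ (by positivity)] at hεle
    nlinarith
  have hil := intervalIntegrable_mono_Icc ie hl
  have hir := intervalIntegrable_mono_Icc ie hr
  have hilr : IntervalIntegrable (fun s => u s - um s) volume l r := hil.symm.trans hir
  -- The integral over the window is a difference of two integrals from `0`, each controlled by
  -- `norm_prim_error_le`.
  have hdiff : ‖∫ s in l..r, J (u s - um s)‖ ≤ η * δ' / 3 := by
    rw [J.intervalIntegral_comp_comm hilr, ← intervalIntegral.integral_interval_sub_left hir hil,
      map_sub]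
    refine (norm_sub_le _ _).trans ?_
    change ‖J (prim (fun s => u s - um s) r)‖ + ‖J (prim (fun s => u s - um s) l)‖ ≤ _
    linarith
  have hLip : ∀ s ∈ Icc 0 τ, ‖J (um s) - J (um t)‖ ≤ R * |s - t| := fun s hs => by
    have := (convex_Icc (0 : ℝ) τ).norm_image_sub_le_of_norm_hasDerivWithin_le
      (f := fun s => J (um s)) (f' := fun s => J (um1 s)) (C := R)
      (fun x _ => (J.hasFDerivAt.comp_hasDerivAt x (G.hasDeriv x)).hasDerivWithinAt)
      (fun x hx => G.norm_um1_le hκ hJ hx) ht hs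
    exact this
  -- Replacing the error by its value at `t` costs at most `2 η / 3` pointwise, so `δ'` times the
  -- error at `t` is at most `η δ' / 3 + 2 η δ' / 3`.
  have hosc : ‖∫ s in l..r, (J (u s - um s) - J (u t - um t))‖ ≤ 2 * η / 3 * |r - l| := by
    refine intervalIntegral.norm_integral_le_of_norm_le_const fun s hs => ?_
    rw [uIoc_of_le (by linarith)] at hs
    have hs' : s ∈ Icc 0 τ := ⟨by linarith [hs.1], by linarith [hs.2]⟩
    have habs : |s - t| ≤ δ' := by
      rw [abs_le]; constructor <;> linarith [hs.1, hs.2]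
    have c1 := hcont s hs' (by rw [Real.dist_eq]; linarith)
    rw [dist_eq_norm] at c1
    have c2 := (hLip s hs').trans (mul_le_mul_of_nonneg_left habs hR)
    have e : J (u s - um s) - J (u t - um t) = (J (u s) - J (u t)) - (J (um s) - J (um t)) := by
      simp only [map_sub]; abel
    rw [e]
    refine (norm_sub_le _ _).trans ?_
    linarith
  rw [intervalIntegral.integral_sub (by
      rw [intervalIntegrable_iff] at hilr ⊢; exact J.integrable_comp hilr) (by simp),
    intervalIntegral.integral_const, hlr, add_sub_cancel_left, abs_of_pos hδ'0, ← hlr] at hosc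
  have hfin : ‖δ' • J (u t - um t)‖ ≤ η * δ' := by
    have := norm_sub_le (∫ s in l..r, J (u s - um s))
      ((∫ s in l..r, J (u s - um s)) - δ' • J (u t - um t))
    rw [sub_sub_cancel] at this
    refine this.trans ?_
    linarith
  rw [norm_smul, Real.norm_of_nonneg hδ'0.le, mul_comm] at hfin
  rw [← norm_neg, ← map_neg, neg_sub]
  exact le_of_mul_le_mul_right hfin hδ'0

/-- Regular solutions are bounded in the energy space by their second derivative. -/
theorem IsRegularSolution.norm_D_le [CompleteSpace K] (S : IsRegularSolution J D τ g h u utt)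
    (hτ : 0 < τ) {κ : ℝ} (hκ : 0 ≤ κ) (hJ : ∀ v, ‖J v‖ ≤ κ * ‖D v‖) {t : ℝ} (ht : t ∈ Icc 0 τ) :
    ‖D (u t)‖ ≤ (78 / τ ^ 2 * (κ ^ 2 * τ + τ ^ 3) + τ) * ∫ s in (0 : ℝ)..τ, ‖D (utt s)‖ := by
  set A := ∫ s in (0 : ℝ)..τ, ‖D (utt s)‖
  have i0 := S.integrable_utt
  have i1 := intervalIntegrable_prim hτ.le i0
  have i2 := intervalIntegrable_prim hτ.le i1
  have i3 := intervalIntegrable_prim hτ.le i2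
  have hz : ∀ s ∈ Icc 0 τ, ‖D (prim utt s)‖ ≤ A := fun s hs => norm_map_prim_le D i0 hs
  have hA : 0 ≤ A := (norm_nonneg _).trans (hz t ht)
  have hZ : ∀ s ∈ Icc 0 τ, ‖D (prim (prim utt) s)‖ ≤ A * τ := fun s hs =>
    norm_map_prim_le_of_bound D i1 hs hz
  have hZ1 : ∀ s ∈ Icc 0 τ, ‖D (prim (prim (prim utt)) s)‖ ≤ A * τ * τ := fun s hs =>
    norm_map_prim_le_of_bound D i2 hs hZ
  have hZ2 : ∀ s ∈ Icc 0 τ, ‖D (prim (prim (prim (prim utt))) s)‖ ≤ A * τ * τ * τ := fun s hs =>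
    norm_map_prim_le_of_bound D i3 hs hZ1
  -- The double primitive `w` of `u` solves a stationary problem with right-hand side minus the
  -- double primitive of `utt`. Testing with `w` itself gives an elliptic bound.
  have hW : ∀ s ∈ Icc 0 τ, ‖D (prim (prim u) s)‖ ≤ κ ^ 2 * (A * τ) := fun s hs => by
    set w := prim (prim u) s
    have e : pairing J w (prim (prim utt) s) + pairing D w w = 0 := by
      have iu1 := intervalIntegrable_prim hτ.le S.integrable
      have : pairing J w (prim (prim utt) s) = - pairing D w w := by
        rw [map_prim _ i1 hs]
        change _ = (-pairing D w) (prim (prim u) s)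
        rw [map_prim _ iu1 hs]
        refine prim_congr_Icc (fun r hr => ?_) hs
        have := S.eqn r hr w
        rw [neg_apply, pairing_apply, pairing_apply]
        linarith
      rw [this]; ring
    rw [pairing_apply, pairing_apply, real_inner_self_eq_norm_sq] at e
    have e1 := abs_real_inner_le_norm (J (prim (prim utt) s)) (J w)
    have e2 : ‖J (prim (prim utt) s)‖ ≤ κ * (A * τ) :=
      (hJ _).trans (mul_le_mul_of_nonneg_left (hZ s hs) hκ)
    have e3 : ‖J (prim (prim utt) s)‖ * ‖J w‖ ≤ κ * (A * τ) * (κ * ‖D w‖) :=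
      mul_le_mul e2 (hJ w) (norm_nonneg _) (by positivity)
    have e4 : ‖D w‖ * ‖D w‖ ≤ κ ^ 2 * (A * τ) * ‖D w‖ := by
      have := neg_abs_le (inner ℝ (J (prim (prim utt) s)) (J w))
      nlinarith
    rcases (norm_nonneg (D w)).eq_or_lt with h0 | h0
    · rw [← h0]; positivity
    · exact le_of_mul_le_mul_right e4 h0
  -- Integrating Taylor's formula twice more: the polynomial part, which carries `g` and `h`, is a
  -- difference of two quantities already bounded by `A`.
  have hWeq : ∀ s ∈ Icc 0 τ, prim (prim u) s =
      (s ^ 2 / 2) • g + (s ^ 3 / 6) • h + prim (prim (prim (prim utt))) s := fun s hs => by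
    have q1 : ∀ r ∈ Icc 0 τ, prim u r = r • g + (r ^ 2 / 2) • h + prim (prim (prim utt)) r :=
      fun r hr => by
        rw [prim_congr_Icc S.eq_prim hr, prim, intervalIntegral.integral_add
          (Continuous.intervalIntegrable (by fun_prop) _ _) (intervalIntegrable_mono_Icc i2 hr),
          intervalIntegral.integral_add (by simp) (Continuous.intervalIntegrable (by fun_prop) _ _),
          intervalIntegral.integral_smul_const, integral_id]
        simp [prim]
    rw [prim_congr_Icc q1 hs, prim, intervalIntegral.integral_add
      (Continuous.intervalIntegrable (by fun_prop) _ _) (intervalIntegrable_mono_Icc i3 hs),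
      intervalIntegral.integral_add (Continuous.intervalIntegrable (by fun_prop) _ _)
        (Continuous.intervalIntegrable (by fun_prop) _ _),
      intervalIntegral.integral_smul_const, intervalIntegral.integral_smul_const, integral_id,
      intervalIntegral.integral_div, integral_pow]
    refine congrArg₂ _ (congrArg₂ _ (congrArg (· • g) ?_) (congrArg (· • h) ?_)) rfl
    · ring
    · push_cast; ring
  set M := (κ ^ 2 * τ + τ ^ 3) * A
  have hM : ∀ s ∈ Icc 0 τ, ‖(s ^ 2 / 2) • D g + (s ^ 3 / 6) • D h‖ ≤ M := fun s hs => by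
    have e : (s ^ 2 / 2) • D g + (s ^ 3 / 6) • D h =
        D (prim (prim u) s) - D (prim (prim (prim (prim utt))) s) := by
      rw [hWeq s hs]; simp only [map_add, map_smul]; abel
    rw [e]
    refine (norm_sub_le _ _).trans ((add_le_add (hW s hs) (hZ2 s hs)).trans (le_of_eq ?_))
    simp only [M]; ring
  -- The values of this polynomial at `τ` and `τ / 2` form an invertible linear system for `D g` and
  -- `D h`.
  have m1 := hM τ ⟨hτ.le, le_rfl⟩
  have m2 := hM (τ / 2) ⟨by linarith, by linarith⟩
  set X1 := (τ ^ 2 / 2) • D g + (τ ^ 3 / 6) • D h with hX1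
  set X2 := ((τ / 2) ^ 2 / 2) • D g + ((τ / 2) ^ 3 / 6) • D h with hX2
  have hgeq : D g = (2 / τ ^ 2) • ((8 : ℝ) • X2 - X1) := by
    rw [hX1, hX2]
    match_scalars <;> field_simp <;> ring
  have hheq : D h = (12 / τ ^ 3) • (X1 - (4 : ℝ) • X2) := by
    rw [hX1, hX2]
    match_scalars <;> field_simp <;> ring
  have hM0 : 0 ≤ M := (norm_nonneg _).trans m1
  have hg : ‖D g‖ ≤ 2 / τ ^ 2 * (9 * M) := by
    rw [hgeq, norm_smul, Real.norm_of_nonneg (by positivity)]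
    gcongr
    refine (norm_sub_le _ _).trans ?_
    rw [norm_smul, Real.norm_of_nonneg (by norm_num)]
    linarith
  have hh : ‖D h‖ ≤ 12 / τ ^ 3 * (5 * M) := by
    rw [hheq, norm_smul, Real.norm_of_nonneg (by positivity)]
    gcongr
    refine (norm_sub_le _ _).trans ?_
    rw [norm_smul, Real.norm_of_nonneg (by norm_num)]
    linarith
  have hth : t * ‖D h‖ ≤ 60 / τ ^ 2 * M := by
    refine (mul_le_mul ht.2 hh (norm_nonneg _) hτ.le).trans (le_of_eq ?_)
    field_simp; ring
  rw [S.eq_prim t ht, map_add, map_add, map_smul]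
  refine (norm_add₃_le).trans ?_
  rw [norm_smul, Real.norm_of_nonneg ht.1]
  have hZt := hZ t ht
  -- The constant `78` is `2 · 9` from `g` plus `60` from `h`.
  calc ‖D g‖ + t * ‖D h‖ + ‖D (prim (prim utt) t)‖
      ≤ 2 / τ ^ 2 * (9 * M) + 60 / τ ^ 2 * M + A * τ := by gcongr
    _ = _ := by simp only [M]; ring

/-- Cauchy–Schwarz in time, read off from the nonnegativity of the variance of `‖f‖` on `(0, τ)`;
the source of the factor `√T`. -/
theorem integral_norm_le_sqrt {W : Type*} [NormedAddCommGroup W] {f : ℝ → W} (hτ : 0 < τ)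
    (hf : MemLp f 2 (volume.restrict (Ioo 0 τ))) :
    ∫ s in (0 : ℝ)..τ, ‖f s‖ ≤ √τ * √(∫ s in Ioo 0 τ, ‖f s‖ ^ 2) := by
  rw [intervalIntegral.integral_of_le hτ.le, integral_Ioc_eq_integral_Ioo,
    ← Real.sqrt_mul hτ.le]
  refine Real.le_sqrt_of_sq_le ?_
  have i1 : IntegrableOn (fun s => ‖f s‖) (Ioo 0 τ) := (hf.integrable (by norm_num)).norm
  have i2 : IntegrableOn (fun s => ‖f s‖ ^ 2) (Ioo 0 τ) := hf.integrable_norm_pow (by norm_num)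
  set I := ∫ s in Ioo 0 τ, ‖f s‖
  have h0 : 0 ≤ ∫ s in Ioo 0 τ, (‖f s‖ ^ 2 - 2 * (I / τ) * ‖f s‖ + (I / τ) ^ 2) :=
    integral_nonneg fun s => by
      have := sq_nonneg (‖f s‖ - I / τ)
      simp only [Pi.zero_apply]; nlinarith
  have i3 : IntegrableOn (fun s => 2 * (I / τ) * ‖f s‖) (Ioo 0 τ) := i1.const_mul _
  have i4 : IntegrableOn (fun s => ‖f s‖ ^ 2 - 2 * (I / τ) * ‖f s‖) (Ioo 0 τ) := i2.sub i3
  rw [integral_add i4 (integrableOn_const (by simp)), integral_sub i2 i3, integral_const_mul,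
    setIntegral_const, Real.volume_real_Ioo_of_le hτ.le, sub_zero, smul_eq_mul] at h0
  have e : 2 * (I / τ) * I = 2 * I ^ 2 / τ := by ring
  have e2 : τ * (I / τ) ^ 2 = I ^ 2 / τ := by field_simp
  change 0 ≤ (∫ s in Ioo 0 τ, ‖f s‖ ^ 2) - 2 * (I / τ) * I + τ * (I / τ) ^ 2 at h0
  rw [e, e2] at h0
  have : I ^ 2 / τ ≤ ∫ s in Ioo 0 τ, ‖f s‖ ^ 2 := by
    have : 2 * I ^ 2 / τ = I ^ 2 / τ + I ^ 2 / τ := by ring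
    linarith
  rwa [div_le_iff₀' hτ] at this

end EvolutionEstimates

/-! ### Tilings of an interval by finitely many intervals -/

section Tiling

variable {ι : Type*} [Fintype ι] {l r : ι → ℝ} {a b : ℝ}

/-- The covering makes the difference of the two sides nonnegative, and the bound on the total
length makes its integral nonpositive, so it vanishes almost everywhere. Every nonempty open set
therefore contains a point covered with the right multiplicity, which excludes overlaps and
overshoots with interior. -/
theorem tiling_exists_mem (hab : a < b) (hlr : ∀ i, l i < r i)
    (hcov : Icc a b ⊆ ⋃ i, Icc (l i) (r i)) (hsum : ∑ i, (r i - l i) ≤ b - a) {O : Set ℝ}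
    (hO : IsOpen O) (hne : O.Nonempty) : ∃ x ∈ O,
      ∑ i, (Icc (l i) (r i)).indicator (1 : ℝ → ℝ) x = (Icc a b).indicator (1 : ℝ → ℝ) x := by
  let S : ℝ → ℝ := fun x =>
    ∑ i, (Icc (l i) (r i)).indicator (1 : ℝ → ℝ) x - (Icc a b).indicator (1 : ℝ → ℝ) x
  have hind : ∀ (s : Set ℝ) (x : ℝ), 0 ≤ s.indicator (1 : ℝ → ℝ) x := fun s x =>
    indicator_nonneg (fun _ _ => zero_le_one) x
  have hS0 : 0 ≤ S := fun x => by
    simp only [S, Pi.zero_apply, sub_nonneg]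
    by_cases hx : x ∈ Icc a b
    · obtain ⟨i, hi⟩ := mem_iUnion.mp (hcov hx)
      rw [indicator_of_mem hx]
      refine le_trans ?_ (Finset.single_le_sum (fun i _ => hind _ x) (Finset.mem_univ i))
      rw [indicator_of_mem hi]
    · rw [indicator_of_notMem hx]
      exact Finset.sum_nonneg fun i _ => hind _ x
  have hi : ∀ u v : ℝ, Integrable ((Icc u v).indicator (1 : ℝ → ℝ)) := fun u v =>
    (integrable_indicator_iff measurableSet_Icc).mpr (integrableOn_const (by simp))
  have hint : ∀ u v : ℝ, u ≤ v → ∫ x, (Icc u v).indicator (1 : ℝ → ℝ) x = v - u := fun u v h => by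
    rw [integral_indicator_one measurableSet_Icc, Real.volume_real_Icc_of_le h]
  have hSi : Integrable S := (integrable_finsetSum _ fun i _ => hi _ _).sub (hi _ _)
  have hS : ∫ x, S x = 0 := by
    refine le_antisymm ?_ (integral_nonneg hS0)
    simp only [S]
    rw [integral_sub (integrable_finsetSum _ fun i _ => hi _ _) (hi _ _),
      integral_finsetSum _ fun i _ => hi _ _, hint a b hab.le,
      Finset.sum_congr rfl fun i _ => hint _ _ (hlr i).le]
    linarith
  have hae := (integral_eq_zero_iff_of_nonneg hS0 hSi).mp hS
  have : ∃ x ∈ O, S x = 0 := by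
    by_contra! hcon
    exact (hO.measure_pos volume hne).ne' (measure_mono_null (fun x hx => hcon x hx) hae)
  obtain ⟨x, hx, hx0⟩ := this
  exact ⟨x, hx, sub_eq_zero.mp hx0⟩

theorem tiling_subset (hab : a < b) (hlr : ∀ i, l i < r i)
    (hcov : Icc a b ⊆ ⋃ i, Icc (l i) (r i)) (hsum : ∑ i, (r i - l i) ≤ b - a) (i : ι) :
    a ≤ l i ∧ r i ≤ b := by
  have hsub : Ioo (l i) (r i) ⊆ Icc a b := by
    by_contra h
    obtain ⟨y, hy, hy'⟩ := not_subset.mp h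
    obtain ⟨x, ⟨hx, hx'⟩, he⟩ := tiling_exists_mem hab hlr hcov hsum
      (isOpen_Ioo.inter isClosed_Icc.isOpen_compl) ⟨y, hy, hy'⟩
    rw [indicator_of_notMem hx'] at he
    have := Finset.single_le_sum (f := fun i => (Icc (l i) (r i)).indicator (1 : ℝ → ℝ) x)
      (fun i _ => indicator_nonneg (fun _ _ => zero_le_one) x) (Finset.mem_univ i)
    simp only [indicator_of_mem (Ioo_subset_Icc_self hx), Pi.one_apply] at this
    linarith
  have := closure_mono hsub
  rw [closure_Ioo (hlr i).ne, isClosed_Icc.closure_eq] at this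
  exact ⟨(this (left_mem_Icc.mpr (hlr i).le)).1, (this (right_mem_Icc.mpr (hlr i).le)).2⟩

theorem tiling_disjoint (hab : a < b) (hlr : ∀ i, l i < r i)
    (hcov : Icc a b ⊆ ⋃ i, Icc (l i) (r i)) (hsum : ∑ i, (r i - l i) ≤ b - a) {i j : ι}
    (hij : i ≠ j) : r i ≤ l j ∨ r j ≤ l i := by
  classical
  by_contra! h
  have hne : (Ioo (l i) (r i) ∩ Ioo (l j) (r j)).Nonempty := by
    rw [Ioo_inter_Ioo, nonempty_Ioo, sup_lt_iff, lt_inf_iff, lt_inf_iff]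
    exact ⟨⟨hlr i, h.2⟩, h.1, hlr j⟩
  obtain ⟨x, ⟨hx, hx'⟩, he⟩ := tiling_exists_mem hab hlr hcov hsum
    (isOpen_Ioo.inter isOpen_Ioo) hne
  have h1 : (Icc a b).indicator (1 : ℝ → ℝ) x ≤ 1 :=
    indicator_le_self' (fun _ _ => zero_le_one) x
  have h2 := Finset.sum_le_sum_of_subset_of_nonneg (Finset.subset_univ {i, j})
    (f := fun i => (Icc (l i) (r i)).indicator (1 : ℝ → ℝ) x)
    (fun i _ _ => indicator_nonneg (fun _ _ => zero_le_one) x)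
  rw [Finset.sum_pair hij] at h2
  simp only [indicator_of_mem (Ioo_subset_Icc_self hx),
    indicator_of_mem (Ioo_subset_Icc_self hx'), Pi.one_apply] at h2
  linarith

theorem tiling_right_end (hab : a < b) (hlr : ∀ i, l i < r i)
    (hcov : Icc a b ⊆ ⋃ i, Icc (l i) (r i)) (hsum : ∑ i, (r i - l i) ≤ b - a) (i : ι) :
    r i = b ∨ ∃ j, l j = r i := by
  obtain ⟨h1, h2⟩ := tiling_subset hab hlr hcov hsum i
  rcases h2.eq_or_lt with h2 | h2
  · exact Or.inl h2
  right
  -- A point `x` to the right of `r i` but left of every `l j > r i` is covered by some interval,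
  -- which can only start at `r i`, as it may not overlap the `i`-th one.
  have hev : ∀ᶠ x in nhdsWithin (r i) (Ioi (r i)),
      (∀ j, r i < l j → x < l j) ∧ x < b ∧ r i < x := by
    refine Filter.Eventually.and (Filter.eventually_all.mpr fun j => ?_)
      (Filter.Eventually.and ?_ self_mem_nhdsWithin)
    · by_cases hj : r i < l j
      · filter_upwards [nhdsWithin_le_nhds (Iio_mem_nhds hj)] with x hx _ using hx
      · exact Filter.Eventually.of_forall fun x h => absurd h hj
    · exact nhdsWithin_le_nhds (Iio_mem_nhds h2)
  obtain ⟨x, hx1, hx2, hx3⟩ := hev.exists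
  obtain ⟨j, hj⟩ := mem_iUnion.mp (hcov (show x ∈ Icc a b from
    ⟨by linarith [hlr i], hx2.le⟩))
  have hlj : l j ≤ r i := not_lt.mp fun h => absurd hj.1 (not_le.mpr (hx1 j h))
  refine ⟨j, hlj.antisymm (not_lt.mp fun h => ?_)⟩
  have hij : i ≠ j := by rintro rfl; linarith [hj.2]
  rcases tiling_disjoint hab hlr hcov hsum hij with h' | h'
  · linarith
  · linarith [hj.2, hlr i]

/-- The end-points of the intervals of a tiling, in increasing order, start at `a`, end at `b`, and
consecutive end-points are the two ends of one of the intervals. -/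
theorem tiling_nodes [DecidableEq ι] (hab : a < b) (hlr : ∀ i, l i < r i)
    (hcov : Icc a b ⊆ ⋃ i, Icc (l i) (r i)) (hsum : ∑ i, (r i - l i) ≤ b - a) {V : Finset ℝ}
    (hV : V = Finset.univ.biUnion fun i => {l i, r i}) {δ : ℝ} (hδ : ∀ i, r i - l i ≤ δ)
    {x : ℕ → ℝ} (hx : ∀ k, x k = (V.sort (· ≤ ·)).getD k b) :
    x 0 = a ∧ x (Fintype.card ι) = b ∧
      ∀ k < Fintype.card ι, x k < x (k + 1) ∧ x (k + 1) - x k ≤ δ := by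
  have hsub := tiling_subset hab hlr hcov hsum
  have hmem : ∀ y, y ∈ V ↔ ∃ i, y = l i ∨ y = r i := fun y => by simp [hV]
  obtain ⟨ib, hib⟩ := mem_iUnion.mp (hcov (right_mem_Icc.mpr hab.le))
  have hrb : r ib = b := le_antisymm (hsub ib).2 hib.2
  obtain ⟨ia, hia⟩ := mem_iUnion.mp (hcov (left_mem_Icc.mpr hab.le))
  have hla : l ia = a := le_antisymm hia.1 (hsub ia).1
  -- Every right end other than `b` is also a left end. As the left ends are distinct, there are
  -- exactly one more nodes than intervals.
  have hVeq : V = insert b (Finset.univ.image l) := by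
    ext y
    simp only [hmem, Finset.mem_insert, Finset.mem_image, Finset.mem_univ, true_and]
    constructor
    · rintro ⟨i, rfl | rfl⟩
      · exact Or.inr ⟨i, rfl⟩
      · exact tiling_right_end hab hlr hcov hsum i
    · rintro (rfl | ⟨i, rfl⟩)
      · exact ⟨ib, Or.inr hrb.symm⟩
      · exact ⟨i, Or.inl rfl⟩
  have hinj : Function.Injective l := fun i j hij => by
    by_contra hne
    rcases tiling_disjoint hab hlr hcov hsum hne with h | h
    · linarith [hlr i]
    · linarith [hlr j]
  have hcard : V.card = Fintype.card ι + 1 := by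
    rw [hVeq, Finset.card_insert_of_notMem, Finset.card_image_of_injective _ hinj, Finset.card_univ]
    simp only [Finset.mem_image, Finset.mem_univ, true_and, not_exists]
    intro i hi
    linarith [hlr i, (hsub i).2]
  have hVab : ∀ y ∈ V, y ∈ Icc a b := fun y hy => by
    obtain ⟨i, rfl | rfl⟩ := (hmem y).mp hy
    · exact ⟨(hsub i).1, (hlr i).le.trans (hsub i).2⟩
    · exact ⟨(hsub i).1.trans (hlr i).le, (hsub i).2⟩
  set n := Fintype.card ι
  let e := V.orderEmbOfFin hcard
  have hxe : ∀ k (hk : k < n + 1), x k = e ⟨k, hk⟩ := fun k hk => by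
    rw [hx, Finset.orderEmbOfFin_apply, List.getD_eq_getElem]
    rfl
  have hsurj : ∀ y ∈ V, ∃ k, k < n + 1 ∧ x k = y := fun y hy => by
    have : y ∈ Set.range e := by rw [Finset.range_orderEmbOfFin]; exact hy
    obtain ⟨k, hk⟩ := this
    exact ⟨k, k.2, by rw [hxe k k.2]; exact hk⟩
  have hxV : ∀ k < n + 1, x k ∈ V := fun k hk => by
    rw [hxe k hk]; exact Finset.orderEmbOfFin_mem V hcard _
  have hmono : ∀ i j, i < j → j < n + 1 → x i < x j := fun i j hij hj => by
    rw [hxe i (hij.trans hj), hxe j hj]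
    exact e.strictMono hij
  have hxb : x n = b := by
    obtain ⟨k, hk, hkb⟩ := hsurj b ((hmem b).mpr ⟨ib, Or.inr hrb.symm⟩)
    refine le_antisymm (hVab _ (hxV n (by omega))).2 ?_
    rcases (Nat.lt_succ_iff.mp hk).eq_or_lt with h | h
    · rw [← hkb, h]
    · rw [← hkb]; exact (hmono k n h (by omega)).le
  refine ⟨?_, hxb, fun k hk => ⟨hmono k (k + 1) (by omega) (by omega), ?_⟩⟩
  · obtain ⟨k, hk, hka⟩ := hsurj a ((hmem a).mpr ⟨ia, Or.inl hla.symm⟩)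
    refine le_antisymm ?_ (hVab _ (hxV 0 (by omega))).1
    rcases Nat.eq_zero_or_pos k with h | h
    · rw [← hka, h]
    · rw [← hka]; exact (hmono 0 k h hk).le
  -- The node `x k` is the left end of some interval `i`; its right end is a later node, so the next
  -- node comes no later than `r i`.
  · have h1 := hxV k (by omega)
    have h2 : x k ≠ b := by rw [← hxb]; exact (hmono k n hk (by omega)).ne
    rw [hVeq, Finset.mem_insert] at h1
    obtain ⟨i, -, hi⟩ := Finset.mem_image.mp (h1.resolve_left h2)
    obtain ⟨k', hk', hki⟩ := hsurj (r i) ((hmem _).mpr ⟨i, Or.inr rfl⟩)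
    have hlt : x k < x k' := by rw [hki, ← hi]; exact hlr i
    have hkk : k < k' := by
      by_contra h
      rcases (not_lt.mp h).eq_or_lt with h | h
      · rw [h] at hlt; exact lt_irrefl _ hlt
      · exact lt_asymm hlt (hmono k' k h (by omega))
    have : x (k + 1) ≤ x k' := by
      rcases (Nat.succ_le_of_lt hkk).eq_or_lt with h | h
      · rw [← h]
      · exact (hmono _ _ h hk').le
    rw [hki] at this
    linarith [hδ i]

end Tiling

/-! ### The level intervals of the auxiliary iterated function system -/

namespace AuxIFS

variable {N : ℕ} (A : AuxIFS N)

theorem ratio_pos (j : Fin N) : 0 < A.r ^ A.n j := pow_pos A.r_pos _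

theorem ratio_le_rho (j : Fin N) : A.r ^ A.n j ≤ A.rho :=
  le_ciSup (f := fun j => A.r ^ A.n j) (Set.finite_range _).bddAbove j

theorem rho_nonneg : 0 ≤ A.rho := Real.iSup_nonneg fun j => (A.ratio_pos j).le

theorem rho_lt_one : A.rho < 1 := by
  rcases isEmpty_or_nonempty (Fin N) with h | h
  · rw [rho, Real.iSup_of_isEmpty]; exact zero_lt_one
  · obtain ⟨j, hj⟩ := exists_eq_ciSup_of_finite (f := fun j => A.r ^ A.n j)
    rw [rho, ← hj]
    exact pow_lt_one₀ A.r_pos.le A.r_lt_one (Nat.one_le_iff_ne_zero.mp (A.n_pos j))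

open scoped Pointwise in
/-- The open set condition bounds the sum of the contraction ratios. -/
theorem sum_ratio_le_one (hosc : A.OpenSetCondition) : ∑ j, A.r ^ A.n j ≤ 1 := by
  obtain ⟨U, hU, hne, hb, hsub, hdisj⟩ := hosc
  have hpos : 0 < volume U := hU.measure_pos volume hne
  have hfin : volume U ≠ ⊤ := hb.measure_lt_top.ne
  have himg : ∀ j, A.T j '' U = (fun x => x + A.d j) '' ((fun x => A.r ^ A.n j * x) '' U) :=
    fun j => by rw [image_image]; rfl
  have hopen : ∀ j, IsOpen (A.T j '' U) := fun j => by
    rw [himg]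
    exact (Homeomorph.addRight (A.d j)).isOpenMap _
      ((Homeomorph.mulLeft₀ _ (A.ratio_pos j).ne').isOpenMap _ hU)
  have hvol : ∀ j, volume (A.T j '' U) = ENNReal.ofReal (A.r ^ A.n j) * volume U := fun j => by
    rw [himg, image_add_right, measure_preimage_add_right]
    have : (fun x => A.r ^ A.n j * x) '' U = (A.r ^ A.n j) • U := rfl
    rw [this, Measure.addHaar_smul]
    simp [abs_of_pos A.r_pos]
  -- The disjoint images lie in `U` and have the volume of `U` scaled by the ratios; `U` has
  -- positive finite volume, so that it can be cancelled.
  have h1 : ∑ j, volume (A.T j '' U) ≤ volume U := by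
    rw [← measure_biUnion_finset (fun i _ j _ hij => hdisj i j hij)
      fun j _ => (hopen j).measurableSet]
    exact measure_mono (iUnion₂_subset fun j _ => hsub j)
  simp_rw [hvol] at h1
  rw [← Finset.sum_mul, ← ENNReal.ofReal_sum_of_nonneg fun j _ => (A.ratio_pos j).le] at h1
  have h2 : ENNReal.ofReal (∑ j, A.r ^ A.n j) ≤ 1 := by
    by_contra hcon
    have := ENNReal.mul_lt_mul_left hpos.ne' hfin (not_le.mp hcon)
    rw [one_mul] at this
    exact absurd h1 (not_le.mpr this)
  rwa [ENNReal.ofReal_le_one] at h2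

theorem comp_zero (J : Fin 0 → Fin N) (x : ℝ) : A.comp J x = x := by simp [comp]

theorem comp_succ {m : ℕ} (J : Fin (m + 1) → Fin N) (x : ℝ) :
    A.comp J x = A.T (J 0) (A.comp (fun i => J i.succ) x) := by
  simp [comp, List.ofFn_succ]

theorem comp_sub : ∀ {m : ℕ} (J : Fin m → Fin N) (x y : ℝ),
    A.comp J y - A.comp J x = (∏ i, A.r ^ A.n (J i)) * (y - x)
  | 0, J, x, y => by simp [comp_zero]
  | m + 1, J, x, y => by
    rw [comp_succ, comp_succ, Fin.prod_univ_succ, mul_assoc, ← comp_sub]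
    simp only [T]; ring

theorem comp_cover {a b : ℝ} (hcov : ∀ x ∈ Icc a b, ∃ j, ∃ y ∈ Icc a b, A.T j y = x) :
    ∀ (m : ℕ), ∀ x ∈ Icc a b, ∃ J : Fin m → Fin N, x ∈ Icc (A.comp J a) (A.comp J b)
  | 0, x, hx => ⟨Fin.elim0, by simpa [comp_zero] using hx⟩
  | m + 1, x, hx => by
    obtain ⟨j, y, hy, rfl⟩ := hcov x hx
    obtain ⟨J, hJ⟩ := comp_cover hcov m y hy
    have hT : Monotone (A.T j) := fun u v huv =>
      add_le_add_left (mul_le_mul_of_nonneg_left huv (A.ratio_pos j).le) _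
    refine ⟨Fin.cons j J, ?_⟩
    simp only [comp_succ, Fin.cons_zero, Fin.cons_succ]
    exact ⟨hT hJ.1, hT hJ.2⟩

theorem rho_pow_ge {m : ℕ} (J : Fin m → Fin N) : ∏ i, A.r ^ A.n (J i) ≤ A.rho ^ m := by
  calc ∏ i, A.r ^ A.n (J i) ≤ ∏ _i : Fin m, A.rho :=
        Finset.prod_le_prod (fun i _ => (A.ratio_pos _).le) fun i _ => A.ratio_le_rho _
    _ = A.rho ^ m := by simp

/-- The nodes of level `m` form a partition of `[a, b]` into `N ^ m` intervals of length at most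
`ρ ^ m (b - a)`. -/
theorem node_spec {a b : ℝ} (hab : a < b) (hosc : A.OpenSetCondition)
    (hcov : ∀ x ∈ Icc a b, ∃ j, ∃ y ∈ Icc a b, A.T j y = x) (m : ℕ) :
    A.node a b m 0 = a ∧ A.node a b m (N ^ m) = b ∧ ∀ k < N ^ m,
      A.node a b m k < A.node a b m (k + 1) ∧
      A.node a b m (k + 1) - A.node a b m k ≤ A.rho ^ m * (b - a) := by
  have hpos : ∀ J : Fin m → Fin N, 0 < ∏ i, A.r ^ A.n (J i) := fun J =>
    Finset.prod_pos fun i _ => A.ratio_pos _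
  have key := tiling_nodes (ι := Fin m → Fin N) (l := fun J => A.comp J a)
    (r := fun J => A.comp J b) (V := A.vertices a b m) (δ := A.rho ^ m * (b - a))
    (x := A.node a b m) hab
    (fun J => by
      have := A.comp_sub J a b
      have := mul_pos (hpos J) (sub_pos.mpr hab)
      linarith)
    (fun x hx => mem_iUnion.mpr (A.comp_cover hcov m x hx))
    (by
      -- The lengths of level `m` add up to `(∑ j, r ^ n j) ^ m (b - a)`.
      simp_rw [comp_sub]
      rw [← Finset.sum_mul, ← Fintype.sum_pow fun j => A.r ^ A.n j]
      refine mul_le_of_le_one_left (sub_pos.mpr hab).le (pow_le_one₀ ?_ (A.sum_ratio_le_one hosc))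
      exact Finset.sum_nonneg fun j _ => (A.ratio_pos j).le)
    rfl
    (fun J => by
      rw [comp_sub]
      exact mul_le_mul_of_nonneg_right (A.rho_pow_ge J) (sub_pos.mpr hab).le)
    (fun k => rfl)
  simpa using key

end AuxIFS

/-! ### Tent functions -/

section Tent

variable {a b l c r : ℝ}

/-- The tent function with nodes `l < c < r`. -/
def tentFun (l c r x : ℝ) : ℝ :=
  if l ≤ x ∧ x ≤ c then (x - l) / (c - l)
  else if c ≤ x ∧ x ≤ r then (x - r) / (c - r)
  else 0

/-- The form in which the tent appears when its step-function derivative is integrated from the left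
end of the interval. -/
theorem tentFun_eq (hlc : l < c) (hcr : c < r) (x : ℝ) :
    tentFun l c r x = max (min x c - l) 0 * (1 / (c - l)) - max (min x r - c) 0 * (1 / (r - c)) := by
  have h1 : c - l ≠ 0 := by linarith
  have h2 : r - c ≠ 0 := by linarith
  have h3 : c - r ≠ 0 := by linarith
  unfold tentFun
  rcases lt_or_ge x l with h | h
  · rw [if_neg (by intro h'; linarith [h'.1]), if_neg (by intro h'; linarith [h'.1]),
      min_eq_left (by linarith), min_eq_left (by linarith), max_eq_right (by linarith),
      max_eq_right (by linarith)]
    simp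
  rcases le_or_gt x c with h' | h'
  · rw [if_pos ⟨h, h'⟩, min_eq_left h', min_eq_left (by linarith), max_eq_left (by linarith),
      max_eq_right (by linarith)]
    ring
  rw [if_neg (by intro h''; linarith [h''.2]), min_eq_right h'.le, max_eq_left (by linarith)]
  rcases le_or_gt x r with h'' | h''
  · rw [if_pos ⟨h'.le, h''⟩, min_eq_left h'', max_eq_left (by linarith)]
    field_simp; ring
  · rw [if_neg (by intro h3; linarith [h3.2]), min_eq_right h''.le, max_eq_left (by linarith)]
    field_simp; ring

theorem tentFun_center (hlc : l < c) : tentFun l c r c = 1 := by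
  rw [tentFun, if_pos ⟨hlc.le, le_rfl⟩, div_self (by linarith)]

theorem tentFun_of_le (hlc : l < c) (hcr : c < r) {x : ℝ} (hx : x ≤ l) : tentFun l c r x = 0 := by
  rw [tentFun_eq hlc hcr, min_eq_left (by linarith), min_eq_left (by linarith),
    max_eq_right (by linarith), max_eq_right (by linarith)]
  simp

theorem tentFun_of_ge (hlc : l < c) (hcr : c < r) {x : ℝ} (hx : r ≤ x) : tentFun l c r x = 0 := by
  have h1 : c - l ≠ 0 := by linarith
  have h2 : r - c ≠ 0 := by linarith
  rw [tentFun_eq hlc hcr, min_eq_right (by linarith), min_eq_right (by linarith),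
    max_eq_left (by linarith), max_eq_left (by linarith)]
  field_simp; ring

theorem measureReal_restrict_Ioo {s t : ℝ} (hs : a ≤ s) (ht : t ≤ b) :
    (volume.restrict (Ioo a b)).real (Ioc s t) = max (t - s) 0 := by
  rw [restrict_Ioo_eq_restrict_Ioc, measureReal_restrict_apply measurableSet_Ioc,
    inter_eq_self_of_subset_left (Ioc_subset_Ioc hs ht), measureReal_def, Real.volume_Ioc,
    ENNReal.toReal_ofReal']

/-- The weak derivative of the tent function. -/
def tentGrad (a b l c r : ℝ) : L2 a b :=
  indicatorConstLp 2 measurableSet_Ioc (measure_ne_top _ (Ioc l c)) (1 / (c - l)) -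
    indicatorConstLp 2 measurableSet_Ioc (measure_ne_top _ (Ioc c r)) (1 / (r - c))

/-- Links the pointwise derivatives in the stiffness matrix with the weak derivative; off the three
nodes the tent is locally affine. -/
theorem tentGrad_ae (hlc : l < c) (hcr : c < r) :
    tentGrad a b l c r =ᵐ[volume.restrict (Ioo a b)] deriv (tentFun l c r) := by
  have hne : ∀ y : ℝ, ∀ᵐ x ∂(volume.restrict (Ioo a b)), x ≠ y := fun y =>
    ae_restrict_of_ae (by simp [ae_iff, measure_singleton])
  have e1 := indicatorConstLp_coeFn (p := 2) (hs := measurableSet_Ioc)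
    (hμs := measure_ne_top (volume.restrict (Ioo a b)) (Ioc l c)) (c := 1 / (c - l))
  have e2 := indicatorConstLp_coeFn (p := 2) (hs := measurableSet_Ioc)
    (hμs := measure_ne_top (volume.restrict (Ioo a b)) (Ioc c r)) (c := 1 / (r - c))
  filter_upwards [hne l, hne c, hne r, e1, e2, Lp.coeFn_sub
    (indicatorConstLp 2 measurableSet_Ioc (measure_ne_top (volume.restrict (Ioo a b)) (Ioc l c))
      (1 / (c - l)))
    (indicatorConstLp 2 measurableSet_Ioc (measure_ne_top (volume.restrict (Ioo a b)) (Ioc c r))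
      (1 / (r - c)))] with x n1 n2 n3 h1 h2 h3
  rw [tentGrad, h3, Pi.sub_apply, h1, h2]
  symm
  rcases n1.lt_or_gt with q1 | q1
  · rw [indicator_of_notMem (by intro h; linarith [h.1]),
      indicator_of_notMem (by intro h; linarith [h.1]), sub_zero]
    refine ((hasDerivAt_const x (0 : ℝ)).congr_of_eventuallyEq ?_).deriv
    filter_upwards [Iio_mem_nhds q1] with y hy using tentFun_of_le hlc hcr (le_of_lt hy)
  rcases n2.lt_or_gt with q2 | q2
  · rw [indicator_of_mem (show x ∈ Ioc l c from ⟨q1, q2.le⟩), indicator_of_notMem (by intro h; linarith [h.1]), sub_zero]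
    refine ((((hasDerivAt_id x).sub_const l).div_const (c - l)).congr_of_eventuallyEq ?_).deriv
    filter_upwards [Ioo_mem_nhds q1 q2] with y hy
    rw [tentFun, if_pos ⟨hy.1.le, hy.2.le⟩]; rfl
  rcases n3.lt_or_gt with q3 | q3
  · rw [indicator_of_notMem (by intro h; linarith [h.2]), indicator_of_mem (show x ∈ Ioc c r from ⟨q2, q3.le⟩)]
    have := (((hasDerivAt_id x).sub_const r).div_const (c - r)).congr_of_eventuallyEq
      (f₁ := tentFun l c r) (by
        filter_upwards [Ioo_mem_nhds q2 q3] with y hy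
        rw [tentFun, if_neg (by intro h; linarith [h.2, hy.1]), if_pos ⟨hy.1.le, hy.2.le⟩]; rfl)
    rw [this.deriv, zero_sub, ← neg_sub r c, div_neg]
  · rw [indicator_of_notMem (by intro h; linarith [h.2]),
      indicator_of_notMem (by intro h; linarith [h.2]), sub_zero]
    refine ((hasDerivAt_const x (0 : ℝ)).congr_of_eventuallyEq ?_).deriv
    filter_upwards [Ioi_mem_nhds q3] with y hy using tentFun_of_ge hlc hcr (le_of_lt hy)

/-- Tent functions belong to `H₀¹(a, b)`. -/
theorem exists_tent (hal : a ≤ l) (hlc : l < c) (hcr : c < r) (hrb : r ≤ b) :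
    ∃ φ : H01 a b, wderiv φ = tentGrad a b l c r ∧
      ∀ x ∈ Icc a b, contRep φ x = tentFun l c r x := by
  have h1 : c - l ≠ 0 := by linarith
  have h2 : r - c ≠ 0 := by linarith
  -- The step function has mean zero because the tent rises by one and falls by one.
  obtain ⟨φ, hφ⟩ := exists_H01_of_wderiv (by linarith) (tentGrad a b l c r) (by
    rw [tentGrad, integral_congr_ae (Lp.coeFn_sub _ _)]
    simp only [Pi.sub_apply]
    rw [integral_sub ((Lp.memLp _).integrable (by norm_num)) ((Lp.memLp _).integrable (by norm_num)),
      integral_indicatorConstLp, integral_indicatorConstLp,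
      measureReal_restrict_Ioo hal (by linarith), measureReal_restrict_Ioo (by linarith) hrb,
      max_eq_left (by linarith), max_eq_left (by linarith), smul_eq_mul, smul_eq_mul]
    field_simp; ring)
  refine ⟨φ, hφ, fun x hx => ?_⟩
  have h := inner_indicator_wderiv φ hx.1 1
  rw [contRep_left, sub_zero, one_mul, hφ, tentGrad, inner_sub_right,
    L2.inner_indicatorConstLp_indicatorConstLp, L2.inner_indicatorConstLp_indicatorConstLp,
    Ioc_inter_Ioc, Ioc_inter_Ioc, max_eq_right hal, max_eq_right (by linarith : a ≤ c),
    measureReal_restrict_Ioo hal ((min_le_right _ _).trans (by linarith)),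
    measureReal_restrict_Ioo (by linarith) ((min_le_right _ _).trans hrb)] at h
  rw [tentFun_eq hlc hcr, ← h]
  simp [mul_comm]

/-- The energy pairing with a tent sees only three nodal values; this makes interpolation the Ritz
projection. -/
theorem inner_tentGrad (u : H01 a b) (hlc : l < c) (hcr : c < r) :
    inner ℝ (tentGrad a b l c r) (wderiv u) =
      1 / (c - l) * (contRep u c - contRep u l) - 1 / (r - c) * (contRep u r - contRep u c) := by
  rw [tentGrad, inner_sub_left, inner_indicator_wderiv u hlc.le, inner_indicator_wderiv u hcr.le]

end Tent

/-! ### The energy space as a normed space -/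

/-- The Hilbert space `Dom ℰ`, as a type. -/
def Dom (μ : Measure ℝ) [IsFiniteMeasure μ] (a b : ℝ) : Type := DomE μ a b

section DomType

variable (μ : Measure ℝ) [IsFiniteMeasure μ] (a b : ℝ)

instance : NormedAddCommGroup (Dom μ a b) := inferInstanceAs (NormedAddCommGroup (DomE μ a b))

instance : NormedSpace ℝ (Dom μ a b) := Submodule.normedSpace (DomE μ a b)

instance : CompleteSpace (Dom μ a b) := inferInstanceAs (CompleteSpace (DomE μ a b))

/-- The embedding `Dom ℰ → L²_μ`. -/
def embL : Dom μ a b →L[ℝ] Lp ℝ 2 μ := toL2mu (a := a) (b := b) μ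

/-- The weak derivative `Dom ℰ → L²(a, b)`. -/
def derivL : Dom μ a b →L[ℝ] L2 a b := gradL μ a b

/-- The evaluation at a point. -/
def evalL (x : ℝ) : Dom μ a b →L[ℝ] ℝ :=
  (innerSL ℝ (indicatorConstLp 2 measurableSet_Ioc
    (measure_ne_top (volume.restrict (Ioo a b)) (Ioc a x)) (1 : ℝ))).comp (derivL μ a b)

variable {μ a b}

/-- The continuous representative of an element of `Dom ℰ`. -/
def rep (u : Dom μ a b) : ℝ → ℝ := toFun (u : DomE μ a b)

theorem derivL_apply (u : Dom μ a b) : derivL μ a b u = wderiv (u : DomE μ a b).1 := rfl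

theorem rep_apply (u : Dom μ a b) : rep u = contRep (u : DomE μ a b).1 := rfl

theorem evalL_apply {x : ℝ} (hx : a ≤ x) (u : Dom μ a b) : evalL μ a b x u = rep u x := by
  rw [evalL, ContinuousLinearMap.comp_apply, innerSL_apply_apply, derivL_apply,
    inner_indicator_wderiv _ hx, contRep_left, one_mul, sub_zero, rep_apply]

theorem rep_right (hab : a < b) (u : Dom μ a b) : rep u b = 0 := contRep_right hab _

theorem rep_left (u : Dom μ a b) : rep u a = 0 := contRep_left _

theorem abs_rep_sub_le (u : Dom μ a b) {x y : ℝ} (hxy : x ≤ y) :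
    |rep u y - rep u x| ≤ √(y - x) * ‖derivL μ a b u‖ := by
  rw [rep_apply, derivL_apply]; exact abs_contRep_sub_le _ hxy

theorem inner_tentGrad_derivL {l c r : ℝ} (u : Dom μ a b) (hlc : l < c) (hcr : c < r) :
    inner ℝ (tentGrad a b l c r) (derivL μ a b u) =
      1 / (c - l) * (rep u c - rep u l) - 1 / (r - c) * (rep u r - rep u c) := by
  rw [derivL_apply, rep_apply]; exact inner_tentGrad _ hlc hcr

theorem exists_Dom_tent (hab : a < b) (hsupp : μ.support = Icc a b) {l c r : ℝ} (hal : a ≤ l)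
    (hlc : l < c) (hcr : c < r) (hrb : r ≤ b) : ∃ φ : Dom μ a b,
      derivL μ a b φ = tentGrad a b l c r ∧ ∀ x ∈ Icc a b, rep φ x = tentFun l c r x := by
  obtain ⟨φ, h1, h2⟩ := exists_tent hal hlc hcr hrb
  let ψ : DomE μ a b := ⟨φ, by rw [DomE_eq_top hab hsupp]; trivial⟩
  exact ⟨ψ, h1, h2⟩

theorem embL_injective : Function.Injective (embL μ a b) := toL2mu_injective

theorem inner_embL (hsupp : μ.support = Icc a b) (u v : Dom μ a b) :
    inner ℝ (embL μ a b u) (embL μ a b v) = ∫ x in Icc a b, rep u x * rep v x ∂μ := by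
  rw [integral_eq_setIntegral_Icc hsupp]; exact inner_toL2mu (u : DomE μ a b) v

end DomType

section DomProb

variable {μ : Measure ℝ} [IsProbabilityMeasure μ] {a b : ℝ}

theorem norm_embL_le_of_bound (hsupp : μ.support = Icc a b) (u : Dom μ a b) {C : ℝ} (hC : 0 ≤ C)
    (h : ∀ x ∈ Icc a b, |rep u x| ≤ C) : ‖embL μ a b u‖ ≤ C :=
  norm_toL2mu_le_of_bound hsupp (u : DomE μ a b) hC h

theorem norm_embL_le (hsupp : μ.support = Icc a b) (u : Dom μ a b) :
    ‖embL μ a b u‖ ≤ √(b - a) * ‖derivL μ a b u‖ :=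
  norm_toL2mu_le hsupp (u : DomE μ a b)

end DomProb

/-! ### Interpolation at the nodes of a partition -/

/-- `x 0 < ⋯ < x n` is a partition of `[a, b]` of mesh at most `δ`. -/
structure IsPartition (a b δ : ℝ) (n : ℕ) (x : ℕ → ℝ) : Prop where
  first : x 0 = a
  last : x n = b
  lt_succ : ∀ k < n, x k < x (k + 1)
  mesh : ∀ k < n, x (k + 1) - x k ≤ δ

/-- The tent functions of a partition, as elements of `Dom ℰ`. -/
structure IsTentBasis {μ : Measure ℝ} [IsFiniteMeasure μ] {a b : ℝ} (n : ℕ) (x : ℕ → ℝ)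
    (Φ : ℕ → Dom μ a b) : Prop where
  deriv_eq : ∀ j ∈ Finset.Ioo 0 n, derivL μ a b (Φ j) = tentGrad a b (x (j - 1)) (x j) (x (j + 1))
  rep_eq : ∀ j ∈ Finset.Ioo 0 n, ∀ y ∈ Icc a b,
    rep (Φ j) y = tentFun (x (j - 1)) (x j) (x (j + 1)) y

namespace IsPartition

variable {a b δ : ℝ} {n : ℕ} {x : ℕ → ℝ} (X : IsPartition a b δ n x)
include X

theorem mono {i j : ℕ} (hij : i ≤ j) (hj : j ≤ n) : x i ≤ x j := by
  induction j, hij using Nat.le_induction with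
  | base => exact le_rfl
  | succ k _ ih => exact (ih (by omega)).trans (X.lt_succ k (by omega)).le

theorem mem_Icc {j : ℕ} (hj : j ≤ n) : x j ∈ Icc a b :=
  ⟨X.first ▸ X.mono (Nat.zero_le j) hj, X.last ▸ X.mono hj le_rfl⟩

theorem lt_left {j : ℕ} (hj : j ∈ Finset.Ioo 0 n) : x (j - 1) < x j := by
  rw [Finset.mem_Ioo] at hj
  have := X.lt_succ (j - 1) (by omega)
  rwa [Nat.sub_add_cancel (by omega)] at this

theorem lt_right {j : ℕ} (hj : j ∈ Finset.Ioo 0 n) : x j < x (j + 1) :=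
  X.lt_succ j (Finset.mem_Ioo.mp hj).2

theorem exists_mem {y : ℝ} (hy : y ∈ Icc a b) (hn : 0 < n) :
    ∃ k < n, x k ≤ y ∧ y ≤ x (k + 1) := by
  classical
  have hex : ∃ k, y ≤ x (k + 1) ∧ k < n :=
    ⟨n - 1, by rw [Nat.sub_add_cancel (by omega), X.last]; exact hy.2, by omega⟩
  obtain ⟨h1, h2⟩ := Nat.find_spec hex
  refine ⟨Nat.find hex, h2, ?_, h1⟩
  rcases Nat.eq_zero_or_pos (Nat.find hex) with h | h
  · rw [h, X.first]; exact hy.1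
  · by_contra hlt
    refine Nat.find_min hex (m := Nat.find hex - 1) (by omega) ⟨?_, by omega⟩
    rw [Nat.sub_add_cancel (by omega)]
    exact (not_le.mp hlt).le

theorem exists_tentBasis {μ : Measure ℝ} [IsFiniteMeasure μ] (hab : a < b)
    (hsupp : μ.support = Icc a b) : ∃ Φ : ℕ → Dom μ a b, IsTentBasis n x Φ := by
  have : ∀ j, ∃ φ : Dom μ a b, j ∈ Finset.Ioo 0 n →
      derivL μ a b φ = tentGrad a b (x (j - 1)) (x j) (x (j + 1)) ∧
      ∀ y ∈ Icc a b, rep φ y = tentFun (x (j - 1)) (x j) (x (j + 1)) y := fun j => by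
    by_cases hj : j ∈ Finset.Ioo 0 n
    · have hj' := Finset.mem_Ioo.mp hj
      obtain ⟨φ, h⟩ := exists_Dom_tent hab hsupp (X.mem_Icc (by omega : j - 1 ≤ n)).1
        (X.lt_left hj) (X.lt_right hj) (X.mem_Icc (by omega : j + 1 ≤ n)).2
      exact ⟨φ, fun _ => h⟩
    · exact ⟨0, fun h => absurd h hj⟩
  choose Φ hΦ using this
  exact ⟨Φ, fun j hj => (hΦ j hj).1, fun j hj => (hΦ j hj).2⟩

end IsPartition

section Interpolation

/-- The piecewise linear interpolation operator. -/
def interp {μ : Measure ℝ} [IsFiniteMeasure μ] {a b : ℝ} (n : ℕ) (x : ℕ → ℝ)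
    (Φ : ℕ → Dom μ a b) : Dom μ a b →L[ℝ] Dom μ a b :=
  ∑ j ∈ Finset.Ioo 0 n, (evalL μ a b (x j)).smulRight (Φ j)

theorem interp_apply {μ : Measure ℝ} [IsFiniteMeasure μ] {a b : ℝ} (n : ℕ) (x : ℕ → ℝ)
    (Φ : ℕ → Dom μ a b) (w : Dom μ a b) :
    interp n x Φ w = ∑ j ∈ Finset.Ioo 0 n, evalL μ a b (x j) w • Φ j := by
  simp [interp]

variable {μ : Measure ℝ} [IsFiniteMeasure μ] {a b δ : ℝ} {n : ℕ} {x : ℕ → ℝ} {Φ : ℕ → Dom μ a b}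
  (X : IsPartition a b δ n x) (B : IsTentBasis n x Φ)
include X B

theorem evalL_basis {i j : ℕ} (hi : i ∈ Finset.Ioo 0 n) (hj : j ∈ Finset.Ioo 0 n) :
    evalL μ a b (x i) (Φ j) = if i = j then 1 else 0 := by
  have hi' := Finset.mem_Ioo.mp hi
  have hj' := Finset.mem_Ioo.mp hj
  have hm := X.mem_Icc (by omega : i ≤ n)
  rw [evalL_apply hm.1, B.rep_eq j hj _ hm]
  split_ifs with h
  · rw [h, tentFun_center (X.lt_left hj)]
  · rcases Nat.lt_or_gt_of_ne h with h | h
    · exact tentFun_of_le (X.lt_left hj) (X.lt_right hj) (X.mono (by omega) (by omega))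
    · exact tentFun_of_ge (X.lt_left hj) (X.lt_right hj) (X.mono (by omega) (by omega))

theorem evalL_sum_basis (k : ℕ → ℝ) {i : ℕ} (hi : i ∈ Finset.Ioo 0 n) :
    evalL μ a b (x i) (∑ j ∈ Finset.Ioo 0 n, k j • Φ j) = k i := by
  rw [map_sum, Finset.sum_eq_single i]
  · rw [map_smul, evalL_basis X B hi hi, if_pos rfl, smul_eq_mul, mul_one]
  · intro j hj hne
    rw [map_smul, evalL_basis X B hi hj, if_neg hne.symm, smul_zero]
  · intro h; exact absurd hi h

theorem interp_sum_basis (k : ℕ → ℝ) :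
    interp n x Φ (∑ j ∈ Finset.Ioo 0 n, k j • Φ j) = ∑ j ∈ Finset.Ioo 0 n, k j • Φ j := by
  rw [interp_apply]
  exact Finset.sum_congr rfl fun i hi => by rw [evalL_sum_basis X B k hi]

theorem interp_interp (w : Dom μ a b) : interp n x Φ (interp n x Φ w) = interp n x Φ w := by
  rw [interp_apply (w := w), interp_sum_basis X B]

theorem rep_sub_interp (hab : a < b) (w : Dom μ a b) {i : ℕ} (hi : i ≤ n) :
    rep (w - interp n x Φ w) (x i) = 0 := by
  rcases Nat.eq_zero_or_pos i with h0 | h0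
  · rw [h0, X.first, rep_left]
  rcases hi.eq_or_lt with h1 | h1
  · rw [h1, X.last, rep_right hab]
  · rw [← evalL_apply (X.mem_Icc hi).1, map_sub, interp_apply,
      evalL_sum_basis X B _ (Finset.mem_Ioo.mpr ⟨h0, h1⟩), sub_self]

/-- The error `w - P w` vanishes at every node, end-points included, and a fixed vector of `P` is a
combination of tents. -/
theorem interp_ritz (hab : a < b) (w v : Dom μ a b) (hv : interp n x Φ v = v) :
    inner ℝ (derivL μ a b (w - interp n x Φ w)) (derivL μ a b v) = 0 := by
  rw [← hv, interp_apply (w := v), map_sum, inner_sum]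
  refine Finset.sum_eq_zero fun j hj => ?_
  have hj' := Finset.mem_Ioo.mp hj
  rw [map_smul, inner_smul_right, B.deriv_eq j hj, real_inner_comm,
    inner_tentGrad_derivL _ (X.lt_left hj) (X.lt_right hj),
    rep_sub_interp X B hab w (by omega : j - 1 ≤ n), rep_sub_interp X B hab w (by omega : j ≤ n),
    rep_sub_interp X B hab w (by omega : j + 1 ≤ n)]
  ring

/-- Pythagoras for the energy-orthogonal splitting of `w` into `w - P w` and `P w`. -/
theorem norm_derivL_sub_interp_le (hab : a < b) (w : Dom μ a b) :
    ‖derivL μ a b (w - interp n x Φ w)‖ ≤ ‖derivL μ a b w‖ := by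
  have h := interp_ritz X B hab w (interp n x Φ w) (interp_interp X B w)
  have e : derivL μ a b w = derivL μ a b (w - interp n x Φ w) + derivL μ a b (interp n x Φ w) := by
    rw [← map_add, sub_add_cancel]
  have h2 := norm_add_sq_eq_norm_sq_add_norm_sq_of_inner_eq_zero _ _ h
  rw [← e] at h2
  refine le_of_sq_le_sq ?_ (norm_nonneg _)
  nlinarith [sq_nonneg ‖derivL μ a b (interp n x Φ w)‖]

end Interpolation

/-- The error vanishes at the left node of the cell containing `y`, so the Hölder bound over one
cell controls it uniformly; the mass of `μ` is one. -/
theorem norm_embL_sub_interp_le {μ : Measure ℝ} [IsProbabilityMeasure μ] {a b δ : ℝ} {n : ℕ}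
    {x : ℕ → ℝ} {Φ : ℕ → Dom μ a b} (X : IsPartition a b δ n x) (B : IsTentBasis n x Φ)
    (hab : a < b) (hn : 0 < n) (hsupp : μ.support = Icc a b) (w : Dom μ a b) :
    ‖embL μ a b (w - interp n x Φ w)‖ ≤ √δ * ‖derivL μ a b w‖ := by
  refine norm_embL_le_of_bound hsupp _ (by positivity) fun y hy => ?_
  obtain ⟨k, hk, h1, h2⟩ := X.exists_mem hy hn
  have h := abs_rep_sub_le (w - interp n x Φ w) h1
  rw [rep_sub_interp X B hab w hk.le, sub_zero] at h
  refine h.trans ?_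
  gcongr
  · linarith [X.mesh k hk]
  · exact norm_derivL_sub_interp_le X B hab w

/-! ### The finite element system as a Galerkin method -/

section FEM

theorem hasDerivAt_sum_smul {V : Type*} [NormedAddCommGroup V] [NormedSpace ℝ V] {s : Finset ℕ}
    {k' : ℕ → ℝ} {f : ℕ → ℝ → ℝ} (Φ : ℕ → V) {t : ℝ}
    (h : ∀ j ∈ s, HasDerivAt (f j) (k' j) t) :
    HasDerivAt (fun t => ∑ j ∈ s, f j t • Φ j) (∑ j ∈ s, k' j • Φ j) t := by
  have := HasDerivAt.fun_sum fun j hj => (h j hj).smul_const (Φ j)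
  exact this

/-- The element `∑ j, β_j(t) φ_j` of `Dom ℰ`. -/
def femDom {μ : Measure ℝ} [IsFiniteMeasure μ] {a b : ℝ} (n : ℕ) (Φ : ℕ → Dom μ a b)
    (β : ℕ → ℝ → ℝ) (t : ℝ) : Dom μ a b := ∑ j ∈ Finset.Ioo 0 n, β j t • Φ j

variable {N : ℕ} {A : AuxIFS N} {a b τ δ : ℝ} {m : ℕ} {β : ℕ → ℝ → ℝ}

theorem tent_eq (j : ℕ) : A.tent a b m j =
    tentFun (A.node a b m (j - 1)) (A.node a b m j) (A.node a b m (j + 1)) := rfl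

theorem inner_sum_sum {V H : Type*} [NormedAddCommGroup V] [NormedSpace ℝ V]
    [NormedAddCommGroup H] [InnerProductSpace ℝ H] (L : V →L[ℝ] H) (s : Finset ℕ) (k c : ℕ → ℝ)
    (Φ : ℕ → V) : inner ℝ (L (∑ j ∈ s, k j • Φ j)) (L (∑ i ∈ s, c i • Φ i)) =
      ∑ i ∈ s, c i * ∑ j ∈ s, inner ℝ (L (Φ i)) (L (Φ j)) * k j := by
  simp only [map_sum, map_smul, sum_inner, inner_sum, inner_smul_left, inner_smul_right,
    Finset.mul_sum]
  refine Finset.sum_congr rfl fun i _ => Finset.sum_congr rfl fun j _ => ?_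
  rw [real_inner_comm (L (Φ j))]
  simp only [conj_trivial]; ring

theorem mass_eq {μ : Measure ℝ} [IsFiniteMeasure μ] {Φ : ℕ → Dom μ a b}
    (B : IsTentBasis (N ^ m) (A.node a b m) Φ) (hsupp : μ.support = Icc a b) {i j : ℕ}
    (hi : i ∈ Finset.Ioo 0 (N ^ m)) (hj : j ∈ Finset.Ioo 0 (N ^ m)) :
    A.mass μ a b m i j = inner ℝ (embL μ a b (Φ i)) (embL μ a b (Φ j)) := by
  rw [inner_embL hsupp, AuxIFS.mass]
  refine setIntegral_congr_fun measurableSet_Icc fun x hx => ?_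
  simp only [tent_eq, B.rep_eq i hi x hx, B.rep_eq j hj x hx]

theorem stiffness_eq {μ : Measure ℝ} [IsFiniteMeasure μ] {Φ : ℕ → Dom μ a b} (hab : a < b)
    (X : IsPartition a b δ (N ^ m) (A.node a b m))
    (B : IsTentBasis (N ^ m) (A.node a b m) Φ) {i j : ℕ}
    (hi : i ∈ Finset.Ioo 0 (N ^ m)) (hj : j ∈ Finset.Ioo 0 (N ^ m)) :
    A.stiffness a b m i j = -inner ℝ (derivL μ a b (Φ i)) (derivL μ a b (Φ j)) := by
  rw [AuxIFS.stiffness, intervalIntegral.integral_of_le hab.le, integral_Ioc_eq_integral_Ioo,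
    B.deriv_eq i hi, B.deriv_eq j hj, L2_inner_eq]
  congr 1
  refine integral_congr_ae ?_
  filter_upwards [tentGrad_ae (a := a) (b := b) (X.lt_left hi) (X.lt_right hi),
    tentGrad_ae (a := a) (b := b) (X.lt_left hj) (X.lt_right hj)] with x h1 h2
  rw [h1, h2]; rfl

/-- The mass and negated stiffness matrices are the Gram matrices of the tents for the `L²_μ` and
energy products, and nodal initial values are those of the interpolants of `g` and `h`. -/
theorem AuxIFS.IsFEMSolution.isGalerkin {μ : Measure ℝ} [IsProbabilityMeasure μ]
    {Φ : ℕ → Dom μ a b} {g h : Dom μ a b} (hab : a < b) (hsupp : μ.support = Icc a b)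
    (hn : 0 < N ^ m) (X : IsPartition a b δ (N ^ m) (A.node a b m))
    (B : IsTentBasis (N ^ m) (A.node a b m) Φ)
    (hF : A.IsFEMSolution μ a b τ (rep g) (rep h) m β) :
    IsGalerkin (embL μ a b) (derivL μ a b) (interp (N ^ m) (A.node a b m) Φ) τ √δ g h
      (femDom (N ^ m) Φ β) (femDom (N ^ m) Φ fun j => deriv (β j))
      (femDom (N ^ m) Φ fun j => iteratedDeriv 2 (β j)) where
  idem := interp_interp X B
  ritz := interp_ritz X B hab
  approx := norm_embL_sub_interp_le X B hab hn hsupp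
  mem t := interp_sum_basis X B _
  mem1 t := interp_sum_basis X B _
  mem2 t := interp_sum_basis X B _
  hasDeriv t := hasDerivAt_sum_smul Φ fun j hj =>
    ((hF.contDiff j hj).differentiable (by norm_num) t).hasDerivAt
  hasDeriv1 t := hasDerivAt_sum_smul Φ fun j hj => by
    change HasDerivAt (deriv (β j)) (iteratedDeriv 2 (β j) t) t
    rw [iteratedDeriv_succ, iteratedDeriv_one]
    have h2 : ContDiff ℝ (1 + 1) (β j) := hF.contDiff j hj
    exact ((contDiff_succ_iff_deriv.mp h2).2.2.differentiable (by norm_num) t).hasDerivAt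
  cont2 := continuous_finsetSum _ fun j hj =>
    ((hF.contDiff j hj).continuous_iteratedDeriv 2 le_rfl).smul continuous_const
  eqn t ht v hv := by
    -- A discrete `v` is the combination of tents with its nodal values as coefficients, so the
    -- tested equation is the same combination of rows of the system.
    rw [← hv, interp_apply, femDom, femDom, inner_sum_sum, inner_sum_sum, ← Finset.sum_add_distrib]
    refine Finset.sum_eq_zero fun i hi => ?_
    have h1 := hF.ode t ht i hi
    have e1 : ∑ j ∈ AuxIFS.interior N m, A.mass μ a b m i j * iteratedDeriv 2 (β j) t =
        ∑ j ∈ Finset.Ioo 0 (N ^ m), inner ℝ (embL μ a b (Φ i)) (embL μ a b (Φ j)) *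
          iteratedDeriv 2 (β j) t :=
      Finset.sum_congr rfl fun j hj => by rw [mass_eq B hsupp hi hj]
    have e2 : ∑ j ∈ AuxIFS.interior N m, A.stiffness a b m i j * β j t =
        -∑ j ∈ Finset.Ioo 0 (N ^ m), inner ℝ (derivL μ a b (Φ i)) (derivL μ a b (Φ j)) * β j t := by
      rw [← Finset.sum_neg_distrib]
      exact Finset.sum_congr rfl fun j hj => by rw [stiffness_eq hab X B hi hj, neg_mul]
    rw [e1, e2] at h1
    rw [h1]; ring
  init := by
    rw [interp_apply, femDom]
    refine Finset.sum_congr rfl fun j hj => ?_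
    rw [hF.init_pos j hj, evalL_apply (X.mem_Icc (Finset.mem_Ioo.mp hj).2.le).1]
  init1 := by
    rw [interp_apply, femDom]
    refine Finset.sum_congr rfl fun j hj => ?_
    rw [hF.init_vel j hj, evalL_apply (X.mem_Icc (Finset.mem_Ioo.mp hj).2.le).1]

theorem errorNorm_eq {μ : Measure ℝ} [IsFiniteMeasure μ] {Φ : ℕ → Dom μ a b}
    (hsupp : μ.support = Icc a b)
    (B : IsTentBasis (N ^ m) (A.node a b m) Φ) (t : ℝ) (u : Dom μ a b) :
    errorNorm (A.femSum a b m β t) (u : DomE μ a b) = ‖embL μ a b (femDom (N ^ m) Φ β t - u)‖ := by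
  have hlin : ∀ x ∈ Icc a b, rep (femDom (N ^ m) Φ β t - u) x = A.femSum a b m β t x - rep u x := by
    intro x hx
    rw [← evalL_apply hx.1, map_sub, femDom, map_sum, evalL_apply hx.1 u, AuxIFS.femSum]
    congr 1
    refine Finset.sum_congr rfl fun j hj => ?_
    rw [map_smul, evalL_apply hx.1, B.rep_eq j hj x hx, tent_eq, smul_eq_mul]
  rw [← Real.sqrt_sq (norm_nonneg (embL μ a b _)), ← real_inner_self_eq_norm_sq, inner_embL hsupp]
  refine congrArg Real.sqrt ?_
  refine setIntegral_congr_fun measurableSet_Icc fun x hx => ?_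
  rw [hlin x hx, sq]; rfl

end FEM

/-! ### Weak solutions, integrated in time -/

section Weak

theorem HasWeakTimeDeriv.map {X : Type*} [NormedAddCommGroup X] [NormedSpace ℝ X]
    [CompleteSpace X] {τ : ℝ}
    {u v : ℝ → X} (huv : HasWeakTimeDeriv τ u v) (hu : IntegrableOn u (Ioo 0 τ))
    (hv : IntegrableOn v (Ioo 0 τ)) (L : X →L[ℝ] ℝ) :
    HasWeakTimeDeriv τ (fun t => L (u t)) (fun t => L (v t)) := by
  intro φ h1 h2 h3
  have hc : Continuous (deriv φ) := h1.continuous_deriv (by simp)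
  have e := congrArg L (huv φ h1 h2 h3)
  rw [map_neg, ← L.integral_comp_comm (integrable_test_smul hu hc h2.deriv),
    ← L.integral_comp_comm (integrable_test_smul hv h1.continuous h2)] at e
  simpa using e

/-- A continuous vector-valued function with a weak derivative, tested against a functional. -/
theorem HasWeakTimeDeriv.map_eq_primitive {X : Type*} [NormedAddCommGroup X] [NormedSpace ℝ X]
    [CompleteSpace X] {τ : ℝ} (hτ : 0 < τ) {u v : ℝ → X} (huv : HasWeakTimeDeriv τ u v)
    (hu : ContinuousOn u (Icc 0 τ)) (hv : MemLp v 2 (volume.restrict (Ioo 0 τ))) (L : X →L[ℝ] ℝ)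
    {t : ℝ} (ht : t ∈ Icc 0 τ) : L (u t) = L (u 0) + ∫ s in (0 : ℝ)..t, L (v s) := by
  have hvi : IntegrableOn v (Ioo 0 τ) := hv.integrable (by norm_num)
  have hui : IntegrableOn u (Ioo 0 τ) := hu.integrableOn_Icc.mono_set Ioo_subset_Icc_self
  exact (huv.map hui hvi L).eq_primitive hτ (L.continuous.comp_continuousOn hu)
    (L.integrable_comp hvi) ht

theorem intervalIntegrable_of_memLp {V : Type*} [NormedAddCommGroup V] {τ : ℝ} (hτ : 0 ≤ τ)
    {f : ℝ → V} (hf : MemLp f 2 (volume.restrict (Ioo 0 τ))) : IntervalIntegrable f volume 0 τ := by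
  rw [intervalIntegrable_iff_integrableOn_Ioo_of_le hτ]
  exact hf.integrable (by norm_num)

variable {μ : Measure ℝ} [IsFiniteMeasure μ] {a b τ : ℝ} {g h : DomE μ a b} {u : ℝ → DomE μ a b}
  {u₁ : ℝ → Lp ℝ 2 μ} {u₂ : ℝ → StrongDual ℝ (DomE μ a b)}

/-- An element of `DomE`, as a term of the type `Dom`. -/
def ofDomE (u : DomE μ a b) : Dom μ a b := u

/-- The curve `u`, with values in the type `Dom`. -/
def toDom (u : ℝ → DomE μ a b) (t : ℝ) : Dom μ a b := ofDomE (u t)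

theorem IsWeakSolution.intervalIntegrable (hτ : 0 < τ)
    (S : IsWeakSolution μ a b τ (fun _ => 0) g (toL2mu μ h) u u₁ u₂) :
    IntervalIntegrable (toDom u) volume 0 τ := by
  have : MemLp (toDom u) 2 (volume.restrict (Ioo 0 τ)) := S.memLp_u
  exact intervalIntegrable_of_memLp hτ.le this

/-- The evaluation of functionals on `Dom ℰ` at a vector. -/
def evalDual (v : DomE μ a b) : StrongDual ℝ (DomE μ a b) →L[ℝ] ℝ :=
  (ContinuousLinearMap.apply ℝ ℝ (ofDomE v) : StrongDual ℝ (Dom μ a b) →L[ℝ] ℝ)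

theorem evalDual_apply (v : DomE μ a b) (f : StrongDual ℝ (DomE μ a b)) : evalDual v f = f v := rfl

/-- Since `u_t` is differentiable only as a curve in the dual space, it is recovered by testing with
a fixed `v`. -/
theorem IsWeakSolution.velocity_eq (hτ : 0 < τ)
    (S : IsWeakSolution μ a b τ (fun _ => 0) g (toL2mu μ h) u u₁ u₂) (v : DomE μ a b) {t : ℝ}
    (ht : t ∈ Icc 0 τ) : inner ℝ (u₁ t) (toL2mu μ v) =
      inner ℝ (toL2mu μ h) (toL2mu μ v) + ∫ s in (0 : ℝ)..t, u₂ s v := by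
  have := S.deriv_ut.map_eq_primitive hτ S.continuous_ut S.memLp_utt
    (evalDual v) ht
  simp only [S.init_vel, evalDual_apply] at this
  exact this

theorem IsWeakSolution.dual_eq
    (S : IsWeakSolution μ a b τ (fun _ => 0) g (toL2mu μ h) u u₁ u₂) (v : DomE μ a b) :
    ∀ᵐ s ∂(volume.restrict (Ioo 0 τ)), u₂ s v = -inner ℝ (gradL μ a b (u s)) (gradL μ a b v) := by
  filter_upwards [S.equation v] with s hs
  rw [energy_eq, map_zero, inner_zero_left] at hs
  exact eq_neg_of_add_eq_zero_left hs

theorem ae_interval_of_ae {p : ℝ → Prop} (hp : ∀ᵐ s ∂(volume.restrict (Ioo 0 τ)), p s) {t : ℝ}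
    (ht : t ∈ Icc 0 τ) : ∀ᵐ s ∂volume, s ∈ Set.uIoc 0 t → p s := by
  rw [restrict_Ioo_eq_restrict_Ioc, ae_restrict_iff' measurableSet_Ioc] at hp
  filter_upwards [hp] with s hs hs'
  rw [uIoc_of_le ht.1] at hs'
  exact hs ⟨hs'.1, hs'.2.trans ht.2⟩

theorem IsWeakSolution.velocity_eq' (hτ : 0 < τ)
    (S : IsWeakSolution μ a b τ (fun _ => 0) g (toL2mu μ h) u u₁ u₂) (v : Dom μ a b) {t : ℝ}
    (ht : t ∈ Icc 0 τ) : inner ℝ (u₁ t) (embL μ a b v) =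
      inner ℝ (embL μ a b (ofDomE h)) (embL μ a b v) -
        inner ℝ (derivL μ a b (prim (toDom u) t)) (derivL μ a b v) := by
  have h1 := S.velocity_eq hτ v ht
  have h2 : ∫ s in (0 : ℝ)..t, u₂ s v = -pairing (derivL μ a b) v (prim (toDom u) t) := by
    rw [map_prim _ (S.intervalIntegrable hτ) ht, prim, ← intervalIntegral.integral_neg]
    refine intervalIntegral.integral_congr_ae (ae_interval_of_ae (τ := τ) ?_ ht)
    filter_upwards [S.dual_eq v] with s hs
    rw [pairing_apply]
    exact hs
  rw [h2, pairing_apply, ← sub_eq_add_neg] at h1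
  exact h1

theorem IsWeakSolution.position_eq (hτ : 0 < τ)
    (S : IsWeakSolution μ a b τ (fun _ => 0) g (toL2mu μ h) u u₁ u₂) (v : Dom μ a b) {t : ℝ}
    (ht : t ∈ Icc 0 τ) : inner ℝ (embL μ a b (toDom u t)) (embL μ a b v) =
      inner ℝ (embL μ a b (ofDomE g)) (embL μ a b v) + prim (fun s => inner ℝ (u₁ s) (embL μ a b v)) t := by
  have hi : IntegrableOn u₁ (Ioo 0 τ) := S.memLp_ut.integrable (by norm_num)
  have h1 := S.deriv_u.eq_primitive hτ S.continuous_u hi ht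
  simp only [S.init_pos] at h1
  have h2 : embL μ a b (toDom u t) = embL μ a b (ofDomE g) + ∫ s in (0 : ℝ)..t, u₁ s := h1
  have hii := intervalIntegrable_mono_Icc (intervalIntegrable_of_memLp hτ.le S.memLp_ut) ht
  rw [h2, inner_add_left, add_right_inj, real_inner_comm]
  have := ((innerSL ℝ (embL μ a b v)).intervalIntegral_comp_comm hii).symm
  rw [innerSL_apply_apply] at this
  rw [this, prim]
  exact intervalIntegral.integral_congr fun s _ => by
    simp only [innerSL_apply_apply]; rw [real_inner_comm]

theorem IsWeakSolution.isIntegratedSolution (hτ : 0 < τ)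
    (S : IsWeakSolution μ a b τ (fun _ => 0) g (toL2mu μ h) u u₁ u₂) :
    IsIntegratedSolution (embL μ a b) (derivL μ a b) τ (ofDomE g) (ofDomE h) (toDom u) where
  integrable := S.intervalIntegrable hτ
  cont := S.continuous_u
  eqn t ht v := by
    have hi := intervalIntegrable_prim hτ.le (S.intervalIntegrable hτ)
    rw [S.position_eq hτ v ht, prim_congr_Icc (fun s hs => S.velocity_eq' hτ v hs) ht, map_add,
      map_smul, inner_add_left, inner_smul_left, ← pairing_apply (derivL μ a b),
      map_prim _ hi ht]
    have e : prim (fun s => inner ℝ (embL μ a b (ofDomE h)) (embL μ a b v) -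
        inner ℝ (derivL μ a b (prim (toDom u) s)) (derivL μ a b v)) t =
        t * inner ℝ (embL μ a b (ofDomE h)) (embL μ a b v) -
          prim (fun s => pairing (derivL μ a b) v (prim (toDom u) s)) t := by
      simp_rw [← pairing_apply (derivL μ a b)]
      rw [prim_sub (by simp) (intervalIntegrable_map _ hi) ht]
      simp [prim]
    rw [e]
    simp only [conj_trivial]
    ring

theorem IsWeakSolution.isRegularSolution (hτ : 0 < τ)
    (S : IsWeakSolution μ a b τ (fun _ => 0) g (toL2mu μ h) u u₁ u₂) {utt : ℝ → DomE μ a b}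
    (R : IsDomEValued τ u₂ utt) :
    IsRegularSolution (embL μ a b) (derivL μ a b) τ (ofDomE g) (ofDomE h) (toDom u) (toDom utt) := by
  have hm : MemLp (toDom utt) 2 (volume.restrict (Ioo 0 τ)) := R.memLp
  have hi := intervalIntegrable_of_memLp hτ.le hm
  have hi1 := intervalIntegrable_prim hτ.le hi
  have hvel : ∀ t ∈ Icc 0 τ, ∀ v : Dom μ a b, inner ℝ (u₁ t) (embL μ a b v) =
      inner ℝ (embL μ a b (ofDomE h)) (embL μ a b v) + pairing (embL μ a b) v (prim (toDom utt) t) := by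
    intro t ht v
    have h1 := S.velocity_eq hτ v ht
    have h2 : ∫ s in (0 : ℝ)..t, u₂ s v = pairing (embL μ a b) v (prim (toDom utt) t) := by
      rw [map_prim _ hi ht, prim]
      refine intervalIntegral.integral_congr_ae (ae_interval_of_ae (τ := τ) ?_ ht)
      filter_upwards [R.ae_eq] with s hs
      rw [pairing_apply, hs]; rfl
    rw [h2] at h1
    exact h1
  refine ⟨S.intervalIntegrable hτ, hi, fun t ht => ?_, fun t ht v => ?_⟩
  -- The identity is known only after testing in `L²_μ`. Testing with the defect `w` itself gives
  -- `‖w‖_μ = 0`, and the embedding of `Dom ℰ` is injective.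
  · rw [← sub_eq_zero]
    set w : Dom μ a b := toDom u t - (ofDomE g + t • ofDomE h +
      prim (prim (toDom utt)) t) with hw
    have e := S.position_eq hτ w ht
    rw [prim_congr_Icc (fun s hs => hvel s hs w) ht, prim,
      intervalIntegral.integral_add (by simp)
        (intervalIntegrable_mono_Icc (intervalIntegrable_map _ hi1) ht)] at e
    change _ = _ + (_ + prim (fun s => pairing (embL μ a b) w (prim (toDom utt) s)) t) at e
    rw [← map_prim _ hi1 ht, pairing_apply, intervalIntegral.integral_const, sub_zero,
      smul_eq_mul] at e
    have e2 : inner ℝ (embL μ a b w) (embL μ a b w) = 0 := by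
      have e4 : embL μ a b w = embL μ a b (toDom u t) - (embL μ a b (ofDomE g) +
          t • embL μ a b (ofDomE h) + embL μ a b (prim (prim (toDom utt)) t)) := by
        rw [hw, map_sub, map_add, map_add, map_smul]
      generalize embL μ a b w = z at e e4
      nth_rewrite 1 [e4]
      rw [inner_sub_left, inner_add_left, inner_add_left, inner_smul_left, conj_trivial, e]
      ring
    have e3 : embL μ a b w = embL μ a b 0 := by rw [inner_self_eq_zero.mp e2, map_zero]
    exact embL_injective e3
  · have e1 := hvel t ht v
    rw [S.velocity_eq' hτ v ht, pairing_apply] at e1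
    linarith

end Weak

/-! ### Error estimates for the finite element approximation -/

section Error

variable {μ : Measure ℝ} {a b τ : ℝ} {N m : ℕ} {A : AuxIFS N}

theorem AuxIFS.exists_preimage (hsupp : μ.support = Icc a b) (hA : A.SecondOrderIdentities μ) :
    ∀ x ∈ Icc a b, ∃ j, ∃ y ∈ Icc a b, A.T j y = x := by
  intro x hx
  have h := hA.1
  rw [hsupp] at h
  obtain ⟨j, y, hy, hyx⟩ := mem_iUnion.mp (h hx)
  exact ⟨j, y, hy, hyx⟩

variable (A m) in
/-- The square root of the bound `ρ ^ m * (b - a)` for the mesh size of level `m`. -/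
def meshRoot (a b : ℝ) : ℝ := √(b - a) * A.rho ^ ((m : ℝ) / 2)

theorem meshRoot_nonneg : 0 ≤ meshRoot m A a b :=
  mul_nonneg (Real.sqrt_nonneg _) (Real.rpow_nonneg A.rho_nonneg _)

theorem sqrt_mesh_eq : √(A.rho ^ m * (b - a)) = meshRoot m A a b := by
  rw [Real.sqrt_mul (pow_nonneg A.rho_nonneg m), mul_comm, meshRoot, Real.sqrt_eq_rpow (A.rho ^ m),
    ← Real.rpow_natCast, ← Real.rpow_mul A.rho_nonneg, mul_one_div]

theorem tendsto_meshRoot :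
    Filter.Tendsto (fun m => meshRoot m A a b) Filter.atTop (nhds 0) := by
  have h := ((tendsto_pow_atTop_nhds_zero_of_lt_one A.rho_nonneg A.rho_lt_one).mul_const
    (b - a)).sqrt
  rw [zero_mul, Real.sqrt_zero] at h
  exact h.congr fun m => sqrt_mesh_eq

theorem AuxIFS.IsFEMSolution.exists_isGalerkin [IsProbabilityMeasure μ] {g h : DomE μ a b}
    {β : ℕ → ℝ → ℝ} (hF : A.IsFEMSolution μ a b τ (toFun g) (toFun h) m β) (hab : a < b)
    (hsupp : μ.support = Icc a b) (hA : A.SecondOrderIdentities μ) (hosc : A.OpenSetCondition) :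
    ∃ (P : Dom μ a b →L[ℝ] Dom μ a b) (um um1 um2 : ℝ → Dom μ a b),
      IsGalerkin (embL μ a b) (derivL μ a b) P τ (meshRoot m A a b) (ofDomE g) (ofDomE h)
        um um1 um2 ∧
      ∀ (t : ℝ) (w : DomE μ a b), errorNorm (A.femSum a b m β t) w =
        ‖embL μ a b (um t - ofDomE w)‖ := by
  have hcov := AuxIFS.exists_preimage hsupp hA
  -- That the point `a` is covered forces `N ≥ 1`, so there is at least one cell.
  obtain ⟨j, -⟩ := hcov a (left_mem_Icc.mpr hab.le)
  have hn : 0 < N ^ m := pow_pos j.pos m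
  obtain ⟨h1, h2, h3⟩ := A.node_spec hab hosc hcov m
  have X : IsPartition a b (A.rho ^ m * (b - a)) (N ^ m) (A.node a b m) :=
    ⟨h1, h2, fun k hk => (h3 k hk).1, fun k hk => (h3 k hk).2⟩
  obtain ⟨Φ, B⟩ := X.exists_tentBasis (μ := μ) hab hsupp
  have G := AuxIFS.IsFEMSolution.isGalerkin (g := ofDomE g) (h := ofDomE h) hab hsupp hn X B hF
  rw [sqrt_mesh_eq] at G
  exact ⟨_, _, _, _, G, fun t w => errorNorm_eq hsupp B t (ofDomE w)⟩

variable [IsProbabilityMeasure μ] {g h : DomE μ a b} {u : ℝ → DomE μ a b} {u₁ : ℝ → Lp ℝ 2 μ}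
  {u₂ : ℝ → StrongDual ℝ (DomE μ a b)} {utt : ℝ → DomE μ a b} {t : ℝ}

theorem IsWeakSolution.tendsto_errorNorm
    (S : IsWeakSolution μ a b τ (fun _ => 0) g (toL2mu μ h) u u₁ u₂) (hτ : 0 < τ) (hab : a < b)
    (hsupp : μ.support = Icc a b) (hA : A.SecondOrderIdentities μ) (hosc : A.OpenSetCondition)
    {β : ℕ → ℕ → ℝ → ℝ}
    (hF : ∀ m, 1 ≤ m → A.IsFEMSolution μ a b τ (toFun g) (toFun h) m (β m)) (ht : t ∈ Icc 0 τ) :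
    Filter.Tendsto (fun m => errorNorm (A.femSum a b m (β m) t) (u t)) Filter.atTop (nhds 0) := by
  rw [Metric.tendsto_nhds]
  intro η hη
  obtain ⟨ε₀, hε₀, H⟩ := (S.isIntegratedSolution hτ).exists_error_le hτ (Real.sqrt_nonneg (b - a))
    (norm_embL_le hsupp) ht (half_pos hη)
  filter_upwards [Filter.eventually_ge_atTop 1,
    (tendsto_meshRoot (A := A) (a := a) (b := b)).eventually_le_const hε₀] with m hm hle
  obtain ⟨P, um, um1, um2, G, he⟩ := (hF m hm).exists_isGalerkin hab hsupp hA hosc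
  rw [Real.dist_eq, sub_zero, he, abs_of_nonneg (norm_nonneg _)]
  exact (H P _ um um1 um2 meshRoot_nonneg hle G).trans_lt (half_lt_self hη)

theorem IsDomEValued.integral_norm_le (R : IsDomEValued τ u₂ utt) (hτ : 0 < τ) :
    ∫ s in (0 : ℝ)..τ, ‖derivL μ a b (toDom utt s)‖ ≤ √τ * bochnerNorm τ utt := by
  have hm : MemLp (toDom utt) 2 (volume.restrict (Ioo 0 τ)) := R.memLp
  have h := integral_norm_le_sqrt hτ ((derivL μ a b).comp_memLp' hm)
  refine h.trans_eq (congrArg (√τ * ·) (congrArg Real.sqrt ?_))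
  refine integral_congr_ae (Filter.Eventually.of_forall fun s => ?_)
  exact congrArg (· ^ 2) (domNorm_eq (utt s)).symm

/-- The error is split at `P u(t)`. The discrete part is bounded in energy, with one factor `√(b -
a)` from the mesh and another from passing to `L²_μ`; the projection part has only the factor from
the mesh. -/
theorem AuxIFS.IsFEMSolution.errorNorm_le {β : ℕ → ℝ → ℝ}
    (hF : A.IsFEMSolution μ a b τ (toFun g) (toFun h) m β)
    (S : IsWeakSolution μ a b τ (fun _ => 0) g (toL2mu μ h) u u₁ u₂)
    (R : IsDomEValued τ u₂ utt) (hτ : 0 < τ) (hab : a < b)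
    (hsupp : μ.support = Icc a b) (hA : A.SecondOrderIdentities μ) (hosc : A.OpenSetCondition)
    (ht : t ∈ Icc 0 τ) :
    errorNorm (A.femSum a b m β t) (u t) ≤
      (2 * (b - a) * √τ * bochnerNorm τ utt + √(b - a) * domNorm (u t)) *
        A.rho ^ ((m : ℝ) / 2) := by
  obtain ⟨P, um, um1, um2, G, he⟩ := hF.exists_isGalerkin hab hsupp hA hosc
  have hD := G.norm_D_error_le (S.isRegularSolution hτ R) ht
  set E := meshRoot m A a b with hE
  have hE0 : 0 ≤ E := meshRoot_nonneg
  have hI := mul_le_mul_of_nonneg_left (R.integral_norm_le hτ) hE0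
  have h1 := G.approx (toDom u t)
  have h2 : ‖derivL μ a b (toDom u t)‖ = domNorm (u t) := (domNorm_eq (u t)).symm
  have h3 : ‖embL μ a b (P (toDom u t) - um t)‖ ≤
      √(b - a) * (2 * (E * (√τ * bochnerNorm τ utt))) :=
    (norm_embL_le hsupp _).trans (mul_le_mul_of_nonneg_left (by linarith) (Real.sqrt_nonneg _))
  have h4 : embL μ a b (um t - toDom u t) =
      -embL μ a b (P (toDom u t) - um t) - embL μ a b (toDom u t - P (toDom u t)) := by
    simp only [map_sub]; abel
  rw [he]
  change ‖embL μ a b (um t - toDom u t)‖ ≤ _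
  rw [h4]
  refine (norm_sub_le _ _).trans ?_
  rw [norm_neg]
  rw [h2] at h1
  refine (add_le_add h3 h1).trans_eq ?_
  rw [hE, meshRoot]
  linear_combination (2 * √τ * bochnerNorm τ utt * A.rho ^ ((m : ℝ) / 2)) *
    Real.mul_self_sqrt (sub_pos.mpr hab).le

/-- The constant that bounds a regular solution by its second time derivative. -/
def growthConst (κ τ : ℝ) : ℝ := 78 / τ ^ 2 * (κ ^ 2 * τ + τ ^ 3) + τ

theorem growthConst_pos (κ : ℝ) (hτ : 0 < τ) : 0 < growthConst κ τ := by
  rw [growthConst]; positivity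

theorem IsWeakSolution.domNorm_le
    (S : IsWeakSolution μ a b τ (fun _ => 0) g (toL2mu μ h) u u₁ u₂)
    (R : IsDomEValued τ u₂ utt) (hτ : 0 < τ) (hsupp : μ.support = Icc a b) (ht : t ∈ Icc 0 τ) :
    domNorm (u t) ≤ growthConst (√(b - a)) τ * (√τ * bochnerNorm τ utt) := by
  have h := (S.isRegularSolution hτ R).norm_D_le hτ (Real.sqrt_nonneg (b - a))
    (norm_embL_le hsupp) ht
  rw [domNorm_eq]
  exact h.trans (mul_le_mul_of_nonneg_left (R.integral_norm_le hτ) (growthConst_pos _ hτ).le)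

end Error

end

end FractalWave

/-! ### The main theorem: convergence and the two error bounds. -/

theorem theorem1p3
    (μ : Measure ℝ) [IsProbabilityMeasure μ] (a b : ℝ) (hab : a < b)
    {q : ℕ} (c s p : Fin q → ℝ) (hμ : FractalWave.IsSelfSimilar μ c s p)
    (hsupp : μ.support = Icc a b)
    {N : ℕ} (A : FractalWave.AuxIFS N) (hA : A.SecondOrderIdentities μ)
    (hosc : A.OpenSetCondition) :
    -- the approximations converge to the weak solution in `L²_μ[a,b]`, at every fixed time
    (∀ τ : ℝ, 0 < τ → ∀ (g h : FractalWave.DomE μ a b) (u : ℝ → FractalWave.DomE μ a b)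
      (u₁ : ℝ → Lp ℝ 2 μ) (u₂ : ℝ → StrongDual ℝ (FractalWave.DomE μ a b)),
      FractalWave.IsWeakSolution μ a b τ (fun _ => 0) g (FractalWave.toL2mu μ h) u u₁ u₂ →
      ∀ β : ℕ → ℕ → ℝ → ℝ,
      (∀ m, 1 ≤ m → A.IsFEMSolution μ a b τ (FractalWave.toFun g) (FractalWave.toFun h) m (β m)) →
      ∀ t ∈ Icc 0 τ,
        Filter.Tendsto (fun m => FractalWave.errorNorm (A.femSum a b m (β m) t) (u t))
          Filter.atTop (nhds 0)) ∧
    -- the rate, with `C` depending only on the measure, the IFS and `τ`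
    (∀ τ : ℝ, 0 < τ → ∃ C : ℝ, 0 < C ∧
      ∀ (g h : FractalWave.DomE μ a b) (u : ℝ → FractalWave.DomE μ a b)
      (u₁ : ℝ → Lp ℝ 2 μ) (u₂ : ℝ → StrongDual ℝ (FractalWave.DomE μ a b)),
      FractalWave.IsWeakSolution μ a b τ (fun _ => 0) g (FractalWave.toL2mu μ h) u u₁ u₂ →
      ∀ utt : ℝ → FractalWave.DomE μ a b, FractalWave.IsDomEValued τ u₂ utt →
      ∀ (m : ℕ) (β : ℕ → ℝ → ℝ), 1 ≤ m →
      A.IsFEMSolution μ a b τ (FractalWave.toFun g) (FractalWave.toFun h) m β →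
      ∀ t ∈ Icc 0 τ,
        FractalWave.errorNorm (A.femSum a b m β t) (u t) ≤
          (C * √τ * FractalWave.bochnerNorm τ utt + 2 * FractalWave.domNorm (u t)) *
            A.rho ^ ((m : ℝ) / 2)) ∧
    -- the rate, with `C` independent of `τ` too; the length of the interval then enters
    (∃ C : ℝ, 0 < C ∧ ∀ τ : ℝ, 0 < τ →
      ∀ (g h : FractalWave.DomE μ a b) (u : ℝ → FractalWave.DomE μ a b)
      (u₁ : ℝ → Lp ℝ 2 μ) (u₂ : ℝ → StrongDual ℝ (FractalWave.DomE μ a b)),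
      FractalWave.IsWeakSolution μ a b τ (fun _ => 0) g (FractalWave.toL2mu μ h) u u₁ u₂ →
      ∀ utt : ℝ → FractalWave.DomE μ a b, FractalWave.IsDomEValued τ u₂ utt →
      ∀ (m : ℕ) (β : ℕ → ℝ → ℝ), 1 ≤ m →
      A.IsFEMSolution μ a b τ (FractalWave.toFun g) (FractalWave.toFun h) m β →
      ∀ t ∈ Icc 0 τ,
        FractalWave.errorNorm (A.femSum a b m β t) (u t) ≤
          (C * √τ * FractalWave.bochnerNorm τ utt +
            2 * √(b - a) * FractalWave.domNorm (u t)) * A.rho ^ ((m : ℝ) / 2)) := by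
  have hba : 0 < b - a := sub_pos.mpr hab
  -- In the second claim the coefficient `√(b - a)` of `‖u(t)‖` may exceed `2`, so this whole term
  -- is absorbed into the `u_tt` term by `domNorm_le`, at the price of a constant depending on `τ`.
  -- In the third claim the factor `√(b - a)` is kept, and `2 (b - a)` suffices.
  refine ⟨fun τ hτ g h u u₁ u₂ S β hF t ht => S.tendsto_errorNorm hτ hab hsupp hA hosc hF ht,
    fun τ hτ => ⟨2 * (b - a) + √(b - a) * FractalWave.growthConst (√(b - a)) τ, ?_, ?_⟩,
    2 * (b - a), by positivity, ?_⟩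
  · have := FractalWave.growthConst_pos (√(b - a)) hτ
    positivity
  · intro g h u u₁ u₂ S utt R m β _ hF t ht
    refine (hF.errorNorm_le S R hτ hab hsupp hA hosc ht).trans
      (mul_le_mul_of_nonneg_right ?_ (Real.rpow_nonneg A.rho_nonneg _))
    have h1 := mul_le_mul_of_nonneg_left (S.domNorm_le R hτ hsupp ht) (Real.sqrt_nonneg (b - a))
    have h2 : 0 ≤ FractalWave.domNorm (u t) := Real.sqrt_nonneg _
    linarith
  · intro τ hτ g h u u₁ u₂ S utt R m β _ hF t ht
    refine (hF.errorNorm_le S R hτ hab hsupp hA hosc ht).trans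
      (mul_le_mul_of_nonneg_right ?_ (Real.rpow_nonneg A.rho_nonneg _))
    have h2 : 0 ≤ √(b - a) * FractalWave.domNorm (u t) := by
      rw [FractalWave.domNorm]; positivity
    linarith
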